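/- Let $(A,P,\Pi,P^\vee,\Pi^\vee)$ be a Cartan datum with finite index set $I$: $A=(a_{ij})$ is a generalized Cartan matrix, $d_i\in\mathbb Z_{>0}$ with $d_ia_{ij}=d_ja_{ji}$, $P$ is a free abelian group of finite rank with linearly independent simple roots $\alpha_i\in P$ and simple coroots $\alpha_i^\vee\in\operatorname{Hom}(P,\mathbb Z)$, $\langle\alpha_i^\vee,\alpha_j\rangle=a_{ij}$, and fundamental weights exist in $P$. Put $(\alpha_i,\alpha_j)=d_ia_{ij}$. Let $\Bbbk=\bigoplus_{r\ge 0}\Bbbk_r$ be a graded commutative integral domain, and let $Q_{ij}(u,v)\in\Bbbk[u,v]$ $(i,j\in I)$ satisfy $Q_{ij}(u,v)=Q_{ji}(v,u)$, $Q_{ii}=0$ and, for $i\ne j$, $Q_{ij}(u,v)=\sum_{p,q\ge 0}c_{i,j,p,q}u^pv^q$ with $c_{i,j,p,q}\in\Bbbk_{-2(\alpha_i,\alpha_j)-(\alpha_i,\alpha_i)p-(\alpha_j,\alpha_j)q}$ (components of negative degree being $0$) and $c_{i,j,-a_{ij},0}\in\Bbbk_0^\times$. Let $\Lambda\in P$ be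 a dominant integral weight, and for each $i\in I$ let $a_i^\Lambda(u)\in\Bbbk[u]$ be monic of degree $\langle\alpha_i^\vee,\Lambda\rangle$ such that the coefficient of $u^{\langle\alpha_i^\vee,\Lambda\rangle-r}$ lies in $\Bbbk_{r(\alpha_i,\alpha_i)}$ for all $0\le r\le\langle\alpha_i^\vee,\Lambda\rangle$. Let $\beta=\sum_i\beta_i\alpha_i$ with $\beta_i\in\mathbb Z_{\ge0}$ and $\sum_i\beta_i=n$, and let $I^\beta=\{\nu\in I^n:\alpha_{\nu_1}+\dots+\alpha_{\nu_n}=\beta\}$, on which the symmetric group $\mathfrak S_n$ acts by $(w.\nu)_r=\nu_{w^{-1}(r)}$. Let $\mathscr R_\beta$ be the Khovanov–Lauda–Rouquier algebra, that is, the associative $\Bbbk$-algebra with generators $e(\nu)$ $(\nu\in I^\beta)$, $x_1,\dots,x_n$, $\tau_1,\dots,\tau_{n-1}$ and relations $$e(\nu)e(\nu')=\delta_{\nu,\nu'}e(\nu),\quad \sum_{\nu\in I^\beta} e(\nu)=1,\quad x_kx_l=x_lx_k,\quad x_ke(\nu)=e(\nu)x_k,$$ $$\tau_le(\nu)=e(s_l.\nu)\tau_l,\quad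 \tau_k\tau_l=\tau_l\tau_k\ (|k-l|>1),\quad \tau_k^2e(\nu)=Q_{\nu_k,\nu_{k+1}}(x_k,x_{k+1})e(\nu),$$ $$(\tau_kx_l-x_{s_k(l)}\tau_k)e(\nu)=\begin{cases}-e(\nu)&l=k,\ \nu_k=\nu_{k+1}\\ e(\nu)&l=k+1,\ \nu_k=\nu_{k+1}\\0&\text{otherwise,}\end{cases}$$ $$(\tau_{k+1}\tau_k\tau_{k+1}-\tau_k\tau_{k+1}\tau_k)e(\nu)=\begin{cases}\dfrac{Q_{\nu_k,\nu_{k+1}}(x_k,x_{k+1})-Q_{\nu_{k+2},\nu_{k+1}}(x_{k+2},x_{k+1})}{x_k-x_{k+2}}\,e(\nu)&\nu_k=\nu_{k+2}\\0&\text{otherwise.}\end{cases}$$ Let $\mathscr R_\beta^\Lambda$ be the quotient of $\mathscr R_\beta$ by the two-sided ideal generated by $\sum_{\nu\in I^\beta}a^\Lambda_{\nu_1}(x_1)e(\nu)$ (by the zero ideal if $n=0$). For each $w\in\mathfrak S_n$ choose any reduced expression $w=s_{i_1}\cdots s_{i_r}$ and put $\tau_w=\tau_{i_1}\cdots\tau_{i_r}$.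 For $\underline a\in\mathbb N^n$ put $x^{\underline a}=x_1^{a_1}\cdots x_n^{a_n}$. Suppose that $\widetilde\nu\in I^\beta$ has the block form $$\widetilde\nu=(\underbrace{i_1,\dots,i_1}_{k_1},\underbrace{i_2,\dots,i_2}_{k_2},\dots,\underbrace{i_p,\dots,i_p}_{k_p})$$ with $i_1,\dots,i_p\in I$ pairwise distinct, and write $i_s\prec i_t$ if $s<t$. For $\nu\in I^\beta$ let $\mathfrak S(\nu,\widetilde\nu)=\{w\in\mathfrak S_n: w.\nu=\widetilde\nu\}$. For all $\nu\in I^\beta$ define recursively $g^\Lambda_{\nu,1}=a^\Lambda_{\nu_1}(x_1)$ and, for $1\le k<n$, $$g^\Lambda_{\nu,k+1}=\begin{cases}\partial_k(g^\Lambda_{\nu,k})&\nu_k=\nu_{k+1}\\ s_k(g^\Lambda_{s_k.\nu,k})&\nu_k\succ\nu_{k+1}\\ s_k(g^\Lambda_{s_k.\nu,k})\,Q_{\nu_k,\nu_{k+1}}(x_k,x_{k+1})&\nu_k\prec\nu_{k+1},\end{cases}$$ where $s_k$ exchanges $x_k$ and $x_{k+1}$ and $\partial_k(f)=\dfrac{f-s_k(f)}{x_{k+1}-x_k}$.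 Fix $\nu\in I^\beta$ and let $N_k$ be the degree of $g^\Lambda_{\nu,k}$ as a polynomial in $x_k$ (with $N_k=0$ if $g^\Lambda_{\nu,k}=0$). Then the canonical images in $\mathscr R_\beta^\Lambda$ of the elements $$\tau_wx^{\underline a}e(\nu),\qquad w\in\mathfrak S(\nu,\widetilde\nu),\quad \underline a\in\mathbb N^n,\quad a_k<N_k\ \text{ for all } 1\le k\le n,$$ form a $\Bbbk$-basis of the bi-weight space $e(\widetilde\nu)\mathscr R_\beta^\Lambda e(\nu)$. -/

import Mathlib

open scoped Polynomial

noncomputable section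

namespace CycKLR

/-! ### Cartan data -/

/-- A Cartan datum with index set `I` and weight lattice `P` (a free abelian group of finite rank):
a generalized Cartan matrix `A`, a symmetrization `d`, simple roots and simple coroots. -/
structure CartanDatum (I P : Type*) [DecidableEq I] [AddCommGroup P]
    [Module.Free ℤ P] [Module.Finite ℤ P] where
  /-- the generalized Cartan matrix -/
  A : Matrix I I ℤ
  diag : ∀ i, A i i = 2
  offDiag : ∀ i j, i ≠ j → A i j ≤ 0
  zero_iff : ∀ i j, A i j = 0 ↔ A j i = 0
  /-- the diagonal matrix with positive integral entries which makes `A` symmetric -/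
  d : I → ℕ
  d_pos : ∀ i, 0 < d i
  symm : ∀ i j, (d i : ℤ) * A i j = (d j : ℤ) * A j i
  /-- the simple roots -/
  root : I → P
  /-- the simple coroots, as elements of the dual weight lattice -/
  coroot : I → (P →ₗ[ℤ] ℤ)
  pairing : ∀ i j, coroot i (root j) = A i j
  linearIndependent_root : LinearIndependent ℤ root
  exists_fundamental : ∀ i, ∃ Λ : P, ∀ j, coroot j Λ = if j = i then 1 else 0

namespace CartanDatum

variable {I P : Type*} [DecidableEq I] [AddCommGroup P] [Module.Free ℤ P] [Module.Finite ℤ P]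

/-- The value `(α_i, α_j) = d_i a_{ij}` of the symmetric bilinear form on simple roots. -/
def form (D : CartanDatum I P) (i j : I) : ℤ := (D.d i : ℤ) * D.A i j

/-- `Λ` is a dominant integral weight. -/
def IsDominant (D : CartanDatum I P) (Λ : P) : Prop := ∀ i, 0 ≤ D.coroot i Λ

end CartanDatum

/-! ### The parameters of the algebras -/

section Parameters

variable {k : Type*} [CommRing k]

/-- `c` is homogeneous of degree `m`, for an integer `m`, with respect to a grading by natural
numbers; the homogeneous components of negative degree are zero. -/
def HomogOfDegree (𝒜 : ℕ → AddSubgroup k) (m : ℤ) (c : k) : Prop :=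
  c = 0 ∨ ∃ r : ℕ, (r : ℤ) = m ∧ c ∈ 𝒜 r

/-- The coefficient of `u ^ p * v ^ q` in a polynomial in the two variables `u`, `v`
(indexed by `0` and `1`). -/
def coeff₂ (f : MvPolynomial (Fin 2) k) (p q : ℕ) : k :=
  f.coeff (Finsupp.single 0 p + Finsupp.single 1 q)

variable {I P : Type*} [DecidableEq I] [AddCommGroup P] [Module.Free ℤ P] [Module.Finite ℤ P]

/-- The conditions on the matrix of polynomials `Q_{ij}(u, v)` that enters the definition of the
Khovanov-Lauda-Rouquier algebras. -/
structure IsQMatrix (D : CartanDatum I P) (𝒜 : ℕ → AddSubgroup k) [GradedRing 𝒜]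
    (Q : I → I → MvPolynomial (Fin 2) k) : Prop where
  symm : ∀ i j, Q i j = MvPolynomial.rename (Equiv.swap (0 : Fin 2) 1) (Q j i)
  diag : ∀ i, Q i i = 0
  homog : ∀ i j, i ≠ j → ∀ p q : ℕ,
    HomogOfDegree 𝒜 (-2 * D.form i j - D.form i i * p - D.form j j * q) (coeff₂ (Q i j) p q)
  unit : ∀ i j, i ≠ j → ∃ c : (𝒜 0)ˣ, ((c : 𝒜 0) : k) = coeff₂ (Q i j) (-D.A i j).toNat 0

/-- The conditions on the family of polynomials `a_i(u)` that defines a cyclotomic quotient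
for the dominant weight `Λ`. -/
structure IsCyclotomicFamily (D : CartanDatum I P) (𝒜 : ℕ → AddSubgroup k) (Λ : P)
    (a : I → k[X]) : Prop where
  monic : ∀ i, (a i).Monic
  natDegree : ∀ i, ((a i).natDegree : ℤ) = D.coroot i Λ
  homog : ∀ i, ∀ r ≤ (a i).natDegree,
    HomogOfDegree 𝒜 (r * D.form i i) ((a i).coeff ((a i).natDegree - r))

end Parameters

/-! ### Positions, simple transpositions and sequences of weights

Positions are numbered `0, …, n - 1`, and the simple transposition with index `l : Fin (n - 1)`
exchanges the positions `l` and `l + 1`. -/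

/-- The position `l`. -/
def lo {n : ℕ} (l : Fin (n - 1)) : Fin n := ⟨l, by omega⟩

/-- The position `l + 1`. -/
def hi {n : ℕ} (l : Fin (n - 1)) : Fin n := ⟨l + 1, by omega⟩

/-- The simple transposition exchanging `l` and `l + 1`. -/
def simpleTransp {n : ℕ} (l : Fin (n - 1)) : Equiv.Perm (Fin n) := Equiv.swap (lo l) (hi l)

/-- `L` is a reduced expression of the permutation `w`. -/
def IsReducedExpr {n : ℕ} (w : Equiv.Perm (Fin n)) (L : List (Fin (n - 1))) : Prop :=
  (L.map simpleTransp).prod = w ∧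
    ∀ L' : List (Fin (n - 1)), (L'.map simpleTransp).prod = w → L.length ≤ L'.length

/-- The action of permutations on sequences, `(w.ν)_r = ν_{w⁻¹(r)}`. -/
def permAct {I : Type*} {n : ℕ} (w : Equiv.Perm (Fin n)) (ν : Fin n → I) : Fin n → I :=
  fun r => ν (w⁻¹ r)

/-- The set `I^β` of sequences `ν` of length `n` with `α_{ν_1} + ⋯ + α_{ν_n} = β`, where
`β = ∑ β_i α_i` is given by its coefficients. -/
abbrev Seqs (I : Type*) [DecidableEq I] (n : ℕ) (β : I → ℕ) : Type _ :=
  {ν : Fin n → I // ∀ i, (Finset.univ.filter fun r => ν r = i).card = β i}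

/-- The action of permutations on `I^β`. -/
def Seqs.act {I : Type*} [DecidableEq I] {n : ℕ} {β : I → ℕ} (w : Equiv.Perm (Fin n))
    (ν : Seqs I n β) : Seqs I n β :=
  ⟨permAct w ν.1, fun i => by
    rw [← ν.2 i]
    exact Finset.card_equiv w⁻¹ (fun r => by
      rw [Finset.mem_filter, Finset.mem_filter]
      simp [permAct])⟩

/-! ### Divided differences and evaluation of polynomials at commuting elements -/

section Polynomials

variable {k : Type*} [CommRing k] {n : ℕ}

/-- The substitution `f ↦ w f` with `(w f)(x_1, …, x_n) = f(x_{w(1)}, …, x_{w(n)})`. -/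
def permPoly (w : Equiv.Perm (Fin n)) (f : MvPolynomial (Fin n) k) : MvPolynomial (Fin n) k :=
  MvPolynomial.rename w f

theorem dvd_sub_swap (b c : Fin n) (f : MvPolynomial (Fin n) k) :
    (MvPolynomial.X b - MvPolynomial.X c : MvPolynomial (Fin n) k) ∣
      f - permPoly (Equiv.swap b c) f := by
  unfold permPoly
  induction f using MvPolynomial.induction_on with
  | C r => simp
  | add p q hp hq =>
    have h := dvd_add hp hq
    rw [map_add]
    convert h using 1
    ring
  | mul_X p r hp =>
    have hX : (MvPolynomial.X b - MvPolynomial.X c : MvPolynomial (Fin n) k) ∣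
        MvPolynomial.X r - MvPolynomial.X (Equiv.swap b c r) := by
      rcases eq_or_ne r b with rfl | hb
      · simp
      · rcases eq_or_ne r c with rfl | hc
        · rw [Equiv.swap_apply_right]
          exact ⟨-1, by ring⟩
        · rw [Equiv.swap_apply_of_ne_of_ne hb hc]
          simp
    rw [map_mul, MvPolynomial.rename_X]
    have h := dvd_add (Dvd.dvd.mul_right hp (MvPolynomial.X r))
      (Dvd.dvd.mul_left hX (MvPolynomial.rename (Equiv.swap b c) p))
    convert h using 1
    ring

/-- The divided difference `(f - s f) / (x_b - x_c)`, where `s` exchanges `x_b` and `x_c`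
(for `b ≠ c`). -/
def divDiff (b c : Fin n) (f : MvPolynomial (Fin n) k) : MvPolynomial (Fin n) k :=
  Classical.choose (dvd_sub_swap b c f)

theorem divDiff_spec (b c : Fin n) (f : MvPolynomial (Fin n) k) :
    (MvPolynomial.X b - MvPolynomial.X c) * divDiff b c f = f - permPoly (Equiv.swap b c) f :=
  (Classical.choose_spec (dvd_sub_swap b c f)).symm

/-- The Demazure operator `∂_l f = (f - s_l f) / (x_{l+1} - x_l)`. -/
def demazure (l : Fin (n - 1)) (f : MvPolynomial (Fin n) k) : MvPolynomial (Fin n) k :=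
  divDiff (hi l) (lo l) f

theorem demazure_spec (l : Fin (n - 1)) (f : MvPolynomial (Fin n) k) :
    (MvPolynomial.X (hi l) - MvPolynomial.X (lo l)) * demazure l f =
      f - permPoly (simpleTransp l) f := by
  rw [demazure, divDiff_spec, simpleTransp, Equiv.swap_comm]

/-- The polynomial `q(x_b, x_c)`. -/
def subst₂ (q : MvPolynomial (Fin 2) k) (b c : Fin n) : MvPolynomial (Fin n) k :=
  MvPolynomial.aeval ![MvPolynomial.X b, MvPolynomial.X c] q

/-- The monomial `x_1 ^ m_1 * ⋯ * x_n ^ m_n`, in this order, in a possibly noncommutative ring. -/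
def monom {B : Type*} [Ring B] (x : Fin n → B) (m : Fin n → ℕ) : B :=
  (List.ofFn fun r => x r ^ m r).prod

/-- The value of a polynomial at elements `x_1, …, x_n` of a `k`-algebra, computed with ordered
monomials. It is used for pairwise commuting elements, and for the generators of a free algebra
on which commutation relations are going to be imposed. -/
def evalAt {B : Type*} [Ring B] [Algebra k B] (x : Fin n → B) (f : MvPolynomial (Fin n) k) : B :=
  ∑ m ∈ f.support, f.coeff m • monom x m

end Polynomials

/-! ### Khovanov-Lauda-Rouquier algebras -/

/-- The generators `e(ν)`, `x_r` and `τ_l`. -/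
inductive Gen (I : Type*) [DecidableEq I] (n : ℕ) (β : I → ℕ) : Type _
  | e (ν : Seqs I n β) : Gen I n β
  | x (r : Fin n) : Gen I n β
  | τ (l : Fin (n - 1)) : Gen I n β

section KLR

variable {k : Type*} [CommRing k] {I : Type*} [Fintype I] [DecidableEq I]

/-- The free algebra on the generators. -/
abbrev FreeKLR (k : Type*) [CommRing k] {I : Type*} [DecidableEq I] (n : ℕ) (β : I → ℕ) : Type _ :=
  FreeAlgebra k (Gen I n β)

/-- The generator `e(ν)` of the free algebra. -/
def fe (k : Type*) [CommRing k] {I : Type*} [DecidableEq I] {n : ℕ} {β : I → ℕ}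
    (ν : Seqs I n β) : FreeKLR k n β := FreeAlgebra.ι k (Gen.e ν)

/-- The generator `x_r` of the free algebra. -/
def fx (k : Type*) [CommRing k] {I : Type*} [DecidableEq I] {n : ℕ} (β : I → ℕ)
    (r : Fin n) : FreeKLR k n β := FreeAlgebra.ι k (Gen.x r)

/-- The generator `τ_l` of the free algebra. -/
def fτ (k : Type*) [CommRing k] {I : Type*} [DecidableEq I] {n : ℕ} (β : I → ℕ)
    (l : Fin (n - 1)) : FreeKLR k n β := FreeAlgebra.ι k (Gen.τ l)

/-- The defining relations of the Khovanov-Lauda-Rouquier algebra. -/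
inductive KLRRel (Q : I → I → MvPolynomial (Fin 2) k) (n : ℕ) (β : I → ℕ) :
    FreeKLR k n β → FreeKLR k n β → Prop
  | e_mul_self (ν : Seqs I n β) : KLRRel Q n β (fe k ν * fe k ν) (fe k ν)
  | e_mul_ne (ν ν' : Seqs I n β) (h : ν ≠ ν') : KLRRel Q n β (fe k ν * fe k ν') 0
  | sum_e : KLRRel Q n β (∑ ν : Seqs I n β, fe k ν) 1
  | x_comm (r t : Fin n) : KLRRel Q n β (fx k β r * fx k β t) (fx k β t * fx k β r)
  | x_e (r : Fin n) (ν : Seqs I n β) : KLRRel Q n β (fx k β r * fe k ν) (fe k ν * fx k β r)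
  | τ_e (l : Fin (n - 1)) (ν : Seqs I n β) :
      KLRRel Q n β (fτ k β l * fe k ν) (fe k (Seqs.act (simpleTransp l) ν) * fτ k β l)
  | τ_comm (l m : Fin (n - 1)) (h : l.val + 1 < m.val ∨ m.val + 1 < l.val) :
      KLRRel Q n β (fτ k β l * fτ k β m) (fτ k β m * fτ k β l)
  | τ_sq (l : Fin (n - 1)) (ν : Seqs I n β) :
      KLRRel Q n β (fτ k β l * fτ k β l * fe k ν)
        (evalAt (fx k β) (subst₂ (Q (ν.1 (lo l)) (ν.1 (hi l))) (lo l) (hi l)) * fe k ν)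
  | τ_x_lo (l : Fin (n - 1)) (ν : Seqs I n β) (h : ν.1 (lo l) = ν.1 (hi l)) :
      KLRRel Q n β
        ((fτ k β l * fx k β (lo l) - fx k β (simpleTransp l (lo l)) * fτ k β l) * fe k ν) (-fe k ν)
  | τ_x_hi (l : Fin (n - 1)) (ν : Seqs I n β) (h : ν.1 (lo l) = ν.1 (hi l)) :
      KLRRel Q n β
        ((fτ k β l * fx k β (hi l) - fx k β (simpleTransp l (hi l)) * fτ k β l) * fe k ν) (fe k ν)
  | τ_x_other (l : Fin (n - 1)) (r : Fin n) (ν : Seqs I n β)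
      (h : ¬ ((r = lo l ∨ r = hi l) ∧ ν.1 (lo l) = ν.1 (hi l))) :
      KLRRel Q n β
        ((fτ k β l * fx k β r - fx k β (simpleTransp l r) * fτ k β l) * fe k ν) 0
  /- In the next relation `ν_l = ν_{l+2}`, so that the divided difference with respect to `x_l` and
  `x_{l+2}` is `(Q_{ν_l,ν_{l+1}}(x_l,x_{l+1}) - Q_{ν_{l+2},ν_{l+1}}(x_{l+2},x_{l+1}))` divided by
  `x_l - x_{l+2}`. -/
  | braid_eq (l m : Fin (n - 1)) (hlm : m.val = l.val + 1) (ν : Seqs I n β)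
      (h : ν.1 (lo l) = ν.1 (hi m)) :
      KLRRel Q n β
        ((fτ k β m * fτ k β l * fτ k β m - fτ k β l * fτ k β m * fτ k β l) * fe k ν)
        (evalAt (fx k β)
          (divDiff (lo l) (hi m) (subst₂ (Q (ν.1 (lo l)) (ν.1 (hi l))) (lo l) (hi l))) * fe k ν)
  | braid_ne (l m : Fin (n - 1)) (hlm : m.val = l.val + 1) (ν : Seqs I n β)
      (h : ν.1 (lo l) ≠ ν.1 (hi m)) :
      KLRRel Q n β
        ((fτ k β m * fτ k β l * fτ k β m - fτ k β l * fτ k β m * fτ k β l) * fe k ν) 0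

/-- The Khovanov-Lauda-Rouquier algebra `R_β`, a `k`-algebra. -/
abbrev KLR (Q : I → I → MvPolynomial (Fin 2) k) (n : ℕ) (β : I → ℕ) : Type _ :=
  RingQuot (KLRRel Q n β)

variable (Q : I → I → MvPolynomial (Fin 2) k) {n : ℕ} (β : I → ℕ)

/-- The idempotent `e(ν)` of `R_β`. -/
def klrE {β : I → ℕ} (ν : Seqs I n β) : KLR Q n β := RingQuot.mkAlgHom k (KLRRel Q n β) (fe k ν)

/-- The element `x_r` of `R_β`. -/
def klrX (r : Fin n) : KLR Q n β := RingQuot.mkAlgHom k (KLRRel Q n β) (fx k β r)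

/-- The element `τ_l` of `R_β`. -/
def klrτ (l : Fin (n - 1)) : KLR Q n β := RingQuot.mkAlgHom k (KLRRel Q n β) (fτ k β l)

/-- The product of the `τ_l` along a word. -/
def klrτWord (L : List (Fin (n - 1))) : KLR Q n β := (L.map (klrτ Q β)).prod

/-- The element `∑_ν a_{ν_r}(x_r) e(ν)` of `R_β`. -/
def cycElem (a : I → k[X]) (r : Fin n) : KLR Q n β :=
  ∑ ν : Seqs I n β, Polynomial.aeval (klrX Q β r) (a (ν.1 r)) * klrE Q ν

/-- The two-sided ideal of `R_β` generated by `∑_ν a_{ν_1}(x_1) e(ν)`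
(the zero ideal if `n = 0`, when there is no `x_1`). -/
def cycIdeal (n : ℕ) (a : I → k[X]) : TwoSidedIdeal (KLR Q n β) :=
  TwoSidedIdeal.span {y | ∃ r : Fin n, r.val = 0 ∧ y = cycElem Q β a r}

/-- The cyclotomic Khovanov-Lauda-Rouquier algebra, the quotient of `R_β` by `cycIdeal`. -/
abbrev CycKLRAlg (n : ℕ) (a : I → k[X]) : Type _ := (cycIdeal Q β n a).ringCon.Quotient

/-- The canonical surjection from `R_β` to its cyclotomic quotient. -/
def toCyc (a : I → k[X]) (y : KLR Q n β) : CycKLRAlg Q β n a :=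
  (cycIdeal Q β n a).ringCon.mk' y

/-- The bi-weight space `e(μ) R e(ν)` of the cyclotomic quotient `R`, as a `k`-submodule. -/
def biweightSpace {β : I → ℕ} (a : I → k[X]) (μ ν : Seqs I n β) :
    Submodule k (CycKLRAlg Q β n a) :=
  LinearMap.range (LinearMap.mulLeftRight k (toCyc Q β a (klrE Q μ), toCyc Q β a (klrE Q ν)))

end KLR

/-! ### The polynomials `g_{ν,r}` -/

section G

variable {k : Type*} [CommRing k] {I : Type*} [DecidableEq I]

open Classical in
/-- The polynomial attached to the sequence `ν` and the position `r`, for a relation `prec` on `I`.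
It is set to `0` if `r` is not one of the positions `0, …, n - 1`. -/
def gPolyAux (Q : I → I → MvPolynomial (Fin 2) k) (a : I → k[X]) (prec : I → I → Prop) {n : ℕ} :
    ℕ → (Fin n → I) → MvPolynomial (Fin n) k
  | 0, ν => if h : 0 < n then Polynomial.aeval (MvPolynomial.X ⟨0, h⟩) (a (ν ⟨0, h⟩)) else 0
  | r + 1, ν =>
    if h : r < n - 1 then
      let l : Fin (n - 1) := ⟨r, h⟩
      if ν (lo l) = ν (hi l) then demazure l (gPolyAux Q a prec r ν)
      else if prec (ν (lo l)) (ν (hi l)) then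
        permPoly (simpleTransp l) (gPolyAux Q a prec r (permAct (simpleTransp l) ν)) *
          subst₂ (Q (ν (lo l)) (ν (hi l))) (lo l) (hi l)
      else permPoly (simpleTransp l) (gPolyAux Q a prec r (permAct (simpleTransp l) ν))
    else 0

/-- The polynomial `g_{ν,r}`. -/
def gPoly (Q : I → I → MvPolynomial (Fin 2) k) (a : I → k[X]) (prec : I → I → Prop) {n : ℕ}
    (ν : Fin n → I) (r : Fin n) : MvPolynomial (Fin n) k :=
  gPolyAux Q a prec r.val ν

end G

/-- The order on the colours `c_1, …, c_p`: `c_s ≺ c_t` if and only if `s < t`. -/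
def colourLT {I : Type*} {p : ℕ} (c : Fin p → I) (i j : I) : Prop :=
  ∃ s t : Fin p, s < t ∧ c s = i ∧ c t = j

/-- `μ` is the sequence of `m_1` copies of `c_1`, then `m_2` copies of `c_2`, and so on up to
`m_p` copies of `c_p`. -/
def IsBlockSeq {I : Type*} {n p : ℕ} (c : Fin p → I) (m : Fin p → ℕ) (μ : Fin n → I) : Prop :=
  List.ofFn μ = (List.ofFn fun s => List.replicate (m s) (c s)).flatten

/-- The index set of the monomial basis: permutations `w` with `w.ν = μ`, and exponents `b` with
`b_r < N_r`, where `N_r` is the degree of `g_{ν,r}` in the variable `x_r`. -/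
abbrev BasisIndex {k : Type*} [CommRing k] {I : Type*} [DecidableEq I]
    (Q : I → I → MvPolynomial (Fin 2) k) (a : I → k[X]) (prec : I → I → Prop) {n : ℕ}
    (μ ν : Fin n → I) : Type :=
  {w : Equiv.Perm (Fin n) // permAct w ν = μ} ×
    {b : Fin n → ℕ // ∀ r, b r < (gPoly Q a prec ν r).degreeOf r}

end CycKLR

end

noncomputable section

set_option linter.unusedVariables false
set_option linter.unusedSectionVars false

namespace CycKLR

/-! ### Permutations of variables and divided differences -/

section Poly

open MvPolynomial

variable {k : Type*} [CommRing k] {n : ℕ}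

/-! Write $\mu$ for $\widetilde\nu$, and let $J_\nu$ be the ideal of $\Bbbk[x_1,\dots,x_n]$
generated by all $g^\Lambda_{\nu,k}$. The theorem amounts to saying that $e(\mu)\mathscr
R_\beta^\Lambda e(\nu)$ is the direct sum of the spaces $\tau_w\cdot\Bbbk[x]/J_\nu$ over
$w\in\mathfrak S(\nu,\mu)$, and that $\Bbbk[x]/J_\nu$ has the monomials with exponents below $N_k$
as a basis.

The source of the polynomials $g$ is a polynomial representation. The algebra acts from the right on
families of polynomials indexed by $I^\beta$: $\tau_l$ acts by a divided difference on equal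
colours, and otherwise by the exchange of two variables, followed by the factor $Q$ when
$\nu_l\prec\nu_{l+1}$ (`crossing_crossing`, `crossing_braid`, `freeOp_rel`). The recursion for $g$
says that the family of index $k+1$ is the family of index $k$ acted upon by $\tau_k$ (`gFam_succ`).
The relations then show that the family of ideals $J_\nu$ is stable under the action (`tauOp_mem`).
Hence the cyclotomic ideal sends every family into the $J_\nu$ (`ract_mem_of_mem_cycIdeal`).

Spanning. Since $\mu$ is sorted, the braid relations needed to compare reduced words of $w$ have no
error terms, so $\tau_we(\nu)$ is well defined (`klrτWord_eq`) and the elements $\tau_wf(x)e(\nu)$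
span $e(\mu)\mathscr R_\beta e(\nu)$ (`mem_tauSpan_of_isSorted`). All of $J_\nu$ annihilates this
space modulo the cyclotomic ideal (`annihilates_gPolyAux`); in the case $\nu_k\succ\nu_{k+1}$ this
again depends on $\mu$ being sorted.

Independence. If $\sum_w\tau_wp_we(\nu)$ lies in the cyclotomic ideal, acting on families supported
at $\mu$ gives relations modulo $J_\nu$ among the $p_w$. Divided differences inside the blocks of
$\mu$ move these relations up to the longest element of $\mathfrak S(\nu,\mu)$, whose operator takes
the value 1, so all $p_w$ lie in $J_\nu$ (`mem_of_sum_transition_mem`).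

Finally $g^\Lambda_{\nu,k}$ involves only $x_1,\dots,x_k$ and its leading coefficient in $x_k$ is a
unit of $\Bbbk$ (`unitMonic_gPolyAux`), so division by this triangular family has a unique remainder
(`mem_sup_of_unitMonic`, `eq_zero_of_mem_span`). The leading coefficient can fail to be a unit only
after some earlier $g^\Lambda_{\nu,q}$ was a unit constant; then both the space and the index set
are trivial. -/

@[simp] theorem permPoly_add (w : Equiv.Perm (Fin n)) (f g : MvPolynomial (Fin n) k) :
    permPoly w (f + g) = permPoly w f + permPoly w g := map_add _ _ _

@[simp] theorem permPoly_sub (w : Equiv.Perm (Fin n)) (f g : MvPolynomial (Fin n) k) :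
    permPoly w (f - g) = permPoly w f - permPoly w g := map_sub (rename w) _ _

@[simp] theorem permPoly_mul (w : Equiv.Perm (Fin n)) (f g : MvPolynomial (Fin n) k) :
    permPoly w (f * g) = permPoly w f * permPoly w g := map_mul _ _ _

@[simp] theorem permPoly_zero (w : Equiv.Perm (Fin n)) :
    permPoly w (0 : MvPolynomial (Fin n) k) = 0 := map_zero _

@[simp] theorem permPoly_smul (w : Equiv.Perm (Fin n)) (c : k) (f : MvPolynomial (Fin n) k) :
    permPoly w (c • f) = c • permPoly w f := map_smul (rename w) _ _

@[simp] theorem permPoly_X (w : Equiv.Perm (Fin n)) (r : Fin n) :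
    permPoly w (X r : MvPolynomial (Fin n) k) = X (w r) := rename_X _ _

@[simp] theorem permPoly_C (w : Equiv.Perm (Fin n)) (c : k) :
    permPoly w (C c : MvPolynomial (Fin n) k) = C c := rename_C _ _

theorem permPoly_permPoly (w w' : Equiv.Perm (Fin n)) (f : MvPolynomial (Fin n) k) :
    permPoly w (permPoly w' f) = permPoly (w * w') f := rename_rename _ _ _

@[simp] theorem permPoly_swap_swap (b c : Fin n) (f : MvPolynomial (Fin n) k) :
    permPoly (Equiv.swap b c) (permPoly (Equiv.swap b c) f) = f := by
  rw [permPoly_permPoly, Equiv.swap_mul_self, permPoly]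
  simp

@[simp] theorem permPoly_subst₂ (w : Equiv.Perm (Fin n)) (q : MvPolynomial (Fin 2) k)
    (b c : Fin n) : permPoly w (subst₂ q b c) = subst₂ q (w b) (w c) := by
  unfold permPoly subst₂
  rw [← AlgHom.comp_apply]
  congr 1
  ext i
  fin_cases i <;> simp

theorem subst₂_mul (p q : MvPolynomial (Fin 2) k) (b c : Fin n) :
    subst₂ (p * q) b c = subst₂ p b c * subst₂ q b c := map_mul _ _ _

theorem subst₂_rename_swap (q : MvPolynomial (Fin 2) k) (b c : Fin n) :
    subst₂ (rename (Equiv.swap (0 : Fin 2) 1) q) b c = subst₂ q c b := by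
  unfold subst₂
  rw [aeval_rename]
  congr 1
  ext i
  fin_cases i <;> simp

variable [IsDomain k]

theorem X_sub_X_ne_zero {b c : Fin n} (h : b ≠ c) :
    (X b - X c : MvPolynomial (Fin n) k) ≠ 0 :=
  sub_ne_zero.2 fun e => h (X_injective e)

/-- `divDiff` is defined by choice; over a domain its defining equation determines it, and
identities between divided differences are checked through this cancellation. -/
theorem divDiff_eq_of {b c : Fin n} (h : b ≠ c) {f g : MvPolynomial (Fin n) k}
    (e : (X b - X c) * g = f - permPoly (Equiv.swap b c) f) : divDiff b c f = g :=
  mul_left_cancel₀ (X_sub_X_ne_zero h) ((divDiff_spec b c f).trans e.symm)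

theorem divDiff_add {b c : Fin n} (h : b ≠ c) (f g : MvPolynomial (Fin n) k) :
    divDiff b c (f + g) = divDiff b c f + divDiff b c g :=
  divDiff_eq_of h (by rw [mul_add, divDiff_spec, divDiff_spec, permPoly_add]; ring)

theorem divDiff_smul {b c : Fin n} (h : b ≠ c) (a : k) (f : MvPolynomial (Fin n) k) :
    divDiff b c (a • f) = a • divDiff b c f :=
  divDiff_eq_of h (by rw [mul_smul_comm, divDiff_spec, permPoly_smul, smul_sub])

theorem divDiff_mul {b c : Fin n} (h : b ≠ c) (f g : MvPolynomial (Fin n) k) :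
    divDiff b c (f * g) = divDiff b c f * permPoly (Equiv.swap b c) g + f * divDiff b c g :=
  divDiff_eq_of h (by
    rw [permPoly_mul]
    linear_combination permPoly (Equiv.swap b c) g * divDiff_spec b c f + f * divDiff_spec b c g)

theorem divDiff_eq_zero {b c : Fin n} (h : b ≠ c) {f : MvPolynomial (Fin n) k}
    (hf : permPoly (Equiv.swap b c) f = f) : divDiff b c f = 0 :=
  divDiff_eq_of h (by rw [hf]; ring)

theorem permPoly_divDiff (w : Equiv.Perm (Fin n)) {b c : Fin n} (h : b ≠ c)
    (f : MvPolynomial (Fin n) k) :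
    permPoly w (divDiff b c f) = divDiff (w b) (w c) (permPoly w f) := by
  refine (divDiff_eq_of (fun e => h (w.injective e)) ?_).symm
  have := congrArg (permPoly w) (divDiff_spec b c f)
  rw [permPoly_mul, permPoly_sub, permPoly_sub, permPoly_X, permPoly_X, permPoly_permPoly] at this
  rw [this, permPoly_permPoly, Equiv.swap_apply_apply, inv_mul_cancel_right]

theorem permPoly_swap_divDiff {b c : Fin n} (h : b ≠ c) (f : MvPolynomial (Fin n) k) :
    permPoly (Equiv.swap b c) (divDiff b c f) = divDiff b c f := by
  refine (divDiff_eq_of h ?_).symm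
  have := congrArg (permPoly (Equiv.swap b c)) (divDiff_spec b c f)
  simp only [permPoly_mul, permPoly_sub, permPoly_X, Equiv.swap_apply_left, Equiv.swap_apply_right,
    permPoly_swap_swap] at this
  linear_combination - this

theorem divDiff_divDiff {b c : Fin n} (h : b ≠ c) (f : MvPolynomial (Fin n) k) :
    divDiff b c (divDiff b c f) = 0 := divDiff_eq_zero h (permPoly_swap_divDiff h f)

theorem permPoly_swap_eq {a b c d : Fin n} (hac : a ≠ c) (had : a ≠ d) (hbc : b ≠ c) (hbd : b ≠ d)
    (f : MvPolynomial (Fin n) k) :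
    permPoly (Equiv.swap a b) (permPoly (Equiv.swap c d) f) =
      permPoly (Equiv.swap c d) (permPoly (Equiv.swap a b) f) := by
  rw [permPoly_permPoly, permPoly_permPoly]
  congr 1
  refine Equiv.ext fun x => ?_
  simp only [Equiv.Perm.mul_apply, Equiv.swap_apply_def]
  split_ifs <;> simp_all

theorem divDiff_comm {a b c d : Fin n} (hab : a ≠ b) (hcd : c ≠ d) (hac : a ≠ c) (had : a ≠ d)
    (hbc : b ≠ c) (hbd : b ≠ d) (f : MvPolynomial (Fin n) k) :
    divDiff a b (divDiff c d f) = divDiff c d (divDiff a b f) := by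
  refine divDiff_eq_of hab ?_
  rw [permPoly_divDiff _ hcd, Equiv.swap_apply_of_ne_of_ne hac.symm hbc.symm,
    Equiv.swap_apply_of_ne_of_ne had.symm hbd.symm]
  apply mul_left_cancel₀ (X_sub_X_ne_zero (k := k) hcd)
  have h1 := divDiff_spec c d f
  have h2 := divDiff_spec a b f
  have h3 := divDiff_spec c d (permPoly (Equiv.swap a b) f)
  have h4 := divDiff_spec c d (divDiff a b f)
  rw [permPoly_divDiff _ hab, Equiv.swap_apply_of_ne_of_ne hac had,
    Equiv.swap_apply_of_ne_of_ne hbc hbd] at h4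
  have h5 := divDiff_spec a b (permPoly (Equiv.swap c d) f)
  have h6 := permPoly_swap_eq hac had hbc hbd f
  linear_combination (X a - X b) * h4 - h1 + h2 + h3 - h5 + h6

variable {I : Type*} [DecidableEq I]

/-- The elementary operator on polynomials attached to positions `b`, `c` with colours `i`, `j`:
a divided difference for equal colours, a permutation followed by the multiplication with
`P_{ij}(x_b, x_c)` for distinct colours. -/
def crossing (P : I → I → MvPolynomial (Fin 2) k) (b c : Fin n) (i j : I)
    (f : MvPolynomial (Fin n) k) : MvPolynomial (Fin n) k :=
  if i = j then divDiff c b f else permPoly (Equiv.swap b c) f * subst₂ (P i j) b c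

variable (P : I → I → MvPolynomial (Fin 2) k)

theorem crossing_self (b c : Fin n) (i : I) (f : MvPolynomial (Fin n) k) :
    crossing P b c i i f = divDiff c b f := if_pos rfl

theorem crossing_ne (b c : Fin n) {i j : I} (h : i ≠ j) (f : MvPolynomial (Fin n) k) :
    crossing P b c i j f = permPoly (Equiv.swap b c) f * subst₂ (P i j) b c := if_neg h

theorem crossing_add {b c : Fin n} (h : b ≠ c) (i j : I) (f g : MvPolynomial (Fin n) k) :
    crossing P b c i j (f + g) = crossing P b c i j f + crossing P b c i j g := by
  unfold crossing
  split_ifs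
  · exact divDiff_add h.symm f g
  · rw [permPoly_add, add_mul]

theorem crossing_smul {b c : Fin n} (h : b ≠ c) (i j : I) (a : k) (f : MvPolynomial (Fin n) k) :
    crossing P b c i j (a • f) = a • crossing P b c i j f := by
  unfold crossing
  split_ifs
  · exact divDiff_smul h.symm a f
  · rw [permPoly_smul, smul_mul_assoc]

theorem crossing_mul {b c : Fin n} (h : b ≠ c) (i j : I) (f g : MvPolynomial (Fin n) k) :
    crossing P b c i j (f * g) = crossing P b c i j f * permPoly (Equiv.swap b c) g +
      if i = j then f * divDiff c b g else 0 := by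
  unfold crossing
  split_ifs
  · rw [divDiff_mul h.symm, Equiv.swap_comm]
  · rw [permPoly_mul]; ring

theorem crossing_comm {a b c d : Fin n} (hab : a ≠ b) (hcd : c ≠ d) (hac : a ≠ c) (had : a ≠ d)
    (hbc : b ≠ c) (hbd : b ≠ d) (i j i' j' : I) (f : MvPolynomial (Fin n) k) :
    crossing P a b i j (crossing P c d i' j' f) = crossing P c d i' j' (crossing P a b i j f) := by
  unfold crossing
  split_ifs
  · exact divDiff_comm hab.symm hcd.symm hbd hbc had hac f
  · rw [divDiff_mul hab.symm, permPoly_divDiff _ hab.symm,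
      divDiff_eq_zero hab.symm (f := subst₂ _ _ _), Equiv.swap_apply_of_ne_of_ne hac had,
      Equiv.swap_apply_of_ne_of_ne hbc hbd, permPoly_subst₂,
      Equiv.swap_apply_of_ne_of_ne hbc.symm hac.symm, Equiv.swap_apply_of_ne_of_ne hbd.symm had.symm]
    · ring
    · rw [permPoly_subst₂, Equiv.swap_apply_of_ne_of_ne hbc.symm hac.symm,
        Equiv.swap_apply_of_ne_of_ne hbd.symm had.symm]
  · rw [divDiff_mul hcd.symm, permPoly_divDiff _ hcd.symm,
      divDiff_eq_zero hcd.symm (f := subst₂ _ _ _), Equiv.swap_apply_of_ne_of_ne hac.symm hbc.symm,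
      Equiv.swap_apply_of_ne_of_ne had.symm hbd.symm, permPoly_subst₂,
      Equiv.swap_apply_of_ne_of_ne had hac, Equiv.swap_apply_of_ne_of_ne hbd hbc]
    · ring
    · rw [permPoly_subst₂, Equiv.swap_apply_of_ne_of_ne had hac,
        Equiv.swap_apply_of_ne_of_ne hbd hbc]
  · simp only [permPoly_mul, permPoly_subst₂, Equiv.swap_apply_of_ne_of_ne hac had,
      Equiv.swap_apply_of_ne_of_ne hbc hbd, Equiv.swap_apply_of_ne_of_ne hac.symm hbc.symm,
      Equiv.swap_apply_of_ne_of_ne had.symm hbd.symm, permPoly_swap_eq hac had hbc hbd]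
    ring

theorem permPoly_braid {b c d : Fin n} (hbc : b ≠ c) (hbd : b ≠ d) (f : MvPolynomial (Fin n) k) :
    permPoly (Equiv.swap c d) (permPoly (Equiv.swap b c) (permPoly (Equiv.swap c d) f)) =
      permPoly (Equiv.swap b d) f := by
  rw [permPoly_permPoly, permPoly_permPoly]
  congr 1
  have := Equiv.swap_apply_apply (Equiv.swap c d) b c
  rw [Equiv.swap_apply_of_ne_of_ne hbc hbd, Equiv.swap_apply_left, Equiv.swap_inv] at this
  exact this.symm

theorem divDiff_swap {b c : Fin n} (h : b ≠ c) (f : MvPolynomial (Fin n) k) :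
    divDiff b c f = -divDiff c b f :=
  divDiff_eq_of h (by rw [Equiv.swap_comm]; linear_combination divDiff_spec c b f)

theorem divDiff_neg {b c : Fin n} (h : b ≠ c) (f : MvPolynomial (Fin n) k) :
    divDiff b c (-f) = -divDiff b c f := by
  simpa using divDiff_smul h (-1) f

/-- Clearing the three denominators leaves the alternating sum over the permutations of `b`, `c`,
`d`, which does not remember the reduced word of the longest element. -/
theorem mul_divDiff_divDiff_divDiff {b c d : Fin n} (hbc : b ≠ c) (hbd : b ≠ d) (hcd : c ≠ d)
    (f : MvPolynomial (Fin n) k) :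
    (X c - X b) * (X d - X b) * (X d - X c) * divDiff d c (divDiff c b (divDiff d c f)) =
      f - permPoly (Equiv.swap b c) f - permPoly (Equiv.swap c d) f
        + permPoly (Equiv.swap b c) (permPoly (Equiv.swap c d) f)
        + permPoly (Equiv.swap c d) (permPoly (Equiv.swap b c) f)
        - permPoly (Equiv.swap b d) f := by
  have e1 := divDiff_spec d c f
  have e2 := divDiff_spec c b (divDiff d c f)
  have e3 := divDiff_spec d c (divDiff c b (divDiff d c f))
  have e4 := congrArg (permPoly (Equiv.swap b c)) e1
  have e5 := congrArg (permPoly (Equiv.swap c d)) e2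
  have e6 := congrArg (permPoly (Equiv.swap c d)) e4
  have hs := permPoly_swap_divDiff hcd.symm f
  rw [Equiv.swap_comm] at hs
  simp only [permPoly_mul, permPoly_sub, permPoly_X, Equiv.swap_apply_left,
    Equiv.swap_apply_right, Equiv.swap_apply_of_ne_of_ne hbc hbd,
    Equiv.swap_apply_of_ne_of_ne hbd.symm hcd.symm, Equiv.swap_comm c b, Equiv.swap_comm d c, hs]
    at e1 e2 e3 e4 e5 e6
  rw [permPoly_braid hbc hbd] at e6
  linear_combination (X c - X b) * (X d - X b) * e3 + (X d - X b) * e2 - (X c - X b) * e5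
    + e1 - e4 + e6

theorem divDiff_braid {b c d : Fin n} (hbc : b ≠ c) (hbd : b ≠ d) (hcd : c ≠ d)
    (f : MvPolynomial (Fin n) k) :
    divDiff d c (divDiff c b (divDiff d c f)) = divDiff c b (divDiff d c (divDiff c b f)) := by
  apply mul_left_cancel₀ (mul_ne_zero (mul_ne_zero (X_sub_X_ne_zero (k := k) hbc.symm)
    (X_sub_X_ne_zero hbd.symm)) (X_sub_X_ne_zero hcd.symm))
  have h1 := mul_divDiff_divDiff_divDiff hbc hbd hcd f
  -- Reversing the three indices produces the other side; the signs of the three divided differences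
  -- cancel those of the three linear factors.
  have h2 := mul_divDiff_divDiff_divDiff hcd.symm hbd.symm hbc.symm f
  rw [divDiff_swap hbc, divDiff_swap hbc, divDiff_swap hcd, divDiff_neg hcd.symm,
    divDiff_neg hbc.symm, divDiff_neg hbc.symm, Equiv.swap_comm d c,
    Equiv.swap_comm c b, Equiv.swap_comm d b] at h2
  linear_combination h1 - h2

/-- The braid relation for the elementary operators. -/
theorem crossing_braid {b c d : Fin n} (hbc : b ≠ c) (hbd : b ≠ d) (hcd : c ≠ d)
    {Q : I → I → MvPolynomial (Fin 2) k} {i j l : I} (hQ : Q i i = 0)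
    (hP : i ≠ j → Q i j = P i j * rename (Equiv.swap (0 : Fin 2) 1) (P j i))
    (f : MvPolynomial (Fin n) k) :
    crossing P c d j l (crossing P b c i l (crossing P c d i j f)) -
      crossing P b c i j (crossing P c d i l (crossing P b c j l f)) =
      if i = l then f * divDiff b d (subst₂ (Q i j) b c) else 0 := by
  have b1 : Equiv.swap b c d = d := Equiv.swap_apply_of_ne_of_ne hbd.symm hcd.symm
  have b2 : Equiv.swap c d b = b := Equiv.swap_apply_of_ne_of_ne hbc hbd
  have hbr := permPoly_braid (k := k) hbc hbd f
  have hbr' := permPoly_braid (k := k) hcd.symm hbd.symm f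
  rw [Equiv.swap_comm d c, Equiv.swap_comm c b, Equiv.swap_comm d b] at hbr'
  by_cases hil : i = l
  · subst hil
    rw [if_pos rfl]
    -- Equal outer colours: with the same colour in the middle this is the braid relation of divided
    -- differences and `Q i i = 0`; otherwise the mismatch is the divided difference of `Q i j`,
    -- seen as a product of the two factors `P`.
    by_cases hij : i = j
    · subst hij
      simp only [crossing_self]
      rw [divDiff_braid hbc hbd hcd, hQ, sub_self, divDiff_eq_zero hbd, mul_zero] <;>
        simp [subst₂]
    · rw [crossing_self, crossing_self, crossing_ne P c d hij, crossing_ne P b c hij,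
        crossing_ne P _ _ (Ne.symm hij), crossing_ne P _ _ (Ne.symm hij), hP hij]
      rw [permPoly_divDiff _ hbc.symm, permPoly_divDiff _ hcd.symm, b1, b2,
        Equiv.swap_apply_left, Equiv.swap_apply_right]
      apply mul_left_cancel₀ (X_sub_X_ne_zero (k := k) hbd)
      have e1 := divDiff_spec d b (permPoly (Equiv.swap c d) (permPoly (Equiv.swap c d) f *
        subst₂ (P i j) c d))
      have e2 := divDiff_spec d b (permPoly (Equiv.swap b c) (permPoly (Equiv.swap b c) f *
        subst₂ (P j i) b c))
      have e3 := divDiff_spec b d (subst₂ (P i j * rename (Equiv.swap (0 : Fin 2) 1) (P j i)) b c)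
      simp only [permPoly_mul, permPoly_subst₂, permPoly_swap_swap, subst₂_mul, subst₂_rename_swap,
        Equiv.swap_apply_left, Equiv.swap_apply_right, Equiv.swap_apply_of_ne_of_ne hbc.symm hcd,
        Equiv.swap_comm d b] at e1 e2 e3 ⊢
      linear_combination (-subst₂ (P j i) c d) * e1 + subst₂ (P i j) b c * e2 - f * e3
  -- Distinct outer colours: at most one crossing is a divided difference, and the factors it has to
  -- pass are symmetric in its two variables, so no error term arises.
  · rw [if_neg hil, sub_eq_zero]
    by_cases hij : i = j
    · subst hij
      rw [crossing_self, crossing_self, crossing_ne P _ _ hil, crossing_ne P _ _ hil,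
        crossing_ne P _ _ hil, crossing_ne P _ _ hil]
      simp only [permPoly_mul, permPoly_subst₂, Equiv.swap_apply_left, b2, mul_assoc]
      rw [permPoly_divDiff _ hcd.symm, permPoly_divDiff _ (by rwa [b1, Equiv.swap_apply_right,
        Ne, eq_comm] : Equiv.swap b c d ≠ Equiv.swap b c c), divDiff_mul hbc.symm,
        divDiff_eq_zero hbc.symm (f := _ * _)]
      · simp only [permPoly_mul, permPoly_subst₂, Equiv.swap_apply_left, Equiv.swap_apply_right,
          b1, b2, Equiv.swap_comm c b]
        ring
      · simp only [permPoly_mul, permPoly_subst₂, Equiv.swap_apply_left, Equiv.swap_apply_right,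
          b1, Equiv.swap_comm c b]
        ring
    · by_cases hjl : j = l
      · subst hjl
        rw [crossing_self, crossing_self, crossing_ne P _ _ hil, crossing_ne P _ _ hil,
          crossing_ne P _ _ hil, crossing_ne P _ _ hil]
        simp only [permPoly_mul, permPoly_subst₂, Equiv.swap_apply_right,
          b1, mul_assoc]
        rw [permPoly_divDiff _ hbc.symm, b2, Equiv.swap_apply_left,
          permPoly_divDiff _ hbd.symm, Equiv.swap_apply_left, b1, divDiff_mul hcd.symm,
          divDiff_eq_zero hcd.symm (f := _ * _)]
        · simp only [permPoly_mul, permPoly_subst₂, Equiv.swap_apply_left, Equiv.swap_apply_right,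
            b2, Equiv.swap_comm d c]
          ring
        · simp only [permPoly_mul, permPoly_subst₂, Equiv.swap_apply_left, Equiv.swap_apply_right,
            b2, Equiv.swap_comm d c]
          ring
      · rw [crossing_ne P _ _ hil, crossing_ne P _ _ hil, crossing_ne P _ _ hij,
          crossing_ne P _ _ hij, crossing_ne P _ _ hjl, crossing_ne P _ _ hjl]
        simp only [permPoly_mul, permPoly_subst₂, Equiv.swap_apply_left, Equiv.swap_apply_right,
          b1, b2, hbr, hbr']
        ring

/-- The quadratic relation for the elementary operators. -/
theorem crossing_crossing {b c : Fin n} (hbc : b ≠ c) {Q : I → I → MvPolynomial (Fin 2) k} {i j : I}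
    (hQ : Q i i = 0)
    (hP : i ≠ j → Q i j = P i j * rename (Equiv.swap (0 : Fin 2) 1) (P j i))
    (f : MvPolynomial (Fin n) k) :
    crossing P b c i j (crossing P b c j i f) = f * subst₂ (Q i j) b c := by
  by_cases hij : i = j
  · subst hij
    rw [crossing_self, crossing_self, divDiff_divDiff hbc.symm, hQ]
    simp [subst₂]
  · rw [crossing_ne P _ _ hij, crossing_ne P _ _ (Ne.symm hij), hP hij, subst₂_mul,
      subst₂_rename_swap]
    simp
    ring

theorem divDiff_X_left {b c : Fin n} (h : b ≠ c) : divDiff b c (X b : MvPolynomial (Fin n) k) = 1 :=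
  divDiff_eq_of h (by simp)

theorem divDiff_X_right {b c : Fin n} (h : b ≠ c) :
    divDiff b c (X c : MvPolynomial (Fin n) k) = -1 :=
  divDiff_eq_of h (by simp)

theorem divDiff_X_other {b c r : Fin n} (h : b ≠ c) (hb : r ≠ b) (hc : r ≠ c) :
    divDiff b c (X r : MvPolynomial (Fin n) k) = 0 :=
  divDiff_eq_zero h (by simp [Equiv.swap_apply_of_ne_of_ne hb hc])

end Poly

/-! ### Evaluation at commuting elements -/

section Eval

open MvPolynomial

variable {k : Type*} [CommRing k] {n : ℕ} {B B' : Type*} [Ring B] [Algebra k B] [Ring B']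
  [Algebra k B']

theorem map_monom (φ : B →ₐ[k] B') (x : Fin n → B) (m : Fin n → ℕ) :
    φ (monom x m) = monom (fun r => φ (x r)) m := by
  simp only [monom, map_list_prod, List.map_ofFn, Function.comp_def, map_pow]

theorem map_evalAt (φ : B →ₐ[k] B') (x : Fin n → B) (f : MvPolynomial (Fin n) k) :
    φ (evalAt x f) = evalAt (fun r => φ (x r)) f := by
  simp only [evalAt, map_sum, map_smul, map_monom]

theorem monom_X (m : Fin n → ℕ) :
    monom (X : Fin n → MvPolynomial (Fin n) k) m = ∏ r, X r ^ m r := by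
  rw [monom, List.prod_ofFn]

/-- Combined with `map_evalAt`, this matches the ordered monomials of the free algebra with
evaluation under any homomorphism out of the polynomial ring. -/
theorem evalAt_X (f : MvPolynomial (Fin n) k) : evalAt (X : Fin n → MvPolynomial (Fin n) k) f = f := by
  conv_rhs => rw [f.as_sum]
  refine Finset.sum_congr rfl fun m _ => ?_
  rw [monom_X, monomial_eq, smul_eq_C_mul, Finsupp.prod_fintype _ _ (fun _ => pow_zero _)]

open scoped IsMulCommutative in
/-- The evaluation homomorphism at pairwise commuting elements of an algebra. -/
def evalHom (x : Fin n → B) (hx : ∀ r t, x r * x t = x t * x r) :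
    MvPolynomial (Fin n) k →ₐ[k] B :=
  -- `MvPolynomial.aeval` needs a commutative target; commuting elements generate a commutative
  -- subalgebra.
  haveI : IsMulCommutative (Algebra.adjoin k (Set.range x)) :=
    Algebra.isMulCommutative_adjoin k (by rintro _ ⟨r, rfl⟩ _ ⟨t, rfl⟩; exact hx r t)
  (Algebra.adjoin k (Set.range x)).val.comp
    (MvPolynomial.aeval (R := k) (S₁ := Algebra.adjoin k (Set.range x))
      fun r => ⟨x r, Algebra.subset_adjoin ⟨r, rfl⟩⟩)

open scoped IsMulCommutative in
@[simp] theorem evalHom_X (x : Fin n → B) (hx : ∀ r t, x r * x t = x t * x r) (r : Fin n) :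
    evalHom (k := k) x hx (X r) = x r := by
  have : IsMulCommutative (Algebra.adjoin k (Set.range x)) :=
    Algebra.isMulCommutative_adjoin k (by rintro _ ⟨r, rfl⟩ _ ⟨t, rfl⟩; exact hx r t)
  exact congrArg Subtype.val (MvPolynomial.aeval_X (R := k)
    (S₁ := Algebra.adjoin k (Set.range x)) _ r)

theorem evalAt_eq_evalHom (x : Fin n → B) (hx : ∀ r t, x r * x t = x t * x r)
    (f : MvPolynomial (Fin n) k) : evalAt x f = evalHom x hx f := by
  conv_rhs => rw [← evalAt_X f, map_evalAt]
  simp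

theorem monom_eq_evalHom (x : Fin n → B) (hx : ∀ r t, x r * x t = x t * x r) (m : Fin n → ℕ) :
    monom x m = evalHom (k := k) x hx (∏ r, X r ^ m r) := by
  rw [← monom_X, map_monom]
  simp

end Eval

/-! ### Sequences -/

section Sequences

variable {I : Type*} [DecidableEq I] {n : ℕ} {β : I → ℕ}

theorem lo_ne_hi (l : Fin (n - 1)) : lo l ≠ hi l := by simp [lo, hi]

theorem Seqs.act_mul (w w' : Equiv.Perm (Fin n)) (ν : Seqs I n β) :
    Seqs.act (w * w') ν = Seqs.act w (Seqs.act w' ν) := by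
  apply Subtype.ext
  funext r
  simp [Seqs.act, permAct]

@[simp] theorem Seqs.act_one (ν : Seqs I n β) : Seqs.act 1 ν = ν := by
  apply Subtype.ext
  funext r
  simp [Seqs.act, permAct]

@[simp] theorem simpleTransp_mul_self (l : Fin (n - 1)) :
    simpleTransp l * simpleTransp l = 1 := Equiv.swap_mul_self _ _

@[simp] theorem simpleTransp_inv (l : Fin (n - 1)) : (simpleTransp l)⁻¹ = simpleTransp l :=
  Equiv.swap_inv _ _

@[simp] theorem simpleTransp_lo (l : Fin (n - 1)) : simpleTransp l (lo l) = hi l :=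
  Equiv.swap_apply_left _ _

@[simp] theorem simpleTransp_hi (l : Fin (n - 1)) : simpleTransp l (hi l) = lo l :=
  Equiv.swap_apply_right _ _

theorem simpleTransp_of_ne {l : Fin (n - 1)} {r : Fin n} (h : r ≠ lo l) (h' : r ≠ hi l) :
    simpleTransp l r = r := Equiv.swap_apply_of_ne_of_ne h h'

@[simp] theorem Seqs.act_simple_act_simple (l : Fin (n - 1)) (ν : Seqs I n β) :
    Seqs.act (simpleTransp l) (Seqs.act (simpleTransp l) ν) = ν := by
  rw [← Seqs.act_mul, simpleTransp_mul_self, Seqs.act_one]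

theorem Seqs.act_simple_apply (l : Fin (n - 1)) (ν : Seqs I n β) (r : Fin n) :
    (Seqs.act (simpleTransp l) ν).1 r = ν.1 (simpleTransp l r) := by
  simp [Seqs.act, permAct]

theorem Seqs.act_simple_lo (l : Fin (n - 1)) (ν : Seqs I n β) :
    (Seqs.act (simpleTransp l) ν).1 (lo l) = ν.1 (hi l) := by
  rw [Seqs.act_simple_apply, simpleTransp_lo]

theorem Seqs.act_simple_hi (l : Fin (n - 1)) (ν : Seqs I n β) :
    (Seqs.act (simpleTransp l) ν).1 (hi l) = ν.1 (lo l) := by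
  rw [Seqs.act_simple_apply, simpleTransp_hi]

theorem Seqs.act_simple_eq_self {l : Fin (n - 1)} {ν : Seqs I n β}
    (h : ν.1 (lo l) = ν.1 (hi l)) : Seqs.act (simpleTransp l) ν = ν := by
  apply Subtype.ext
  funext r
  rw [Seqs.act_simple_apply]
  by_cases h1 : r = lo l
  · rw [h1, simpleTransp_lo, h]
  by_cases h2 : r = hi l
  · rw [h2, simpleTransp_hi, h]
  rw [simpleTransp_of_ne h1 h2]

theorem Seqs.ne_zero (ν : Seqs I n β) (r : Fin n) : β (ν.1 r) ≠ 0 := by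
  rw [← ν.2 (ν.1 r), Finset.card_ne_zero]
  exact ⟨r, by simp⟩

theorem Seqs.exists_apply_eq {i : I} (h : β i ≠ 0) (ν : Seqs I n β) : ∃ r, ν.1 r = i := by
  rw [← ν.2 i, Finset.card_ne_zero] at h
  obtain ⟨r, hr⟩ := h
  exact ⟨r, by simpa using hr⟩

theorem lo_ne_lo {l m : Fin (n - 1)} (h : l.val + 1 < m.val ∨ m.val + 1 < l.val) :
    lo l ≠ lo m ∧ lo l ≠ hi m ∧ hi l ≠ lo m ∧ hi l ≠ hi m := by
  simp only [lo, hi, Ne, Fin.mk.injEq]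
  omega

theorem simpleTransp_comm {l m : Fin (n - 1)} (h : l.val + 1 < m.val ∨ m.val + 1 < l.val) :
    simpleTransp l * simpleTransp m = simpleTransp m * simpleTransp l := by
  obtain ⟨h1, h2, h3, h4⟩ := lo_ne_lo h
  refine Equiv.ext fun x => ?_
  simp only [simpleTransp, Equiv.Perm.mul_apply, Equiv.swap_apply_def]
  split_ifs <;> simp_all

theorem lo_eq_hi {l m : Fin (n - 1)} (h : m.val = l.val + 1) : lo m = hi l := by
  simp [lo, hi, h]

theorem simpleTransp_braid {l m : Fin (n - 1)} (h : m.val = l.val + 1) :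
    simpleTransp l * simpleTransp m * simpleTransp l =
      simpleTransp m * simpleTransp l * simpleTransp m := by
  have h1 := lo_ne_hi l
  have h2 := lo_ne_hi m
  have h3 : lo l ≠ hi m := by simp only [lo, hi, Ne, Fin.mk.injEq]; omega
  rw [lo_eq_hi h] at h2
  refine Equiv.ext fun x => ?_
  simp only [simpleTransp, Equiv.Perm.mul_apply, lo_eq_hi h]
  by_cases e1 : x = lo l
  · subst e1
    simp [Equiv.swap_apply_of_ne_of_ne h1 h3, Equiv.swap_apply_of_ne_of_ne h3.symm h2.symm]
  by_cases e2 : x = hi l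
  · subst e2
    simp [Equiv.swap_apply_of_ne_of_ne h1 h3, Equiv.swap_apply_of_ne_of_ne h3.symm h2.symm]
  by_cases e3 : x = hi m
  · subst e3
    simp [Equiv.swap_apply_of_ne_of_ne h1 h3, Equiv.swap_apply_of_ne_of_ne h3.symm h2.symm]
  simp [Equiv.swap_apply_of_ne_of_ne e1 e2, Equiv.swap_apply_of_ne_of_ne e2 e3]

end Sequences

/-! ### The polynomial representation -/

section PolRep

open MvPolynomial

variable {k : Type*} [CommRing k] [IsDomain k] {I : Type*} [DecidableEq I]
  {n : ℕ} {β : I → ℕ}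

/-- The relation `prec` is a strict order, total on the colours that occur in `β`, and `Q` is
symmetric with zero diagonal. -/
structure IsAdapted (Q : I → I → MvPolynomial (Fin 2) k) (prec : I → I → Prop) (β : I → ℕ) :
    Prop where
  symm : ∀ i j, Q i j = rename (Equiv.swap (0 : Fin 2) 1) (Q j i)
  diag : ∀ i, Q i i = 0
  irrefl : ∀ i, ¬ prec i i
  asymm : ∀ i j, prec i j → ¬ prec j i
  trans : ∀ i j l, prec i j → prec j l → prec i l
  total : ∀ i j, β i ≠ 0 → β j ≠ 0 → i ≠ j → prec i j ∨ prec j i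

open Classical in
/-- The factor attached to the crossing of the colours `i` and `j`. -/
def factor (Q : I → I → MvPolynomial (Fin 2) k) (prec : I → I → Prop) (i j : I) :
    MvPolynomial (Fin 2) k := if prec i j then Q i j else 1

variable {Q : I → I → MvPolynomial (Fin 2) k} {prec : I → I → Prop}

/-- Exactly one of the two factors is a `Q` and the other is 1; if it is the second one, the
symmetry of `Q` absorbs the exchange of variables. -/
theorem IsAdapted.factor_mul (h : IsAdapted Q prec β) {i j : I} (hi : β i ≠ 0) (hj : β j ≠ 0)
    (hij : i ≠ j) : Q i j = factor Q prec i j *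
      rename (Equiv.swap (0 : Fin 2) 1) (factor Q prec j i) := by
  unfold factor
  rcases h.total i j hi hj hij with h1 | h1
  · rw [if_pos h1, if_neg (h.asymm _ _ h1), map_one, mul_one]
  · rw [if_pos h1, if_neg (h.asymm _ _ h1), one_mul, ← h.symm]

variable (Q prec)

/-- The operator given by the right action of `τ_l e(ν)` on polynomials. -/
def tauAt (l : Fin (n - 1)) (ν : Seqs I n β) (f : MvPolynomial (Fin n) k) :
    MvPolynomial (Fin n) k :=
  crossing (factor Q prec) (lo l) (hi l) (ν.1 (lo l)) (ν.1 (hi l)) f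

/-- The space of families of polynomials on which the Khovanov-Lauda-Rouquier algebra acts. -/
abbrev Pol (k : Type*) [CommRing k] {I : Type*} [DecidableEq I] (n : ℕ) (β : I → ℕ) : Type _ :=
  Seqs I n β → MvPolynomial (Fin n) k

/-- The action of `τ_l`. -/
def tauOp (l : Fin (n - 1)) : Module.End k (Pol k n β) where
  toFun F ν := tauAt Q prec l ν (F (Seqs.act (simpleTransp l) ν))
  map_add' F G := funext fun ν => crossing_add _ (lo_ne_hi l) _ _ _ _
  map_smul' a F := funext fun ν => crossing_smul _ (lo_ne_hi l) _ _ _ _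

theorem tauOp_apply (l : Fin (n - 1)) (F : Pol k n β) (ν : Seqs I n β) :
    tauOp Q prec l F ν = tauAt Q prec l ν (F (Seqs.act (simpleTransp l) ν)) := rfl

variable {Q prec}

theorem tauOp_sq (h : IsAdapted Q prec β) (l : Fin (n - 1)) (F : Pol k n β) (ν : Seqs I n β) :
    tauOp Q prec l (tauOp Q prec l F) ν =
      F ν * subst₂ (Q (ν.1 (lo l)) (ν.1 (hi l))) (lo l) (hi l) := by
  rw [tauOp_apply, tauOp_apply, Seqs.act_simple_act_simple]
  unfold tauAt
  rw [Seqs.act_simple_lo, Seqs.act_simple_hi]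
  exact crossing_crossing _ (lo_ne_hi l) (h.diag _)
    (fun e => h.factor_mul (ν.ne_zero _) (ν.ne_zero _) e) _

theorem tauOp_comm {l m : Fin (n - 1)} (h : l.val + 1 < m.val ∨ m.val + 1 < l.val)
    (F : Pol k n β) :
    tauOp Q prec l (tauOp Q prec m F) = tauOp Q prec m (tauOp Q prec l F) := by
  funext ν
  obtain ⟨h1, h2, h3, h4⟩ := lo_ne_lo h
  simp only [tauOp_apply, tauAt, Seqs.act_simple_apply, ← Seqs.act_mul, simpleTransp_comm h]
  rw [simpleTransp_of_ne h1 h2, simpleTransp_of_ne h3 h4, simpleTransp_of_ne h1.symm h3.symm,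
    simpleTransp_of_ne h2.symm h4.symm]
  exact crossing_comm _ (lo_ne_hi l) (lo_ne_hi m) h1 h2 h3 h4 _ _ _ _ _

theorem tauOp_braid (h : IsAdapted Q prec β) {l m : Fin (n - 1)} (hlm : m.val = l.val + 1)
    (F : Pol k n β) (ν : Seqs I n β) :
    tauOp Q prec m (tauOp Q prec l (tauOp Q prec m F)) ν -
      tauOp Q prec l (tauOp Q prec m (tauOp Q prec l F)) ν =
      if ν.1 (lo l) = ν.1 (hi m) then
        F ν * divDiff (lo l) (hi m) (subst₂ (Q (ν.1 (lo l)) (ν.1 (hi l))) (lo l) (hi l))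
      else 0 := by
  have h1 := lo_ne_hi l
  have h2 := lo_ne_hi m
  have h3 : lo l ≠ hi m := by simp only [lo, hi, Ne, Fin.mk.injEq]; omega
  rw [lo_eq_hi hlm] at h2
  have e1 : simpleTransp m (lo l) = lo l := simpleTransp_of_ne (by rwa [lo_eq_hi hlm]) h3
  have e2 : simpleTransp l (hi m) = hi m := simpleTransp_of_ne h3.symm h2.symm
  have e3 : simpleTransp m (hi l) = hi m := by rw [← lo_eq_hi hlm, simpleTransp_lo]
  have e4 : simpleTransp m (hi m) = hi l := by rw [← lo_eq_hi hlm, simpleTransp_hi]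
  simp only [tauOp_apply, tauAt, Seqs.act_simple_apply, lo_eq_hi hlm, e1, e2, e3, e4,
    simpleTransp_lo, simpleTransp_hi]
  simp only [← Seqs.act_mul, ← mul_assoc, simpleTransp_braid hlm]
  rw [crossing_braid (factor Q prec) h1 h3 h2 (h.diag _)
    (fun e => h.factor_mul (ν.ne_zero _) (ν.ne_zero _) e)]
  split_ifs with h5
  -- The threefold transposition exchanges positions `lo l` and `hi m`, which carry the same colour
  -- here, so it fixes `ν`.
  · congr 2
    apply Subtype.ext
    funext r
    simp only [Seqs.act_mul, Seqs.act_simple_apply]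
    by_cases r1 : r = lo l
    · simp [r1, e1, e3, h5]
    by_cases r2 : r = hi l
    · simp [r2, e2, e3, e4]
    by_cases r3 : r = hi m
    · simp [r3, e1, e4, h5]
    have : simpleTransp m r = r := simpleTransp_of_ne (by rwa [lo_eq_hi hlm]) r3
    rw [this, simpleTransp_of_ne r1 r2, this]
  · rfl

theorem tauAt_mul (l : Fin (n - 1)) (ν : Seqs I n β) (f g : MvPolynomial (Fin n) k) :
    tauAt Q prec l ν (f * g) = tauAt Q prec l ν f * permPoly (simpleTransp l) g +
      if ν.1 (lo l) = ν.1 (hi l) then f * demazure l g else 0 :=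
  crossing_mul _ (lo_ne_hi l) _ _ _ _

/-- The right multiplication of families of polynomials with polynomials. -/
def mulOp (k : Type*) [CommRing k] {I : Type*} [DecidableEq I] (n : ℕ) (β : I → ℕ) :
    MvPolynomial (Fin n) k →ₐ[k] (Module.End k (Pol k n β))ᵐᵒᵖ :=
  (Algebra.lsmul k k (Pol k n β)).toOpposite fun f g => by
    rw [Commute, SemiconjBy, ← map_mul, ← map_mul, mul_comm]

theorem mulOp_apply (f : MvPolynomial (Fin n) k) (F : Pol k n β) (ν : Seqs I n β) :
    (mulOp k n β f).unop F ν = F ν * f := mul_comm _ _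

/-- The projection to the component of `ν`. -/
def projOp (k : Type*) [CommRing k] {I : Type*} [DecidableEq I] {n : ℕ} {β : I → ℕ}
    (ν : Seqs I n β) : Module.End k (Pol k n β) where
  toFun F μ := if μ = ν then F μ else 0
  map_add' F G := funext fun μ => by
    simp only [Pi.add_apply]
    split_ifs <;> simp
  map_smul' a F := funext fun μ => by
    simp only [Pi.smul_apply, RingHom.id_apply]
    split_ifs <;> simp

theorem projOp_apply (ν : Seqs I n β) (F : Pol k n β) (μ : Seqs I n β) :
    projOp k ν F μ = if μ = ν then F μ else 0 := rfl

variable (Q prec)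

/-- The action of the generators. -/
def genOp : Gen I n β → (Module.End k (Pol k n β))ᵐᵒᵖ
  | Gen.e ν => MulOpposite.op (projOp k ν)
  | Gen.x r => mulOp k n β (X r)
  | Gen.τ l => MulOpposite.op (tauOp Q prec l)

/-- The action of the free algebra. -/
def freeOp : FreeKLR k n β →ₐ[k] (Module.End k (Pol k n β))ᵐᵒᵖ := FreeAlgebra.lift k (genOp Q prec)

theorem freeOp_fe (ν : Seqs I n β) : freeOp Q prec (fe k ν) = MulOpposite.op (projOp k ν) :=
  FreeAlgebra.lift_ι_apply _ _

theorem freeOp_fx (r : Fin n) : freeOp Q prec (fx k β r) = mulOp k n β (X r) :=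
  FreeAlgebra.lift_ι_apply _ _

theorem freeOp_fτ (l : Fin (n - 1)) :
    freeOp Q prec (fτ k β l) = MulOpposite.op (tauOp Q prec l) :=
  FreeAlgebra.lift_ι_apply _ _

theorem freeOp_evalAt (f : MvPolynomial (Fin n) k) :
    freeOp Q prec (evalAt (fx k β) f) = mulOp k n β f := by
  rw [map_evalAt]
  conv_rhs => rw [← evalAt_X f, map_evalAt]
  simp only [freeOp_fx]

variable {Q prec} [Fintype I]

theorem freeOp_rel (h : IsAdapted Q prec β) {y z : FreeKLR k n β} (hyz : KLRRel Q n β y z) :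
    freeOp Q prec y = freeOp Q prec z := by
  apply MulOpposite.unop_injective
  refine LinearMap.ext fun F => funext fun μ => ?_
  -- In the opposite algebra the left factor of a product acts first: this is a right action.
  have apply_mul : ∀ (a b : (Module.End k (Pol k n β))ᵐᵒᵖ) (F : Pol k n β),
    (a * b).unop F = b.unop (a.unop F) := fun _ _ _ => rfl
  have apply_sub : ∀ (a b : (Module.End k (Pol k n β))ᵐᵒᵖ) (F : Pol k n β) (μ),
    (a - b).unop F μ = a.unop F μ - b.unop F μ := fun _ _ _ _ => rfl
  have apply_neg : ∀ (a : (Module.End k (Pol k n β))ᵐᵒᵖ) (F : Pol k n β) (μ),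
    (-a).unop F μ = - a.unop F μ := fun _ _ _ => rfl
  have apply_zero : ∀ (F : Pol k n β) (μ),
    (0 : (Module.End k (Pol k n β))ᵐᵒᵖ).unop F μ = 0 := fun _ _ => rfl
  cases hyz with
  | e_mul_self ν =>
    simp only [map_mul, freeOp_fe, apply_mul, projOp_apply, MulOpposite.unop_op]
    split_ifs <;> rfl
  | e_mul_ne ν ν' hne =>
    simp only [map_mul, map_zero, freeOp_fe, apply_mul, projOp_apply, MulOpposite.unop_op]
    split_ifs with h1 h2
    · exact absurd (h2.symm.trans h1) hne
    · rfl
    · rfl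
  | sum_e =>
    have e : ∑ ν : Seqs I n β, MulOpposite.op (projOp k ν) =
        MulOpposite.op (∑ ν : Seqs I n β, projOp k ν) :=
      (map_sum MulOpposite.opAddEquiv _ _).symm
    simp only [map_sum, map_one, freeOp_fe, e, MulOpposite.unop_op, LinearMap.sum_apply,
      Finset.sum_apply, projOp_apply, Finset.sum_ite_eq, Finset.mem_univ, if_true]
    rfl
  | x_comm r t =>
    simp only [map_mul, freeOp_fx, apply_mul, mulOp_apply]
    ring
  | x_e r ν =>
    simp only [map_mul, freeOp_fx, freeOp_fe, apply_mul, mulOp_apply, projOp_apply,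
      MulOpposite.unop_op]
    split_ifs <;> simp
  | τ_e l ν =>
    have hz : tauAt Q prec l μ (0 : MvPolynomial (Fin n) k) = 0 := by
      have := congrFun (map_zero (tauOp (β := β) Q prec l)) μ
      exact this
    have : Seqs.act (simpleTransp l) μ = Seqs.act (simpleTransp l) ν ↔ μ = ν :=
      ⟨fun e => by simpa using congrArg (Seqs.act (simpleTransp l)) e, fun e => by rw [e]⟩
    simp only [map_mul, freeOp_fτ, freeOp_fe, apply_mul, tauOp_apply, projOp_apply,
      MulOpposite.unop_op, this]
    split_ifs
    · rfl
    · exact hz.symm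
  | τ_comm l m hlm =>
    simp only [map_mul, freeOp_fτ, apply_mul, MulOpposite.unop_op]
    rw [tauOp_comm hlm]
  | τ_sq l ν =>
    simp only [map_mul, freeOp_fτ, freeOp_fe, freeOp_evalAt, apply_mul, mulOp_apply, projOp_apply,
      MulOpposite.unop_op, tauOp_sq h]
    split_ifs with e
    · rw [e]
    · rfl
  | τ_x_lo l ν hν =>
    simp only [map_mul, map_sub, map_neg, freeOp_fτ, freeOp_fx, freeOp_fe, apply_mul, apply_sub,
      apply_neg, mulOp_apply, projOp_apply, MulOpposite.unop_op, simpleTransp_lo]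
    split_ifs with e
    · subst e
      simp only [tauOp_apply, mulOp_apply]
      rw [tauAt_mul, if_pos hν, demazure, divDiff_X_left (lo_ne_hi l).symm, permPoly_X,
        Seqs.act_simple_eq_self hν, simpleTransp_hi]
      ring
    · simp
  | τ_x_hi l ν hν =>
    simp only [map_mul, map_sub, freeOp_fτ, freeOp_fx, freeOp_fe, apply_mul, apply_sub,
      mulOp_apply, projOp_apply, MulOpposite.unop_op, simpleTransp_hi]
    split_ifs with e
    · subst e
      simp only [tauOp_apply, mulOp_apply]
      rw [tauAt_mul, if_pos hν, demazure, divDiff_X_right (lo_ne_hi l).symm, permPoly_X,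
        Seqs.act_simple_eq_self hν, simpleTransp_lo]
      ring
    · simp
  | τ_x_other l r ν hν =>
    simp only [map_mul, map_sub, map_zero, freeOp_fτ, freeOp_fx, freeOp_fe, apply_mul, apply_sub,
      apply_zero, mulOp_apply, projOp_apply, MulOpposite.unop_op]
    split_ifs with e
    · subst e
      simp only [tauOp_apply, mulOp_apply]
      have : (simpleTransp l) (simpleTransp l r) = r := Equiv.swap_apply_self _ _ _
      rw [tauAt_mul, permPoly_X, this]
      split_ifs with h1
      · rw [demazure, divDiff_X_other (lo_ne_hi l).symm]
        · ring
        · exact fun e => hν ⟨Or.inl (by rw [← this, e, simpleTransp_hi]), h1⟩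
        · exact fun e => hν ⟨Or.inr (by rw [← this, e, simpleTransp_lo]), h1⟩
      · ring
    · rfl
  | braid_eq l m hlm ν hν =>
    simp only [map_mul, map_sub, freeOp_fτ, freeOp_fe, freeOp_evalAt, apply_mul, apply_sub,
      mulOp_apply, projOp_apply, MulOpposite.unop_op, tauOp_braid h hlm]
    split_ifs with h1 h2
    · rw [h1]
    · subst h1; exact absurd hν h2
    · simp
  | braid_ne l m hlm ν hν =>
    simp only [map_mul, map_sub, map_zero, freeOp_fτ, freeOp_fe, apply_mul, apply_sub,
      apply_zero, projOp_apply, MulOpposite.unop_op, tauOp_braid h hlm]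
    split_ifs with h1 h2
    · subst h1; exact absurd h2 hν
    · rfl
    · rfl

/-- The right action of the Khovanov-Lauda-Rouquier algebra on families of polynomials. -/
def polRep (h : IsAdapted Q prec β) : KLR Q n β →ₐ[k] (Module.End k (Pol k n β))ᵐᵒᵖ :=
  RingQuot.liftAlgHom k ⟨freeOp Q prec, fun _ _ => freeOp_rel h⟩

/-- The right action on families of polynomials. -/
def ract (h : IsAdapted Q prec β) (F : Pol k n β) (y : KLR Q n β) : Pol k n β :=
  (polRep h y).unop F

end PolRep

/-! ### Induction over the generators of the algebra. -/

section KLRBasic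

open MvPolynomial

variable {k : Type*} [CommRing k] {I : Type*} [Fintype I] [DecidableEq I]
  {Q : I → I → MvPolynomial (Fin 2) k} {n : ℕ} {β : I → ℕ}

theorem klr_induction {p : KLR Q n β → Prop} (hs : ∀ c : k, p (algebraMap k _ c))
    (he : ∀ ν, p (klrE Q ν)) (hx : ∀ r, p (klrX Q β r)) (hτ : ∀ l, p (klrτ Q β l))
    (hadd : ∀ y z, p y → p z → p (y + z)) (hmul : ∀ y z, p y → p z → p (y * z))
    (y : KLR Q n β) : p y := by
  obtain ⟨z, rfl⟩ := RingQuot.mkAlgHom_surjective k (KLRRel Q n β) y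
  induction z using FreeAlgebra.induction with
  | grade0 c => rw [AlgHom.commutes]; exact hs c
  | grade1 g =>
    cases g with
    | e ν => exact he ν
    | x r => exact hx r
    | τ l => exact hτ l
  | mul a b ha hb => rw [map_mul]; exact hmul _ _ ha hb
  | add a b ha hb => rw [map_add]; exact hadd _ _ ha hb

end KLRBasic

/-! ### Stability of the ideals generated by the polynomials `g` under the right action. -/

section Stability

open MvPolynomial

variable {k : Type*} [CommRing k] [IsDomain k] {I : Type*} [DecidableEq I]
  {n : ℕ} {β : I → ℕ} {Q : I → I → MvPolynomial (Fin 2) k} {prec : I → I → Prop}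

section Ract

variable [Fintype I]

theorem ract_mul (h : IsAdapted Q prec β) (F : Pol k n β) (y z : KLR Q n β) :
    ract h F (y * z) = ract h (ract h F y) z := by
  simp [ract, Module.End.mul_apply]

theorem ract_add (h : IsAdapted Q prec β) (F : Pol k n β) (y z : KLR Q n β) :
    ract h F (y + z) = ract h F y + ract h F z := by
  simp [ract]

theorem ract_zero (h : IsAdapted Q prec β) (F : Pol k n β) : ract h F (0 : KLR Q n β) = 0 := by
  simp [ract]

theorem ract_neg (h : IsAdapted Q prec β) (F : Pol k n β) (y : KLR Q n β) :
    ract h F (-y) = -ract h F y := by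
  simp [ract]

theorem ract_smul (h : IsAdapted Q prec β) (F : Pol k n β) (c : k) (y : KLR Q n β) :
    ract h F (c • y) = c • ract h F y := by
  simp [ract]

theorem ract_algebraMap (h : IsAdapted Q prec β) (F : Pol k n β) (c : k) :
    ract h F (algebraMap k (KLR Q n β) c) = c • F := by
  rw [Algebra.algebraMap_eq_smul_one, ract_smul]
  simp [ract]

theorem ract_sum (h : IsAdapted Q prec β) (F : Pol k n β) {ι : Type*} (s : Finset ι)
    (y : ι → KLR Q n β) : ract h F (∑ i ∈ s, y i) = ∑ i ∈ s, ract h F (y i) := by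
  classical
  induction s using Finset.induction_on with
  | empty => simp [ract_zero]
  | insert i s hi ih => rw [Finset.sum_insert hi, Finset.sum_insert hi, ract_add, ih]

theorem polRep_mk (h : IsAdapted Q prec β) (z : FreeKLR k n β) :
    polRep h (RingQuot.mkAlgHom k (KLRRel Q n β) z) = freeOp Q prec z :=
  RingQuot.liftAlgHom_mkAlgHom_apply _ _ _ _

theorem ract_klrE (h : IsAdapted Q prec β) (F : Pol k n β) (ν μ : Seqs I n β) :
    ract h F (klrE Q ν) μ = if μ = ν then F μ else 0 := by
  rw [ract, klrE, polRep_mk, freeOp_fe]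
  rfl

theorem polRep_klrX (h : IsAdapted Q prec β) (r : Fin n) :
    polRep h (klrX Q β r) = mulOp k n β (X r) := by
  rw [klrX, polRep_mk, freeOp_fx]

theorem ract_klrτ (h : IsAdapted Q prec β) (F : Pol k n β) (l : Fin (n - 1)) :
    ract h F (klrτ Q β l) = tauOp Q prec l F := by
  rw [ract, klrτ, polRep_mk, freeOp_fτ]
  rfl

theorem ract_cycElem (h : IsAdapted Q prec β) (F : Pol k n β) (a : I → k[X]) (r : Fin n)
    (ν : Seqs I n β) :
    ract h F (cycElem Q β a r) ν = F ν * Polynomial.aeval (X r) (a (ν.1 r)) := by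
  have key : ∀ p : k[X], polRep h (Polynomial.aeval (klrX Q β r) p) =
      mulOp k n β (Polynomial.aeval (X r) p) := fun p => by
    rw [← Polynomial.aeval_algHom_apply, polRep_klrX, Polynomial.aeval_algHom_apply]
  rw [cycElem, ract_sum, Finset.sum_apply]
  simp only [ract_mul, ract_klrE]
  rw [Finset.sum_ite_eq, if_pos (Finset.mem_univ _), ract, key, mulOp_apply]

end Ract

/-- The polynomials `g_{ν,r}` for a fixed `r`, as a family of polynomials. -/
def gFam (Q : I → I → MvPolynomial (Fin 2) k) (a : I → k[X]) (prec : I → I → Prop) (r : ℕ) :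
    Pol k n β := fun ν => gPolyAux Q a prec r ν.1

variable {a : I → k[X]}

/-- The two recursion cases with distinct colours differ only by `factor`, and for equal colours the
transposition fixes `ν`; so the recursion is one application of `τ_r`. -/
theorem gPolyAux_succ {r : ℕ} (hr : r < n - 1) (h : IsAdapted Q prec β) (ν : Seqs I n β) :
    gPolyAux Q a prec (r + 1) ν.1 =
      tauAt Q prec ⟨r, hr⟩ ν (gPolyAux Q a prec r (Seqs.act (simpleTransp ⟨r, hr⟩) ν).1) := by
  rw [gPolyAux, dif_pos hr]
  simp only [tauAt, crossing, factor]
  split_ifs with h1 h2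
  · rw [Seqs.act_simple_eq_self h1]; rfl
  · rfl
  · rw [subst₂, map_one, mul_one]; rfl

theorem gFam_succ {r : ℕ} (hr : r < n - 1) (h : IsAdapted Q prec β) :
    gFam Q a prec (r + 1) = tauOp (β := β) Q prec ⟨r, hr⟩ (gFam Q a prec r) :=
  funext fun ν => gPolyAux_succ hr h ν

theorem gPolyAux_eq_zero {r : ℕ} (hr : n ≤ r) (ν : Fin n → I) : gPolyAux Q a prec r ν = 0 := by
  cases r with
  | zero => rw [gPolyAux, dif_neg (by omega)]
  | succ r => rw [gPolyAux, dif_neg (by omega)]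

/-- Only positions up to `r` enter the recursion; with `permPoly_gPolyAux` this makes `s_l` act
trivially on the member of index `r` when `r < l`. -/
theorem gPolyAux_congr {r : ℕ} {ν ν' : Fin n → I} (e : ∀ t : Fin n, t.val ≤ r → ν t = ν' t) :
    gPolyAux Q a prec r ν = gPolyAux Q a prec r ν' := by
  induction r generalizing ν ν' with
  | zero =>
    rw [gPolyAux, gPolyAux]
    split_ifs with h0
    · rw [e _ (Nat.zero_le _)]
    · rfl
  | succ r ih =>
    rw [gPolyAux, gPolyAux]
    split_ifs with hr
    · have e1 : ν (lo ⟨r, hr⟩) = ν' (lo ⟨r, hr⟩) := e _ (Nat.le_succ _)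
      have e2 : ν (hi ⟨r, hr⟩) = ν' (hi ⟨r, hr⟩) := e _ le_rfl
      have e3 : gPolyAux Q a prec r (permAct (simpleTransp ⟨r, hr⟩) ν) =
          gPolyAux Q a prec r (permAct (simpleTransp ⟨r, hr⟩) ν') := ih fun t ht => by
        simp only [permAct, simpleTransp_inv]
        by_cases h1 : t = lo ⟨r, hr⟩
        · rw [h1, simpleTransp_lo, e2]
        · rw [simpleTransp_of_ne h1]
          · exact e _ (by omega)
          · rintro rfl
            simp [hi] at ht
      simp only [e1, e2, e3, ih fun t ht => e t (ht.trans (Nat.le_succ _))]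
      split_ifs <;> simp_all
    · rfl

theorem permPoly_gPolyAux {r : ℕ} {ν : Fin n → I} (w : Equiv.Perm (Fin n))
    (hw : ∀ t : Fin n, t.val ≤ r → w t = t) :
    permPoly w (gPolyAux Q a prec r ν) = gPolyAux Q a prec r ν := by
  induction r generalizing ν with
  | zero =>
    rw [gPolyAux]
    split_ifs with h0
    · have : permPoly w (Polynomial.aeval (X (⟨0, h0⟩ : Fin n) : MvPolynomial (Fin n) k)
          (a (ν ⟨0, h0⟩))) = _ := (Polynomial.aeval_algHom_apply (rename w) _ _).symm
      rw [this, rename_X, hw _ le_rfl]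
    · simp
  | succ r ih =>
    have ih' := fun ν => ih (ν := ν) fun t ht => hw t (ht.trans (Nat.le_succ _))
    rw [gPolyAux]
    split_ifs with hr
    · have e1 : w (lo ⟨r, hr⟩) = lo ⟨r, hr⟩ := hw _ (Nat.le_succ _)
      have e2 : w (hi ⟨r, hr⟩) = hi ⟨r, hr⟩ := hw _ le_rfl
      have e3 : ∀ f : MvPolynomial (Fin n) k, permPoly w (permPoly (simpleTransp ⟨r, hr⟩) f) =
          permPoly (simpleTransp ⟨r, hr⟩) (permPoly w f) := fun f => by
        rw [permPoly_permPoly, permPoly_permPoly]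
        congr 1
        have := Equiv.swap_apply_apply w (lo ⟨r, hr⟩) (hi ⟨r, hr⟩)
        rw [e1, e2] at this
        rw [simpleTransp, eq_mul_inv_iff_mul_eq.1 this]
      dsimp only
      split_ifs
      · rw [demazure, permPoly_divDiff _ (lo_ne_hi _).symm, e1, e2, ih']
      · rw [permPoly_mul, permPoly_subst₂, e1, e2, e3, ih']
      · rw [e3, ih']
    · simp

theorem gFam_simple {r : ℕ} {l : Fin (n - 1)} (hrl : r < l.val) (ν : Seqs I n β) :
    gFam Q a prec r (Seqs.act (simpleTransp l) ν) = gFam Q a prec r ν :=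
  gPolyAux_congr fun t ht => by
    rw [Seqs.act_simple_apply, simpleTransp_of_ne] <;>
    · rintro rfl
      simp only [lo, hi] at ht
      omega

theorem permPoly_gFam {r : ℕ} {l : Fin (n - 1)} (hrl : r < l.val) (ν : Seqs I n β) :
    permPoly (simpleTransp l) (gFam Q a prec r ν) = gFam Q a prec r ν :=
  permPoly_gPolyAux _ fun t ht => by
    rw [simpleTransp_of_ne] <;>
    · rintro rfl
      simp only [lo, hi] at ht
      omega

/-- The ideal generated by the polynomials `g_{ν,r}` with `r < m`. -/
def gIdeal (Q : I → I → MvPolynomial (Fin 2) k) (a : I → k[X]) (prec : I → I → Prop) (m : ℕ)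
    (ν : Seqs I n β) : Ideal (MvPolynomial (Fin n) k) :=
  Ideal.span {f | ∃ r < m, f = gFam Q a prec r ν}

theorem gFam_mem_gIdeal {r m : ℕ} (h : r < m) (ν : Seqs I n β) :
    gFam Q a prec r ν ∈ gIdeal Q a prec m ν := Ideal.subset_span ⟨r, h, rfl⟩

theorem gIdeal_mono {m m' : ℕ} (h : m ≤ m') (ν : Seqs I n β) :
    gIdeal Q a prec m ν ≤ gIdeal Q a prec m' ν :=
  Ideal.span_mono fun _ ⟨r, hr, e⟩ => ⟨r, hr.trans_le h, e⟩

theorem tauAt_zero (l : Fin (n - 1)) (ν : Seqs I n β) :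
    tauAt Q prec l ν (0 : MvPolynomial (Fin n) k) = 0 :=
  congrFun (map_zero (tauOp (β := β) Q prec l)) ν

theorem tauAt_add (l : Fin (n - 1)) (ν : Seqs I n β) (f g : MvPolynomial (Fin n) k) :
    tauAt Q prec l ν (f + g) = tauAt Q prec l ν f + tauAt Q prec l ν g :=
  crossing_add _ (lo_ne_hi l) _ _ _ _

/-- By the twisted Leibniz rule generators suffice: the correction term occurs only for equal
colours, when `s_l` fixes `ν` and the undifferentiated factor already lies in the ideal at `ν`. -/
theorem tauAt_mem {l : Fin (n - 1)} {ν : Seqs I n β} {m m' : ℕ} (hm : m ≤ m')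
    (H : ∀ r < m, tauAt Q prec l ν (gFam Q a prec r (Seqs.act (simpleTransp l) ν)) ∈
      gIdeal Q a prec m' ν)
    {f : MvPolynomial (Fin n) k} (hf : f ∈ gIdeal Q a prec m (Seqs.act (simpleTransp l) ν)) :
    tauAt Q prec l ν f ∈ gIdeal Q a prec m' ν := by
  unfold gIdeal Ideal.span at hf
  induction hf using Submodule.span_induction with
  | mem x hx =>
    obtain ⟨r, hr, rfl⟩ := hx
    exact H r hr
  | zero => rw [tauAt_zero]; exact zero_mem _
  | add x y _ _ hx hy => rw [tauAt_add]; exact add_mem hx hy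
  | smul c x hx0 hx =>
    rw [smul_eq_mul, mul_comm, tauAt_mul]
    refine add_mem (Ideal.mul_mem_right _ _ hx) ?_
    split_ifs with e
    · rw [Seqs.act_simple_eq_self e] at hx0
      exact Ideal.mul_mem_right _ _ (gIdeal_mono hm ν hx0)
    · exact zero_mem _

theorem tauAt_eq_mul {l : Fin (n - 1)} {ν : Seqs I n β} {f : MvPolynomial (Fin n) k}
    (hf : permPoly (simpleTransp l) f = f) : ∃ q, tauAt Q prec l ν f = f * q := by
  unfold tauAt crossing
  split_ifs
  · exact ⟨0, by rw [divDiff_eq_zero (lo_ne_hi l).symm (by rwa [Equiv.swap_comm]), mul_zero]⟩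
  · exact ⟨_, congrArg (· * _) hf⟩

theorem tauAt_gFam_mem_of_lt {r : ℕ} {l : Fin (n - 1)} (hrl : r < l.val) (ν : Seqs I n β) :
    tauAt Q prec l ν (gFam Q a prec r (Seqs.act (simpleTransp l) ν)) ∈
      gIdeal Q a prec (r + 1) ν := by
  rw [gFam_simple hrl]
  obtain ⟨q, hq⟩ := tauAt_eq_mul (Q := Q) (prec := prec) (ν := ν)
    (permPoly_gFam (Q := Q) (a := a) (prec := prec) hrl ν)
  rw [hq]
  exact Ideal.mul_mem_right _ _ (gFam_mem_gIdeal (Nat.lt_succ_self r) ν)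

theorem tauOp_mem_of_le {m : ℕ} {l : Fin (n - 1)} (hml : m ≤ l.val) {F : Pol k n β}
    (hF : ∀ ν, F ν ∈ gIdeal Q a prec m ν) (ν : Seqs I n β) :
    tauOp Q prec l F ν ∈ gIdeal Q a prec m ν :=
  tauAt_mem le_rfl (fun r hr => gIdeal_mono hr ν (tauAt_gFam_mem_of_lt (hr.trans_le hml) ν)) (hF _)

theorem tauOp_mem_succ (h : IsAdapted Q prec β) (l : Fin (n - 1)) {F : Pol k n β}
    (hF : ∀ ν, F ν ∈ gIdeal Q a prec (l + 1) ν) (ν : Seqs I n β) :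
    tauOp Q prec l F ν ∈ gIdeal Q a prec (l + 2) ν := by
  refine tauAt_mem (Nat.le_succ _) (fun r hr => ?_) (hF _)
  rcases (Nat.lt_succ_iff.1 hr).lt_or_eq with h1 | h1
  · exact gIdeal_mono (by omega) ν (tauAt_gFam_mem_of_lt h1 ν)
  · subst h1
    rw [← tauOp_apply, ← gFam_succ l.2 h]
    exact gFam_mem_gIdeal (Nat.lt_succ_self _) ν

/-- The member of index `r` is obtained from the first by `τ_0, …, τ_{r-1}` in turn. For `r < l` it
is free of the variables exchanged by `τ_l` and gets multiplied by a polynomial; for `r = l` the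
next member appears; `r = l + 1` is the quadratic relation, `r = l + 2` the braid relation, and for
larger `r` the operator commutes with the last one applied. The bound on the index is what makes the
induction run. -/
theorem tauOp_gFam_mem (h : IsAdapted Q prec β) (l : Fin (n - 1)) (r : ℕ) (ν : Seqs I n β) :
    tauOp Q prec l (gFam Q a prec r) ν ∈ gIdeal Q a prec (max (r + 1) (l + 2)) ν := by
  rcases lt_or_ge r l.val with h1 | h1
  · exact gIdeal_mono (le_max_left _ _) ν (tauAt_gFam_mem_of_lt h1 ν)
  rcases h1.eq_or_lt with h1 | h1
  · refine gIdeal_mono (le_max_right _ _) ν (tauOp_mem_succ h l (fun ν => ?_) ν)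
    exact gFam_mem_gIdeal (by omega) ν
  have : ∀ j : ℕ, ∀ ν : Seqs I n β,
      tauOp Q prec l (gFam Q a prec (l + 1 + j)) ν ∈ gIdeal Q a prec (l + 2 + j) ν := by
    intro j
    induction j with
    | zero =>
      intro ν
      rw [add_zero, gFam_succ l.2 h, tauOp_sq h]
      exact Ideal.mul_mem_right _ _ (gFam_mem_gIdeal (by omega) ν)
    | succ j ih =>
      intro ν
      by_cases hn : l.val + 1 + j < n - 1
      · have e : gFam Q a prec (l + 1 + (j + 1)) =
            tauOp (β := β) Q prec ⟨l + 1 + j, hn⟩ (gFam Q a prec (l + 1 + j)) := gFam_succ hn h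
        cases j with
        | zero =>
          set m : Fin (n - 1) := ⟨l + 1 + 0, hn⟩ with hm
          -- The member of index `l + 2` is `τ_{l+1} τ_l` applied to that of index `l`. The braid
          -- relation replaces `τ_l τ_{l+1} τ_l` by `τ_{l+1} τ_l τ_{l+1}`, whose three steps stay in
          -- ideals of index `l + 1`, `l + 2`, `l + 3`, up to a multiple of the member of index `l`.
          have hb := tauOp_braid h (l := l) (m := m) rfl (gFam Q a prec l) ν
          rw [e, add_zero, gFam_succ l.2 h]
          rw [sub_eq_iff_eq_add'] at hb
          have h1 : tauOp Q prec m (tauOp Q prec l (tauOp Q prec m (gFam Q a prec l))) ν ∈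
              gIdeal Q a prec (l + 2 + (0 + 1)) ν := by
            refine tauOp_mem_succ h m (fun ν => ?_) ν
            refine tauOp_mem_succ h l (fun ν => ?_) ν
            refine tauOp_mem_of_le (by simp [hm]) (fun ν => ?_) ν
            exact gFam_mem_gIdeal (by omega) ν
          rw [hb] at h1
          refine (Submodule.add_mem_iff_left _ ?_).1 h1
          split_ifs
          · exact Ideal.mul_mem_right _ _ (gFam_mem_gIdeal (by omega) ν)
          · exact zero_mem _
        | succ j =>
          rw [e, tauOp_comm (by simp only []; omega)]
          exact gIdeal_mono (by dsimp only; omega) ν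
            (tauOp_mem_succ h ⟨l + 1 + (j + 1), hn⟩
              (fun ν => gIdeal_mono (by dsimp only; omega) ν (ih ν)) ν)
      -- Past the last position the polynomials are zero by convention.
      · have e : gFam Q a prec (l + 1 + (j + 1)) = (0 : Pol k n β) :=
          funext fun ν => gPolyAux_eq_zero (by omega) _
        rw [e, map_zero]
        exact zero_mem _
  have := this (r - (l + 1)) ν
  rw [show l.val + 1 + (r - (l + 1)) = r by omega] at this
  exact gIdeal_mono (by omega) ν this

theorem tauOp_mem (h : IsAdapted Q prec β) (l : Fin (n - 1)) {F : Pol k n β}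
    (hF : ∀ ν, F ν ∈ gIdeal Q a prec n ν) (ν : Seqs I n β) :
    tauOp Q prec l F ν ∈ gIdeal Q a prec n ν :=
  tauAt_mem le_rfl (fun r hr => gIdeal_mono (by omega) ν (tauOp_gFam_mem h l r ν)) (hF _)

variable [Fintype I]

theorem ract_mem (h : IsAdapted Q prec β) (y : KLR Q n β) : ∀ {F : Pol k n β},
    (∀ ν, F ν ∈ gIdeal Q a prec n ν) → ∀ ν, ract h F y ν ∈ gIdeal Q a prec n ν := by
  induction y using klr_induction with
  | hs c =>
    intro F hF ν
    rw [ract_algebraMap, Pi.smul_apply, smul_eq_C_mul]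
    exact Ideal.mul_mem_left _ _ (hF ν)
  | he μ =>
    intro F hF ν
    rw [ract_klrE]
    split_ifs
    · exact hF ν
    · exact zero_mem _
  | hx r =>
    intro F hF ν
    rw [ract, polRep_klrX, mulOp_apply]
    exact Ideal.mul_mem_right _ _ (hF ν)
  | hτ l =>
    intro F hF ν
    rw [ract_klrτ]
    exact tauOp_mem h l hF ν
  | hadd y z hy hz =>
    intro F hF ν
    rw [ract_add]
    exact add_mem (hy hF ν) (hz hF ν)
  | hmul y z hy hz =>
    intro F hF
    rw [ract_mul]
    exact hz (hy hF)

/-- The cyclotomic ideal maps all families of polynomials to the ideals generated by the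
polynomials `g_{ν,r}`. -/
theorem ract_mem_of_mem_cycIdeal (h : IsAdapted Q prec β) {y : KLR Q n β}
    (hy : y ∈ cycIdeal Q β n a) (F : Pol k n β) (ν : Seqs I n β) :
    ract h F y ν ∈ gIdeal Q a prec n ν := by
  -- The elements sending all families into the ideals form a two-sided ideal: a left factor only
  -- changes the family, a right factor is handled by stability. Only the generator remains to be
  -- tested.
  let J : TwoSidedIdeal (KLR Q n β) :=
    TwoSidedIdeal.mk' {y | ∀ F : Pol k n β, ∀ ν, ract h F y ν ∈ gIdeal Q a prec n ν}
      (fun F ν => by rw [ract_zero]; exact zero_mem _)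
      (fun {y z} hy hz F ν => by rw [ract_add]; exact add_mem (hy F ν) (hz F ν))
      (fun {y} hy F ν => by rw [ract_neg]; exact neg_mem (hy F ν))
      (fun {y z} hz F ν => by rw [ract_mul]; exact hz _ ν)
      (fun {y z} hy F ν => by rw [ract_mul]; exact ract_mem h z (hy F) ν)
  have hJ : cycIdeal Q β n a ≤ J := by
    refine TwoSidedIdeal.span_le.2 ?_
    rintro _ ⟨r, hr, rfl⟩
    refine (TwoSidedIdeal.mem_mk' _ _ _ _ _ _ _).2 fun F ν => ?_
    rw [ract_cycElem]
    refine Ideal.mul_mem_left _ _ ?_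
    have hn : 0 < n := by have := r.2; omega
    have := gFam_mem_gIdeal (Q := Q) (a := a) (prec := prec) hn ν
    rw [gFam, gPolyAux, dif_pos hn] at this
    rwa [show r = ⟨0, hn⟩ from Fin.ext hr]
  exact (TwoSidedIdeal.mem_mk' _ _ _ _ _ _ _).1 (hJ hy) F ν

end Stability

/-! ### Inversions and reduced expressions -/

section Inversions

variable {n : ℕ}

/-- The set of inversions of a permutation. -/
def inversions (w : Equiv.Perm (Fin n)) : Finset (Fin n × Fin n) :=
  Finset.univ.filter fun p => p.1 < p.2 ∧ w p.2 < w p.1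

/-- The number of inversions of a permutation. -/
def invCount (w : Equiv.Perm (Fin n)) : ℕ := (inversions w).card

theorem mem_inversions {w : Equiv.Perm (Fin n)} {p : Fin n × Fin n} :
    p ∈ inversions w ↔ p.1 < p.2 ∧ w p.2 < w p.1 := by simp [inversions]

theorem lo_lt_hi (l : Fin (n - 1)) : lo l < hi l := by simp [lo, hi]

theorem simpleTransp_val (l : Fin (n - 1)) (r : Fin n) :
    (simpleTransp l r).val = if r.val = l.val then l.val + 1 else
      if r.val = l.val + 1 then l.val else r.val := by
  have e1 : r = lo l ↔ r.val = l.val := Fin.ext_iff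
  have e2 : r = hi l ↔ r.val = l.val + 1 := Fin.ext_iff
  rw [simpleTransp, Equiv.swap_apply_def, apply_ite Fin.val, apply_ite Fin.val]
  simp only [e1, e2]
  rfl

theorem simpleTransp_lt {l : Fin (n - 1)} {r t : Fin n} (h : r < t)
    (h' : ¬ (r = lo l ∧ t = hi l)) : simpleTransp l r < simpleTransp l t := by
  have h2 : ¬ (r.val = l.val ∧ t.val = l.val + 1) := fun e => h' ⟨Fin.ext e.1, Fin.ext e.2⟩
  rw [Fin.lt_def] at h ⊢
  rw [simpleTransp_val, simpleTransp_val]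
  split_ifs <;> omega

/-- Transport of pairs by `s_l` matches the inversions of both permutations, except for the new pair
`(lo l, hi l)`. -/
theorem invCount_mul_simple {w : Equiv.Perm (Fin n)} {l : Fin (n - 1)}
    (h : w (lo l) < w (hi l)) : invCount (w * simpleTransp l) = invCount w + 1 := by
  have hs : ∀ r, simpleTransp l (simpleTransp l r) = r := fun r => Equiv.swap_apply_self _ _ _
  have key : inversions (w * simpleTransp l) = insert (lo l, hi l)
      ((inversions w).map ((simpleTransp l).prodCongr (simpleTransp l)).toEmbedding) := by
    ext ⟨r, t⟩
    simp only [Finset.mem_insert, Finset.mem_map, mem_inversions, Equiv.Perm.mul_apply, Prod.exists,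
      Equiv.coe_toEmbedding, Equiv.prodCongr_apply, Prod.map_apply, Prod.mk.injEq]
    constructor
    · rintro ⟨h1, h2⟩
      by_cases h3 : r = lo l ∧ t = hi l
      · exact Or.inl h3
      · exact Or.inr ⟨simpleTransp l r, simpleTransp l t, ⟨simpleTransp_lt h1 h3, h2⟩, hs r, hs t⟩
    · rintro (⟨rfl, rfl⟩ | ⟨r', t', ⟨h1, h2⟩, rfl, rfl⟩)
      · exact ⟨lo_lt_hi l, by simpa using h⟩
      · refine ⟨simpleTransp_lt h1 ?_, by rwa [hs, hs]⟩
        rintro ⟨rfl, rfl⟩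
        exact absurd h2 h.not_gt
  rw [invCount, key, Finset.card_insert_of_notMem, Finset.card_map, invCount]
  simp only [Finset.mem_map, mem_inversions, Prod.exists, Equiv.coe_toEmbedding,
    Equiv.prodCongr_apply, Prod.map_apply, Prod.mk.injEq, not_exists, not_and]
  rintro r t ⟨h1, h2⟩ h3 h4
  have h5 : r = hi l := by rw [← hs r, h3, simpleTransp_lo]
  have h6 : t = lo l := by rw [← hs t, h4, simpleTransp_hi]
  rw [h5, h6] at h1
  exact absurd h1 (lo_lt_hi l).not_gt

theorem mul_simple_mul_simple (w : Equiv.Perm (Fin n)) (l : Fin (n - 1)) :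
    w * simpleTransp l * simpleTransp l = w := by
  rw [mul_assoc, simpleTransp_mul_self, mul_one]

theorem invCount_mul_simple_add_one {w : Equiv.Perm (Fin n)} {l : Fin (n - 1)}
    (h : w (hi l) < w (lo l)) : invCount (w * simpleTransp l) + 1 = invCount w := by
  rw [← invCount_mul_simple (w := w * simpleTransp l) (l := l) (by simpa using h), mul_simple_mul_simple]

theorem lt_or_gt_simple (w : Equiv.Perm (Fin n)) (l : Fin (n - 1)) :
    w (lo l) < w (hi l) ∨ w (hi l) < w (lo l) :=
  lt_or_gt_of_ne fun e => lo_ne_hi l (w.injective e)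

@[simp] theorem invCount_one : invCount (1 : Equiv.Perm (Fin n)) = 0 := by
  rw [invCount, Finset.card_eq_zero, inversions, Finset.filter_eq_empty_iff]
  rintro ⟨r, t⟩ _ ⟨h1, h2⟩
  exact absurd h1 (not_lt.2 h2.le)

/-- The bound `m` is there for the rightmost descent, after which a permutation is increasing. -/
theorem strictMono_of_forall_lo_lt_hi {w : Fin n → Fin n} {m : ℕ}
    (h : ∀ l : Fin (n - 1), m ≤ l.val → w (lo l) < w (hi l)) {r t : Fin n} (hr : m ≤ r.val)
    (hrt : r < t) : w r < w t := by
  obtain ⟨r, hrn⟩ := r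
  obtain ⟨t, htn⟩ := t
  rw [Fin.mk_lt_mk] at hrt
  induction t with
  | zero => omega
  | succ t ih =>
    have h1 := h ⟨t, by omega⟩ (by simp only at hr ⊢; omega)
    rcases (Nat.lt_succ_iff.1 hrt).eq_or_lt with h2 | h2
    · subst h2
      exact h1
    · exact (ih (by omega) h2).trans h1

theorem exists_descent {w : Equiv.Perm (Fin n)} (hw : w ≠ 1) :
    ∃ l, w (hi l) < w (lo l) := by
  by_contra! hcon
  have hm : StrictMono w := fun r t hrt => strictMono_of_forall_lo_lt_hi (m := 0)
    (fun l _ => (lt_or_gt_simple w l).resolve_right (hcon l).not_gt) (Nat.zero_le _) hrt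
  apply hw
  -- `Fin n` has only one order automorphism.
  have : hm.orderIsoOfSurjective w w.surjective = OrderIso.refl _ := Subsingleton.elim _ _
  exact Equiv.ext fun r => congrArg (fun f : Fin n ≃o Fin n => f r) this

theorem invCount_prod_le (L : List (Fin (n - 1))) :
    invCount (L.map simpleTransp).prod ≤ L.length := by
  induction L using List.reverseRecOn with
  | nil => simp
  | append_singleton L l ih =>
    rw [List.map_append, List.prod_append, List.map_singleton, List.prod_singleton,
      List.length_append, List.length_singleton]
    rcases lt_or_gt_simple (L.map simpleTransp).prod l with h | h
    · rw [invCount_mul_simple h]; omega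
    · have := invCount_mul_simple_add_one h; omega

theorem exists_word (w : Equiv.Perm (Fin n)) :
    ∃ L : List (Fin (n - 1)), (L.map simpleTransp).prod = w ∧ L.length = invCount w := by
  induction hN : invCount w generalizing w with
  | zero =>
    by_cases hw : w = 1
    · exact ⟨[], by simp [hw]⟩
    · obtain ⟨l, hl⟩ := exists_descent hw
      have := invCount_mul_simple_add_one hl
      omega
  | succ N ih =>
    have hw : w ≠ 1 := by rintro rfl; simp at hN
    obtain ⟨l, hl⟩ := exists_descent hw
    have h1 := invCount_mul_simple_add_one hl
    obtain ⟨L, hL, hL'⟩ := ih (w * simpleTransp l) (by omega)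
    exact ⟨L ++ [l], by simp [hL, mul_simple_mul_simple], by simp [hL']⟩

/-- Each letter changes the number of inversions by one, and removing descents reaches the identity
with no wasted letter; minimality becomes an equality of numbers. -/
theorem isReducedExpr_iff {w : Equiv.Perm (Fin n)} {L : List (Fin (n - 1))} :
    IsReducedExpr w L ↔ (L.map simpleTransp).prod = w ∧ L.length = invCount w := by
  constructor
  · rintro ⟨h1, h2⟩
    obtain ⟨L', h3, h4⟩ := exists_word w
    refine ⟨h1, le_antisymm ((h2 L' h3).trans_eq h4) ?_⟩
    rw [← h1]
    exact invCount_prod_le L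
  · rintro ⟨h1, h2⟩
    refine ⟨h1, fun L' h3 => ?_⟩
    rw [h2, ← h3]
    exact invCount_prod_le L'

theorem IsReducedExpr.concat {w : Equiv.Perm (Fin n)} {L : List (Fin (n - 1))} {l : Fin (n - 1)}
    (h : IsReducedExpr w L) (hl : w (lo l) < w (hi l)) :
    IsReducedExpr (w * simpleTransp l) (L ++ [l]) := by
  rw [isReducedExpr_iff] at h ⊢
  rw [invCount_mul_simple hl]
  simp [h.1, h.2]

theorem IsReducedExpr.of_concat {w : Equiv.Perm (Fin n)} {L : List (Fin (n - 1))} {l : Fin (n - 1)}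
    (h : IsReducedExpr w (L ++ [l])) :
    w (hi l) < w (lo l) ∧ IsReducedExpr (w * simpleTransp l) L := by
  rw [isReducedExpr_iff] at h
  obtain ⟨h1, h2⟩ := h
  have h3 : (L.map simpleTransp).prod = w * simpleTransp l := by
    rw [← h1]
    simp [mul_simple_mul_simple]
  have h4 := invCount_prod_le L
  rw [h3] at h4
  rw [List.length_append, List.length_singleton] at h2
  rcases lt_or_gt_simple w l with h | h
  · rw [invCount_mul_simple h] at h4
    omega
  · have := invCount_mul_simple_add_one h
    exact ⟨h, isReducedExpr_iff.2 ⟨h3, by omega⟩⟩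

theorem exists_isReducedExpr (w : Equiv.Perm (Fin n)) : ∃ L, IsReducedExpr w L :=
  (exists_word w).imp fun _ h => isReducedExpr_iff.2 h

theorem invCount_inv (w : Equiv.Perm (Fin n)) : invCount w⁻¹ = invCount w := by
  refine Finset.card_nbij' (fun p => (w⁻¹ p.2, w⁻¹ p.1)) (fun p => (w p.2, w p.1)) ?_ ?_ ?_ ?_
  · rintro ⟨r, t⟩ h
    simpa [mem_inversions, and_comm] using h
  · rintro ⟨r, t⟩ h
    simpa [mem_inversions, and_comm] using h
  · rintro ⟨r, t⟩ h
    simp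
  · rintro ⟨r, t⟩ h
    simp

theorem invCount_simple_mul {w : Equiv.Perm (Fin n)} {l : Fin (n - 1)}
    (h : w⁻¹ (lo l) < w⁻¹ (hi l)) : invCount (simpleTransp l * w) = invCount w + 1 := by
  rw [← invCount_inv, mul_inv_rev, simpleTransp_inv, invCount_mul_simple h, invCount_inv]

theorem simple_mul_simple_mul (w : Equiv.Perm (Fin n)) (l : Fin (n - 1)) :
    simpleTransp l * (simpleTransp l * w) = w := by
  rw [← mul_assoc, simpleTransp_mul_self, one_mul]

theorem IsReducedExpr.cons {w : Equiv.Perm (Fin n)} {L : List (Fin (n - 1))} {l : Fin (n - 1)}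
    (h : IsReducedExpr w L) (hl : w⁻¹ (lo l) < w⁻¹ (hi l)) :
    IsReducedExpr (simpleTransp l * w) (l :: L) := by
  rw [isReducedExpr_iff] at h ⊢
  rw [invCount_simple_mul hl]
  simp [h.1, h.2]

theorem isReducedExpr_one_iff {L : List (Fin (n - 1))} : IsReducedExpr 1 L ↔ L = [] := by
  rw [isReducedExpr_iff, invCount_one, List.length_eq_zero_iff]
  constructor
  · exact fun h => h.2
  · rintro rfl
    simp

end Inversions

/-! ### Relations in the Khovanov-Lauda-Rouquier algebra -/

section Relations

open MvPolynomial

variable {k : Type*} [CommRing k] [IsDomain k] {I : Type*} [Fintype I] [DecidableEq I]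
  {Q : I → I → MvPolynomial (Fin 2) k} {n : ℕ} {β : I → ℕ}

theorem mk_rel {y z : FreeKLR k n β} (h : KLRRel Q n β y z) :
    RingQuot.mkAlgHom k (KLRRel Q n β) y = RingQuot.mkAlgHom k (KLRRel Q n β) z :=
  RingQuot.mkAlgHom_rel k h

theorem klrE_mul_self (ν : Seqs I n β) : klrE Q ν * klrE Q ν = klrE Q ν := by
  simpa only [map_mul] using! mk_rel (KLRRel.e_mul_self (Q := Q) ν)

theorem klrE_mul_ne {ν ν' : Seqs I n β} (h : ν ≠ ν') : klrE Q ν * klrE Q ν' = 0 := by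
  simpa only [map_mul, map_zero] using! mk_rel (KLRRel.e_mul_ne (Q := Q) ν ν' h)

variable (Q β) in
theorem klrX_comm (r t : Fin n) : klrX Q β r * klrX Q β t = klrX Q β t * klrX Q β r := by
  simpa only [map_mul] using! mk_rel (KLRRel.x_comm (Q := Q) (β := β) r t)

theorem klrX_mul_klrE (r : Fin n) (ν : Seqs I n β) :
    klrX Q β r * klrE Q ν = klrE Q ν * klrX Q β r := by
  simpa only [map_mul] using! mk_rel (KLRRel.x_e (Q := Q) r ν)

theorem klrτ_mul_klrE (l : Fin (n - 1)) (ν : Seqs I n β) :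
    klrτ Q β l * klrE Q ν = klrE Q (Seqs.act (simpleTransp l) ν) * klrτ Q β l := by
  simpa only [map_mul] using! mk_rel (KLRRel.τ_e (Q := Q) l ν)

theorem klrτ_comm {l m : Fin (n - 1)} (h : l.val + 1 < m.val ∨ m.val + 1 < l.val) :
    klrτ Q β l * klrτ Q β m = klrτ Q β m * klrτ Q β l := by
  simpa only [map_mul] using! mk_rel (KLRRel.τ_comm (Q := Q) (β := β) l m h)

variable (Q β) in
/-- The evaluation of polynomials at the elements `x_1, …, x_n`. -/
def polyHom : MvPolynomial (Fin n) k →ₐ[k] KLR Q n β := evalHom (klrX Q β) (klrX_comm Q β)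

theorem mk_evalAt (f : MvPolynomial (Fin n) k) :
    RingQuot.mkAlgHom k (KLRRel Q n β) (evalAt (fx k β) f) = polyHom Q β f := by
  rw [map_evalAt]
  exact evalAt_eq_evalHom _ _ _

@[simp] theorem polyHom_X (r : Fin n) : polyHom Q β (X r) = klrX Q β r := evalHom_X _ _ _

theorem klrτ_sq (l : Fin (n - 1)) (ν : Seqs I n β) :
    klrτ Q β l * klrτ Q β l * klrE Q ν =
      polyHom Q β (subst₂ (Q (ν.1 (lo l)) (ν.1 (hi l))) (lo l) (hi l)) * klrE Q ν := by
  simpa only [map_mul, mk_evalAt] using! mk_rel (KLRRel.τ_sq (Q := Q) l ν)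

theorem polyHom_mul_klrE (f : MvPolynomial (Fin n) k) (ν : Seqs I n β) :
    polyHom Q β f * klrE Q ν = klrE Q ν * polyHom Q β f := by
  induction f using MvPolynomial.induction_on with
  | C c =>
    rw [← MvPolynomial.algebraMap_eq, AlgHom.commutes]
    exact Algebra.commutes _ _
  | add p q hp hq => rw [map_add, add_mul, mul_add, hp, hq]
  | mul_X p r hp => rw [map_mul, polyHom_X, mul_assoc, klrX_mul_klrE, ← mul_assoc, hp, mul_assoc]

theorem klrτ_mul_klrX (l : Fin (n - 1)) (r : Fin n) (ν : Seqs I n β) :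
    klrτ Q β l * klrX Q β r * klrE Q ν =
      (klrX Q β (simpleTransp l r) * klrτ Q β l +
        if ν.1 (lo l) = ν.1 (hi l) then polyHom Q β (demazure l (X r)) else 0) * klrE Q ν := by
  rw [add_mul, ← sub_eq_iff_eq_add', ← sub_mul]
  by_cases h : (r = lo l ∨ r = hi l) ∧ ν.1 (lo l) = ν.1 (hi l)
  · obtain ⟨rfl | rfl, h⟩ := h
    · have e : polyHom Q β (-1) * klrE Q ν = -klrE Q ν := by
        refine eq_neg_of_add_eq_zero_left ?_
        conv_lhs => arg 2; rw [← one_mul (klrE Q ν), ← map_one (polyHom Q β)]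
        rw [← add_mul, ← map_add, neg_add_cancel, map_zero, zero_mul]
      rw [if_pos h, demazure, divDiff_X_right (lo_ne_hi l).symm, e]
      simpa only [map_mul, map_sub, map_neg] using! mk_rel (KLRRel.τ_x_lo (Q := Q) l ν h)
    · rw [if_pos h, demazure, divDiff_X_left (lo_ne_hi l).symm, map_one, one_mul]
      simpa only [map_mul, map_sub] using! mk_rel (KLRRel.τ_x_hi (Q := Q) l ν h)
  · have := mk_rel (KLRRel.τ_x_other (Q := Q) l r ν h)
    simp only [map_mul, map_sub, map_zero] at this
    refine this.trans ?_
    split_ifs with h1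
    · rw [demazure, divDiff_X_other (lo_ne_hi l).symm (fun e => h ⟨Or.inr e, h1⟩)
        (fun e => h ⟨Or.inl e, h1⟩), map_zero, zero_mul]
    · rw [zero_mul]

theorem demazure_mul (l : Fin (n - 1)) (f g : MvPolynomial (Fin n) k) :
    demazure l (f * g) = demazure l f * permPoly (simpleTransp l) g + f * demazure l g := by
  rw [demazure, divDiff_mul (lo_ne_hi l).symm, simpleTransp, Equiv.swap_comm]
  rfl

theorem klrτ_mul_polyHom (l : Fin (n - 1)) (f : MvPolynomial (Fin n) k) (ν : Seqs I n β) :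
    klrτ Q β l * polyHom Q β f * klrE Q ν =
      (polyHom Q β (permPoly (simpleTransp l) f) * klrτ Q β l +
        if ν.1 (lo l) = ν.1 (hi l) then polyHom Q β (demazure l f) else 0) * klrE Q ν := by
  induction f using MvPolynomial.induction_on with
  | C c =>
    have : demazure l (C c : MvPolynomial (Fin n) k) = 0 :=
      divDiff_eq_zero (lo_ne_hi l).symm (permPoly_C _ _)
    rw [this, permPoly_C, map_zero, ite_self, add_zero, ← MvPolynomial.algebraMap_eq,
      AlgHom.commutes, Algebra.commutes]
  | add p q hp hq =>
    have : demazure l (p + q) = demazure l p + demazure l q := divDiff_add (lo_ne_hi l).symm _ _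
    rw [map_add, mul_add, add_mul, hp, hq, permPoly_add, this, map_add, map_add]
    split_ifs <;> noncomm_ring
  | mul_X p r hp =>
    have h1 := klrτ_mul_klrX (Q := Q) l r ν
    have h2 : klrτ Q β l * polyHom Q β (p * X r) * klrE Q ν =
        klrτ Q β l * polyHom Q β p * klrE Q ν * klrX Q β r := by
      rw [map_mul, polyHom_X, mul_assoc _ (klrE Q ν), ← klrX_mul_klrE]
      simp only [mul_assoc]
    have h3 : demazure l (p * X r) =
        permPoly (simpleTransp l) p * demazure l (X r) + demazure l p * X r := by
      rw [mul_comm, demazure_mul]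
      ring
    rw [h2, hp, h3, mul_assoc, ← klrX_mul_klrE, ← mul_assoc, add_mul _ _ (klrX Q β r), add_mul,
      mul_assoc (polyHom Q β (permPoly (simpleTransp l) p)) (klrτ Q β l),
      mul_assoc (polyHom Q β (permPoly (simpleTransp l) p)), h1, permPoly_mul, permPoly_X, map_add,
      map_mul, map_mul, map_mul, polyHom_X, polyHom_X]
    split_ifs <;> noncomm_ring

theorem klrτ_mul_klrτ_of_eq {l : Fin (n - 1)} {ν : Seqs I n β} (hQ : ∀ i, Q i i = 0)
    (h : ν.1 (lo l) = ν.1 (hi l)) : klrτ Q β l * klrτ Q β l * klrE Q ν = 0 := by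
  rw [klrτ_sq, h, hQ, subst₂, map_zero, map_zero, zero_mul]

/-- An error term needs equal outer colours, and it vanishes if the middle colour agrees with them
because `Q` has zero diagonal. The hypothesis excludes precisely the remaining case. -/
theorem klrτ_braid {l m : Fin (n - 1)} (hlm : m.val = l.val + 1) {ν : Seqs I n β}
    (hQ : ∀ i, Q i i = 0) (h : ν.1 (lo l) = ν.1 (hi m) → ν.1 (lo l) = ν.1 (hi l)) :
    klrτ Q β m * klrτ Q β l * klrτ Q β m * klrE Q ν =
      klrτ Q β l * klrτ Q β m * klrτ Q β l * klrE Q ν := by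
  rw [← sub_eq_zero, ← sub_mul]
  by_cases h1 : ν.1 (lo l) = ν.1 (hi m)
  · have := mk_rel (KLRRel.braid_eq (Q := Q) l m hlm ν h1)
    simp only [map_mul, map_sub, mk_evalAt] at this
    refine this.trans ?_
    have h3 : lo l ≠ hi m := by simp only [lo, hi, Ne, Fin.mk.injEq]; omega
    have h4 : divDiff (lo l) (hi m) (0 : MvPolynomial (Fin n) k) = 0 :=
      divDiff_eq_zero h3 (permPoly_zero _)
    rw [← h h1, hQ, subst₂, map_zero, h4, map_zero, zero_mul]
  · have := mk_rel (KLRRel.braid_ne (Q := Q) l m hlm ν h1)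
    simpa only [map_mul, map_sub, map_zero] using! this

theorem klrτWord_append (L L' : List (Fin (n - 1))) :
    klrτWord Q β (L ++ L') = klrτWord Q β L * klrτWord Q β L' := by
  simp [klrτWord]

theorem klrτWord_cons (l : Fin (n - 1)) (L : List (Fin (n - 1))) :
    klrτWord Q β (l :: L) = klrτ Q β l * klrτWord Q β L := by
  simp [klrτWord]

@[simp] theorem klrτWord_nil : klrτWord Q β ([] : List (Fin (n - 1))) = 1 := rfl

@[simp] theorem klrτWord_singleton (l : Fin (n - 1)) : klrτWord Q β [l] = klrτ Q β l := by
  simp [klrτWord]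

theorem klrτWord_mul_klrE (L : List (Fin (n - 1))) (ν : Seqs I n β) :
    klrτWord Q β L * klrE Q ν =
      klrE Q (Seqs.act (L.map simpleTransp).prod ν) * klrτWord Q β L := by
  induction L with
  | nil => simp
  | cons l L ih =>
    rw [klrτWord_cons, mul_assoc, ih, ← mul_assoc, klrτ_mul_klrE, List.map_cons, List.prod_cons,
      Seqs.act_mul, mul_assoc]

theorem klrτWord_concat_mul_klrE (L : List (Fin (n - 1))) (l : Fin (n - 1)) (ν : Seqs I n β) :
    klrτWord Q β (L ++ [l]) * klrE Q ν =
      klrτWord Q β L * klrE Q (Seqs.act (simpleTransp l) ν) * klrτ Q β l := by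
  rw [klrτWord_append, klrτWord_singleton, mul_assoc, klrτ_mul_klrE, mul_assoc]

end Relations

/-! ### Independence of the reduced expression -/

section Matsumoto

open MvPolynomial

variable {k : Type*} [CommRing k] [IsDomain k] {I : Type*} [Fintype I] [DecidableEq I]
  {Q : I → I → MvPolynomial (Fin 2) k} {n : ℕ} {β : I → ℕ} {prec : I → I → Prop}

/-- The colours occur in the sequence in the order given by `prec`. -/
def IsSorted (prec : I → I → Prop) (μ : Fin n → I) : Prop :=
  ∀ r t, r ≤ t → μ r = μ t ∨ prec (μ r) (μ t)

theorem IsSorted.eq_of_between (h : IsAdapted Q prec β) {μ : Fin n → I} (hμ : IsSorted prec μ)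
    {r s t : Fin n} (hrs : r ≤ s) (hst : s ≤ t) (e : μ r = μ t) : μ t = μ s := by
  rcases hμ r s hrs with h1 | h1
  · rw [← h1, e]
  · rcases hμ s t hst with h2 | h2
    · exact h2.symm
    · exact absurd (e ▸ h.trans _ _ _ h1 h2) (h.irrefl _)

theorem Seqs.apply_of_act_eq {w : Equiv.Perm (Fin n)} {ν μ : Seqs I n β} (hw : Seqs.act w ν = μ)
    (r : Fin n) : ν.1 r = μ.1 (w r) := by
  rw [← hw]
  simp [Seqs.act, permAct]

theorem Seqs.act_mul_simple {w : Equiv.Perm (Fin n)} {ν μ : Seqs I n β} (hw : Seqs.act w ν = μ)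
    (l : Fin (n - 1)) : Seqs.act (w * simpleTransp l) (Seqs.act (simpleTransp l) ν) = μ := by
  rw [Seqs.act_mul, Seqs.act_simple_act_simple, hw]

/-- For a sorted sequence `μ`, the element `τ_w e(ν)` with `w.ν = μ` does not depend on the reduced
expression of `w`. -/
theorem klrτWord_eq (h : IsAdapted Q prec β) {μ : Seqs I n β} (hμ : IsSorted prec μ.1)
    {w : Equiv.Perm (Fin n)} {ν : Seqs I n β} (hw : Seqs.act w ν = μ) {L L' : List (Fin (n - 1))}
    (hL : IsReducedExpr w L) (hL' : IsReducedExpr w L') :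
    klrτWord Q β L * klrE Q ν = klrτWord Q β L' * klrE Q ν := by
  -- Both last letters are descents of `w`. If they differ, each word is exchanged, by induction on
  -- the length, for one ending in a reduced word of the longest element generated by the two
  -- transpositions; one commutation or braid relation then compares them.
  induction hN : invCount w using Nat.strong_induction_on generalizing w ν L L' with
  | _ N ih =>
  rcases L.eq_nil_or_concat' with rfl | ⟨L, l, rfl⟩
  · have h1 := (isReducedExpr_iff.1 hL).2
    have h2 := (isReducedExpr_iff.1 hL').2
    rw [← h1, List.length_nil, List.length_eq_zero_iff] at h2
    rw [h2]
  rcases L'.eq_nil_or_concat' with rfl | ⟨L', l', rfl⟩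
  · have h1 := (isReducedExpr_iff.1 hL).2
    have h2 := (isReducedExpr_iff.1 hL').2
    rw [← h2] at h1
    simp at h1
  obtain ⟨d, hL⟩ := hL.of_concat
  obtain ⟨d', hL'⟩ := hL'.of_concat
  have e := invCount_mul_simple_add_one d
  have e' := invCount_mul_simple_add_one d'
  have hw1 := Seqs.act_mul_simple hw l
  have hw1' := Seqs.act_mul_simple hw l'
  have far : ∀ {l l' : Fin (n - 1)} {L L' : List (Fin (n - 1))}, w (hi l) < w (lo l) →
      w (hi l') < w (lo l') → IsReducedExpr (w * simpleTransp l) L →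
      IsReducedExpr (w * simpleTransp l') L' → l.val + 1 < l'.val →
      klrτWord Q β (L ++ [l]) * klrE Q ν = klrτWord Q β (L' ++ [l']) * klrE Q ν := by
    intro l l' L L' d d' hL hL' hll
    have e := invCount_mul_simple_add_one d
    have e' := invCount_mul_simple_add_one d'
    have hc : w * simpleTransp l * simpleTransp l' = w * simpleTransp l' * simpleTransp l := by
      rw [mul_assoc, simpleTransp_comm (Or.inl hll), mul_assoc]
    obtain ⟨K, hK⟩ := exists_isReducedExpr (w * simpleTransp l * simpleTransp l')
    obtain ⟨h1, h2, h3, h4⟩ := lo_ne_lo (Or.inl hll)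
    have a1 := hK.concat (l := l') (by
      simpa [simpleTransp_of_ne h1.symm h3.symm, simpleTransp_of_ne h2.symm h4.symm] using d')
    rw [mul_simple_mul_simple] at a1
    have a2 := (hc ▸ hK).concat (l := l) (by
      simpa [simpleTransp_of_ne h1 h2, simpleTransp_of_ne h3 h4] using d)
    rw [mul_simple_mul_simple] at a2
    rw [klrτWord_concat_mul_klrE, klrτWord_concat_mul_klrE,
      ih _ (by omega) (Seqs.act_mul_simple hw l) hL a1 rfl,
      ih _ (by omega) (Seqs.act_mul_simple hw l') hL' a2 rfl,
      mul_assoc, ← klrτ_mul_klrE, mul_assoc, ← klrτ_mul_klrE]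
    have hb := congrArg (· * klrE Q ν) (klrτ_comm (Q := Q) (β := β) (Or.inl hll))
    simp only [klrτWord_append, klrτWord_singleton, mul_assoc] at hb ⊢
    rw [hb]
  have near : ∀ {l m : Fin (n - 1)} {L L' : List (Fin (n - 1))}, w (hi l) < w (lo l) →
      w (hi m) < w (lo m) → IsReducedExpr (w * simpleTransp l) L →
      IsReducedExpr (w * simpleTransp m) L' → m.val = l.val + 1 →
      klrτWord Q β (L ++ [l]) * klrE Q ν = klrτWord Q β (L' ++ [m]) * klrE Q ν := by
    intro l m L L' d d' hL hL' hlm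
    have e := invCount_mul_simple_add_one d
    have e' := invCount_mul_simple_add_one d'
    have h1 := lo_ne_hi l
    have h2 := lo_ne_hi m
    have h3 : lo l ≠ hi m := by simp only [lo, hi, Ne, Fin.mk.injEq]; omega
    rw [lo_eq_hi hlm] at h2 d'
    have e1 : simpleTransp m (lo l) = lo l := simpleTransp_of_ne (by rwa [lo_eq_hi hlm]) h3
    have e2 : simpleTransp l (hi m) = hi m := simpleTransp_of_ne h3.symm h2.symm
    have e3 : simpleTransp m (hi l) = hi m := by rw [← lo_eq_hi hlm, simpleTransp_lo]
    have e4 : simpleTransp m (hi m) = hi l := by rw [← lo_eq_hi hlm, simpleTransp_hi]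
    set u := w * (simpleTransp l * simpleTransp m * simpleTransp l) with hu
    have hu' : u = w * (simpleTransp m * simpleTransp l * simpleTransp m) := by
      rw [hu, simpleTransp_braid hlm]
    obtain ⟨K, hK⟩ := exists_isReducedExpr u
    have a1 := (hK.concat (l := l) (by simpa [hu, e1, e2, e3, e4] using d')).concat (l := m)
      (by simpa [hu, lo_eq_hi hlm, e1, e2, e3, e4] using d'.trans d)
    have a2 := (hK.concat (l := m) (by simpa [hu, lo_eq_hi hlm, e1, e2, e3, e4] using d)).concat
      (l := l) (by simpa [hu, e1, e2, e3, e4] using d'.trans d)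
    have b1 : u * simpleTransp l * simpleTransp m = w * simpleTransp l := by
      rw [hu]
      simp only [← mul_assoc, mul_simple_mul_simple]
    have b2 : u * simpleTransp m * simpleTransp l = w * simpleTransp m := by
      rw [hu']
      simp only [← mul_assoc, mul_simple_mul_simple]
    rw [b1] at a1
    rw [b2] at a2
    rw [klrτWord_concat_mul_klrE, klrτWord_concat_mul_klrE,
      ih _ (by omega) (Seqs.act_mul_simple hw l) hL a1 rfl,
      ih _ (by omega) (Seqs.act_mul_simple hw m) hL' a2 rfl,
      mul_assoc, ← klrτ_mul_klrE, mul_assoc, ← klrτ_mul_klrE]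
    -- The two descents give `w (hi m) < w (hi l) < w (lo l)`. If the outer colours agree,
    -- sortedness of `μ` forces the colour in between to agree as well.
    have hb := klrτ_braid (Q := Q) hlm (ν := ν) h.diag (fun hν => by
      rw [Seqs.apply_of_act_eq hw, Seqs.apply_of_act_eq hw] at hν
      rw [Seqs.apply_of_act_eq hw, Seqs.apply_of_act_eq hw]
      exact hμ.eq_of_between h d'.le d.le hν.symm)
    simp only [klrτWord_append, klrτWord_singleton, mul_assoc] at hb ⊢
    rw [hb]
  rcases lt_trichotomy l.val l'.val with hl | hl | hl
  · rcases (Nat.succ_le_iff.2 hl).eq_or_lt with hl | hl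
    · exact near d d' hL hL' hl.symm
    · exact far d d' hL hL' hl
  · obtain rfl : l = l' := Fin.ext hl
    rw [klrτWord_concat_mul_klrE, klrτWord_concat_mul_klrE, ih _ (by omega) hw1 hL hL' rfl]
  · rcases (Nat.succ_le_iff.2 hl).eq_or_lt with hl | hl
    · exact (near d' d hL' hL hl.symm).symm
    · exact (far d' d hL' hL hl).symm

end Matsumoto

/-! ### Spanning sets -/

section Spanning

open MvPolynomial

variable {k : Type*} [CommRing k] [IsDomain k] {I : Type*} [Fintype I] [DecidableEq I]
  {Q : I → I → MvPolynomial (Fin 2) k} {n : ℕ} {β : I → ℕ} {prec : I → I → Prop}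

variable (Q) in
/-- The span of the elements `τ_w f(x) e(ν)` with `w.ν = μ`. -/
def tauSpan (μ ν : Seqs I n β) : Submodule k (KLR Q n β) :=
  Submodule.span k {z | ∃ w L f, Seqs.act w ν = μ ∧ IsReducedExpr w L ∧
    z = klrτWord Q β L * polyHom Q β f * klrE Q ν}

theorem mem_tauSpan {μ ν : Seqs I n β} {w : Equiv.Perm (Fin n)} {L : List (Fin (n - 1))}
    (hw : Seqs.act w ν = μ) (hL : IsReducedExpr w L) (f : MvPolynomial (Fin n) k) :
    klrτWord Q β L * polyHom Q β f * klrE Q ν ∈ tauSpan Q μ ν :=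
  Submodule.subset_span ⟨w, L, f, hw, hL, rfl⟩

theorem polyHom_mul_klrτ (l : Fin (n - 1)) (f : MvPolynomial (Fin n) k) (ν : Seqs I n β) :
    polyHom Q β f * klrτ Q β l * klrE Q ν =
      klrτ Q β l * polyHom Q β (permPoly (simpleTransp l) f) * klrE Q ν -
        (if ν.1 (lo l) = ν.1 (hi l) then
          polyHom Q β (demazure l (permPoly (simpleTransp l) f)) else 0) * klrE Q ν := by
  rw [klrτ_mul_polyHom, add_mul, add_sub_cancel_right, simpleTransp, permPoly_swap_swap]

theorem klrE_mul_klrτ (l : Fin (n - 1)) (ν : Seqs I n β) :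
    klrE Q ν * klrτ Q β l = klrτ Q β l * klrE Q (Seqs.act (simpleTransp l) ν) := by
  rw [klrτ_mul_klrE, Seqs.act_simple_act_simple]

/-- Moving `τ_l` past `f` costs a divided difference with the same `w`. If `w s_l` is longer the
word extends; otherwise a reduced word of `w` ending in `l` may be used, and the square of `τ_l`
becomes a polynomial. No lower terms arise because `klrτWord_eq` is exact. -/
theorem tauSpan_mul_klrτ (h : IsAdapted Q prec β) {μ : Seqs I n β} (hμ : IsSorted prec μ.1)
    {ν : Seqs I n β} (l : Fin (n - 1)) {z : KLR Q n β} (hz : z ∈ tauSpan Q μ ν) :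
    z * klrτ Q β l ∈ tauSpan Q μ (Seqs.act (simpleTransp l) ν) := by
  induction hz using Submodule.span_induction with
  | zero => rw [zero_mul]; exact zero_mem _
  | add y z _ _ hy hz => rw [add_mul]; exact add_mem hy hz
  | smul c z _ hz => rw [smul_mul_assoc]; exact Submodule.smul_mem _ c hz
  | mem z hz =>
    obtain ⟨w, L, f, hw, hL, rfl⟩ := hz
    set ν' := Seqs.act (simpleTransp l) ν with hν'
    have hw' : Seqs.act (w * simpleTransp l) ν' = μ := Seqs.act_mul_simple hw l
    set g := permPoly (simpleTransp l) f
    have e1 : klrτWord Q β L * polyHom Q β f * klrE Q ν * klrτ Q β l =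
        klrτWord Q β L * klrτ Q β l * polyHom Q β g * klrE Q ν' -
          klrτWord Q β L * (if ν'.1 (lo l) = ν'.1 (hi l) then
          polyHom Q β (demazure l g) else 0) * klrE Q ν' := by
      rw [mul_assoc _ _ (klrτ Q β l), klrE_mul_klrτ, ← mul_assoc, mul_assoc _ _ (klrτ Q β l),
        mul_assoc, polyHom_mul_klrτ, mul_sub]
      simp only [mul_assoc]
      rfl
    rw [e1]
    refine sub_mem ?_ ?_
    · rcases lt_or_gt_simple w l with hl | hl
      · rw [← klrτWord_singleton, ← klrτWord_append]
        exact mem_tauSpan hw' (hL.concat hl) g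
      · obtain ⟨K, hK⟩ := exists_isReducedExpr (w * simpleTransp l)
        have hK' := hK.concat (l := l) (by simpa using hl)
        rw [mul_simple_mul_simple] at hK'
        have e2 := klrτWord_eq h hμ hw hL hK'
        have e3 : klrτWord Q β L * klrτ Q β l * polyHom Q β g * klrE Q ν' =
            klrτWord Q β K * polyHom Q β
              (subst₂ (Q (ν'.1 (lo l)) (ν'.1 (hi l))) (lo l) (hi l) * g) * klrE Q ν' := by
          calc _ = klrτWord Q β L * klrE Q ν * klrτ Q β l * polyHom Q β g := by
                rw [mul_assoc _ (klrE Q ν), klrE_mul_klrτ, mul_assoc _ _ (klrE Q ν'),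
                  polyHom_mul_klrE]
                simp only [mul_assoc]
                rfl
            _ = klrτWord Q β K * (klrτ Q β l * klrτ Q β l * klrE Q ν') * polyHom Q β g := by
                rw [e2, mul_assoc _ (klrE Q ν), klrE_mul_klrτ, klrτWord_append,
                  klrτWord_singleton]
                simp only [mul_assoc]
                rfl
            _ = _ := by
                rw [klrτ_sq, map_mul]
                simp only [mul_assoc]
                rw [polyHom_mul_klrE g]
        rw [e3]
        exact mem_tauSpan hw' hK _
    · split_ifs with heq
      · have : ν' = ν := by
          rw [hν']
          refine Seqs.act_simple_eq_self ?_
          rw [hν', Seqs.act_simple_lo, Seqs.act_simple_hi] at heq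
          exact heq.symm
        rw [this]
        exact mem_tauSpan hw hL _
      · rw [mul_zero, zero_mul]
        exact zero_mem _

theorem tauSpan_mul_klrE {μ ν : Seqs I n β} (ν' : Seqs I n β) {z : KLR Q n β}
    (hz : z ∈ tauSpan Q μ ν) : z * klrE Q ν' = if ν = ν' then z else 0 := by
  induction hz using Submodule.span_induction with
  | zero => rw [zero_mul, ite_self]
  | add y z _ _ hy hz => rw [add_mul, hy, hz]; split_ifs <;> simp
  | smul c z _ hz => rw [smul_mul_assoc, hz]; split_ifs <;> simp
  | mem z hz =>
    obtain ⟨w, L, f, hw, hL, rfl⟩ := hz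
    split_ifs with e
    · rw [← e, mul_assoc, klrE_mul_self]
    · rw [mul_assoc, klrE_mul_ne e, mul_zero]

theorem tauSpan_mul_klrX {μ ν : Seqs I n β} (r : Fin n) {z : KLR Q n β}
    (hz : z ∈ tauSpan Q μ ν) : z * klrX Q β r ∈ tauSpan Q μ ν := by
  induction hz using Submodule.span_induction with
  | zero => rw [zero_mul]; exact zero_mem _
  | add y z _ _ hy hz => rw [add_mul]; exact add_mem hy hz
  | smul c z _ hz => rw [smul_mul_assoc]; exact Submodule.smul_mem _ c hz
  | mem z hz =>
    obtain ⟨w, L, f, hw, hL, rfl⟩ := hz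
    rw [mul_assoc, ← klrX_mul_klrE, ← mul_assoc, mul_assoc _ _ (klrX Q β r), ← polyHom_X,
      ← map_mul]
    exact mem_tauSpan hw hL _

/-- The space `e(μ) R e(ν)` is spanned by the elements `τ_w f(x) e(ν)` if `μ` is sorted. -/
theorem mem_tauSpan_of_isSorted (h : IsAdapted Q prec β) {μ : Seqs I n β}
    (hμ : IsSorted prec μ.1) (y : KLR Q n β) (ν : Seqs I n β) :
    klrE Q μ * y * klrE Q ν ∈ tauSpan Q μ ν := by
  -- Right multiplication changes `ν`, so the span over all `ν` is shown to be a right ideal; it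
  -- contains `e(μ)`.
  have key : ∀ y : KLR Q n β, ∀ z ∈ ⨆ ν, tauSpan Q μ ν, z * y ∈ ⨆ ν, tauSpan Q μ ν := by
    intro y
    induction y using klr_induction with
    | hs c =>
      intro z hz
      rw [← Algebra.commutes, ← Algebra.smul_def]
      exact Submodule.smul_mem _ c hz
    | hadd y y' hy hy' =>
      intro z hz
      rw [mul_add]
      exact add_mem (hy z hz) (hy' z hz)
    | hmul y y' hy hy' =>
      intro z hz
      rw [← mul_assoc]
      exact hy' _ (hy z hz)
    | he ν =>
      intro z hz
      induction hz using Submodule.iSup_induction' with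
      | zero => rw [zero_mul]; exact zero_mem _
      | add y z _ _ hy hz => rw [add_mul]; exact add_mem hy hz
      | mem ν' z hz =>
        rw [tauSpan_mul_klrE ν hz]
        split_ifs
        · exact Submodule.mem_iSup_of_mem ν' hz
        · exact zero_mem _
    | hx r =>
      intro z hz
      induction hz using Submodule.iSup_induction' with
      | zero => rw [zero_mul]; exact zero_mem _
      | add y z _ _ hy hz => rw [add_mul]; exact add_mem hy hz
      | mem ν' z hz => exact Submodule.mem_iSup_of_mem ν' (tauSpan_mul_klrX r hz)
    | hτ l =>
      intro z hz
      induction hz using Submodule.iSup_induction' with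
      | zero => rw [zero_mul]; exact zero_mem _
      | add y z _ _ hy hz => rw [add_mul]; exact add_mem hy hz
      | mem ν' z hz => exact Submodule.mem_iSup_of_mem _ (tauSpan_mul_klrτ h hμ l hz)
  have h1 : klrE Q μ ∈ ⨆ ν, tauSpan Q μ ν := by
    have := mem_tauSpan (Q := Q) (Seqs.act_one μ) (isReducedExpr_one_iff.2 rfl) 1
    rw [klrτWord_nil, map_one, one_mul, one_mul] at this
    exact Submodule.mem_iSup_of_mem μ this
  have h2 := key y _ h1
  generalize klrE Q μ * y = z at h2
  induction h2 using Submodule.iSup_induction' with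
  | zero => rw [zero_mul]; exact zero_mem _
  | add y z _ _ hy hz => rw [add_mul]; exact add_mem hy hz
  | mem ν' z hz =>
    rw [tauSpan_mul_klrE ν hz]
    split_ifs with e
    · rwa [← e]
    · exact zero_mem _

end Spanning

/-! ### Elements of the cyclotomic ideal -/

section Kill

open MvPolynomial

variable {k : Type*} [CommRing k] [IsDomain k] {I : Type*} [Fintype I] [DecidableEq I]
  {Q : I → I → MvPolynomial (Fin 2) k} {n : ℕ} {β : I → ℕ} {prec : I → I → Prop} {a : I → k[X]}

variable (Q a) in
/-- The polynomial `f` annihilates `e(μ) R e(ν)` modulo the cyclotomic ideal. -/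
def Annihilates (μ ν : Seqs I n β) (f : MvPolynomial (Fin n) k) : Prop :=
  ∀ y : KLR Q n β, klrE Q μ * y * (polyHom Q β f * klrE Q ν) ∈ cycIdeal Q β n a

theorem annihilates_zero (μ ν : Seqs I n β) : Annihilates Q a μ ν 0 := fun y => by
  rw [map_zero, zero_mul, mul_zero]
  exact zero_mem _

theorem Annihilates.add {μ ν : Seqs I n β} {f g : MvPolynomial (Fin n) k}
    (hf : Annihilates Q a μ ν f) (hg : Annihilates Q a μ ν g) : Annihilates Q a μ ν (f + g) :=
  fun y => by
    rw [map_add, add_mul, mul_add]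
    exact add_mem (hf y) (hg y)

theorem Annihilates.mul_left {μ ν : Seqs I n β} {g : MvPolynomial (Fin n) k}
    (hg : Annihilates Q a μ ν g) (f : MvPolynomial (Fin n) k) : Annihilates Q a μ ν (f * g) :=
  fun y => by
    have := hg (y * polyHom Q β f)
    rw [map_mul]
    simpa only [mul_assoc] using this

theorem annihilates_gPolyAux_zero (μ ν : Seqs I n β) :
    Annihilates Q a μ ν (gPolyAux Q a prec 0 ν.1) := by
  intro y
  rw [gPolyAux]
  split_ifs with hn
  · have h1 : cycElem Q β a ⟨0, hn⟩ ∈ cycIdeal Q β n a :=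
      TwoSidedIdeal.subset_span ⟨⟨0, hn⟩, rfl, rfl⟩
    have h2 : polyHom Q β (Polynomial.aeval (X ⟨0, hn⟩) (a (ν.1 ⟨0, hn⟩))) * klrE Q ν =
        cycElem Q β a ⟨0, hn⟩ * klrE Q ν := by
      rw [cycElem, Finset.sum_mul, Finset.sum_eq_single ν]
      · rw [mul_assoc, klrE_mul_self, ← Polynomial.aeval_algHom_apply, polyHom_X]
      · intro ν' _ hν
        rw [mul_assoc, klrE_mul_ne hν, mul_zero]
      · simp
    rw [h2]
    exact TwoSidedIdeal.mul_mem_left _ _ _ (TwoSidedIdeal.mul_mem_right _ _ _ h1)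
  · rw [map_zero, zero_mul, mul_zero]
    exact zero_mem _

/-- On `e(ν)` one has `τ g τ = ∂(g) τ`, because `τ² = 0`. Since `τ x_{l+1} - x_l τ = 1` there, `∂(g)
= (τ g τ) x_{l+1} - x_l (τ g τ)`, and in both terms `g` occurs with arbitrary elements on its sides.
-/
theorem Annihilates.demazure {μ ν : Seqs I n β} {l : Fin (n - 1)} (hQ : ∀ i, Q i i = 0)
    (hν : ν.1 (lo l) = ν.1 (hi l)) {g : MvPolynomial (Fin n) k} (hg : Annihilates Q a μ ν g) :
    Annihilates Q a μ ν (demazure l g) := by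
  intro y
  set d := polyHom Q β (CycKLR.demazure l g)
  have hτ : klrτ Q β l * klrE Q ν = klrE Q ν * klrτ Q β l := by
    rw [klrτ_mul_klrE, Seqs.act_simple_eq_self hν]
  have e1 : klrτ Q β l * polyHom Q β g * klrE Q ν * klrτ Q β l = d * klrτ Q β l * klrE Q ν := by
    rw [klrτ_mul_polyHom, if_pos hν, mul_assoc, ← hτ, add_mul, mul_assoc _ (klrτ Q β l),
      ← mul_assoc (klrτ Q β l), klrτ_mul_klrτ_of_eq hQ hν, mul_zero, zero_add, mul_assoc]
  have e2 : klrτ Q β l * klrX Q β (hi l) * klrE Q ν =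
      klrX Q β (lo l) * klrτ Q β l * klrE Q ν + klrE Q ν := by
    rw [klrτ_mul_klrX, if_pos hν, CycKLR.demazure, divDiff_X_left (lo_ne_hi l).symm, map_one,
      add_mul, one_mul, simpleTransp_hi]
  have e3 : d * klrE Q ν = klrτ Q β l * polyHom Q β g * klrE Q ν * klrτ Q β l * klrX Q β (hi l) -
      klrX Q β (lo l) * (klrτ Q β l * polyHom Q β g * klrE Q ν * klrτ Q β l) := by
    have e4 : klrX Q β (lo l) * d = d * klrX Q β (lo l) := by
      rw [← polyHom_X, ← map_mul, mul_comm, map_mul]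
    rw [e1, mul_assoc _ _ (klrX Q β (hi l)), ← klrX_mul_klrE, mul_assoc d, ← mul_assoc (klrτ Q β l),
      e2, mul_assoc d, ← mul_assoc _ d, e4, mul_assoc d, mul_add, mul_assoc (klrX Q β (lo l)),
      add_sub_cancel_left]
  have m1 := hg (y * klrτ Q β l)
  have m2 := hg (y * klrX Q β (lo l) * klrτ Q β l)
  have := sub_mem (TwoSidedIdeal.mul_mem_right _ _ (klrτ Q β l * klrX Q β (hi l)) m1)
    (TwoSidedIdeal.mul_mem_right _ _ (klrτ Q β l) m2)
  rw [e3, mul_sub]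
  simpa only [mul_assoc] using this

/-- Induction along the recursion. For `ν_l ≺ ν_{l+1}` the element `τ_l g τ_l` equals `s_l(g) τ_l²`,
which accounts for the factor `Q`. For `ν_l ≻ ν_{l+1}` no factor is needed: every `w` taking `ν` to
the sorted `μ` inverts `l` and `l + 1`, so `τ_w` may be written with last letter `τ_l`, and this
`τ_l` turns `s_l(g)` into `g` on its left. Only this case uses that `μ` is sorted. -/
theorem annihilates_gPolyAux (h : IsAdapted Q prec β) {μ : Seqs I n β} (hμ : IsSorted prec μ.1)
    (r : ℕ) (ν : Seqs I n β) : Annihilates Q a μ ν (gPolyAux Q a prec r ν.1) := by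
  induction r generalizing ν with
  | zero => exact annihilates_gPolyAux_zero μ ν
  | succ r ih =>
    by_cases hr : r < n - 1
    swap
    · rw [gPolyAux, dif_neg hr]
      exact annihilates_zero μ ν
    set l : Fin (n - 1) := ⟨r, hr⟩ with hl
    rw [gPolyAux_succ hr h ν]
    have ih' := ih (Seqs.act (simpleTransp l) ν)
    set g := gPolyAux Q a prec r (Seqs.act (simpleTransp l) ν).1
    rw [tauAt]
    by_cases heq : ν.1 (lo l) = ν.1 (hi l)
    · rw [heq, crossing_self]
      refine Annihilates.demazure (l := l) h.diag heq ?_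
      rwa [Seqs.act_simple_eq_self heq] at ih'
    have e1 : klrτ Q β l * polyHom Q β (permPoly (simpleTransp l) g) * klrE Q ν =
        polyHom Q β g * klrE Q (Seqs.act (simpleTransp l) ν) * klrτ Q β l := by
      rw [mul_assoc (polyHom Q β g), ← klrτ_mul_klrE, ← mul_assoc, polyHom_mul_klrτ, if_neg heq,
        zero_mul, sub_zero]
    rw [crossing_ne _ _ _ heq]
    intro y
    by_cases hp : prec (ν.1 (lo l)) (ν.1 (hi l))
    · rw [factor, if_pos hp]
      have e2 : polyHom Q β (permPoly (simpleTransp l) g *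
          subst₂ (Q (ν.1 (lo l)) (ν.1 (hi l))) (lo l) (hi l)) * klrE Q ν =
          klrτ Q β l * (polyHom Q β g * klrE Q (Seqs.act (simpleTransp l) ν)) * klrτ Q β l := by
        rw [mul_assoc (klrτ Q β l), ← e1, mul_comm, map_mul, mul_assoc (polyHom Q β _),
          polyHom_mul_klrE (permPoly _ g), ← mul_assoc, ← klrτ_sq, mul_assoc _ _ (klrE Q ν),
          mul_assoc _ _ (klrE Q ν), polyHom_mul_klrE]
        simp only [mul_assoc]
      have := TwoSidedIdeal.mul_mem_right _ _ (klrτ Q β l) (ih' (y * klrτ Q β l))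
      rw [← show simpleTransp l = Equiv.swap (lo l) (hi l) from rfl, e2]
      simpa only [mul_assoc] using this
    · have hp' : prec (ν.1 (hi l)) (ν.1 (lo l)) :=
        (h.total _ _ (ν.ne_zero _) (ν.ne_zero _) heq).resolve_left hp
      rw [factor, if_neg hp, subst₂, map_one, mul_one]
      rw [← show simpleTransp l = Equiv.swap (lo l) (hi l) from rfl]
      have e3 : klrE Q μ * y * (polyHom Q β (permPoly (simpleTransp l) g) * klrE Q ν) =
          klrE Q μ * y * klrE Q ν * polyHom Q β (permPoly (simpleTransp l) g) := by
        rw [polyHom_mul_klrE, mul_assoc]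
        simp only [mul_assoc]
      rw [e3]
      have hy := mem_tauSpan_of_isSorted h hμ y ν
      generalize klrE Q μ * y * klrE Q ν = z at hy
      induction hy using Submodule.span_induction with
      | zero => rw [zero_mul]; exact zero_mem _
      | add y z _ _ hy hz => rw [add_mul]; exact add_mem hy hz
      | smul c z _ hz =>
        rw [smul_mul_assoc, Algebra.smul_def]
        exact TwoSidedIdeal.mul_mem_left _ _ _ hz
      | mem z hz =>
        obtain ⟨w, L, f, hw, hL, rfl⟩ := hz
        have hd : w (hi l) < w (lo l) := by
          rw [Seqs.apply_of_act_eq hw, Seqs.apply_of_act_eq hw] at hp' heq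
          refine lt_of_not_ge fun hle => ?_
          rcases hμ _ _ hle with h1 | h1
          · exact heq h1
          · exact h.asymm _ _ h1 hp'
        obtain ⟨K, hK⟩ := exists_isReducedExpr (w * simpleTransp l)
        have hK' := hK.concat (l := l) (by simpa using hd)
        rw [mul_simple_mul_simple] at hK'
        have e4 := klrτWord_mul_klrE (Q := Q) K (Seqs.act (simpleTransp l) ν)
        rw [hK.1, Seqs.act_mul_simple hw] at e4
        have e5 : klrτWord Q β L * polyHom Q β f * klrE Q ν *
            polyHom Q β (permPoly (simpleTransp l) g) =
            klrE Q μ * klrτWord Q β K * (polyHom Q β g * klrE Q (Seqs.act (simpleTransp l) ν)) *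
              (klrτ Q β l * polyHom Q β f) := by
          calc _ = klrτWord Q β L * klrE Q ν *
                (polyHom Q β f * polyHom Q β (permPoly (simpleTransp l) g)) := by
                rw [mul_assoc (klrτWord Q β L), polyHom_mul_klrE]
                simp only [mul_assoc]
            _ = klrτWord Q β K * (klrτ Q β l * polyHom Q β (permPoly (simpleTransp l) g) *
                klrE Q ν) * polyHom Q β f := by
                rw [klrτWord_eq h hμ hw hL hK', klrτWord_append, klrτWord_singleton, ← map_mul,
                  mul_comm f, map_mul, mul_assoc (klrτ Q β l), polyHom_mul_klrE]
                simp only [mul_assoc]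
            _ = _ := by
                rw [e1, ← e4, polyHom_mul_klrE, ← mul_assoc (klrτWord Q β K * _),
                  mul_assoc _ (klrE Q _) (klrE Q _), klrE_mul_self]
                simp only [mul_assoc]
        rw [e5]
        exact TwoSidedIdeal.mul_mem_right _ _ _ (ih' _)

end Kill

/-! ### Degrees in one variable -/

section Degrees

open MvPolynomial

variable {k : Type*} [CommRing k] {σ : Type*}

variable (k) in
/-- The polynomials whose degree in the variable `r` is less than `N`. -/
def degLT (r : σ) (N : ℕ) : Submodule k (MvPolynomial σ k) :=
  MvPolynomial.restrictSupport k {m | m r < N}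

theorem mem_degLT {r : σ} {N : ℕ} {f : MvPolynomial σ k} :
    f ∈ degLT k r N ↔ ∀ m ∈ f.support, m r < N := by
  rw [degLT, mem_restrictSupport_iff]
  rfl

theorem monomial_mem_degLT {r : σ} {N : ℕ} {m : σ →₀ ℕ} (h : m r < N) (c : k) :
    monomial m c ∈ degLT k r N :=
  mem_degLT.2 fun m' hm' => by
    rw [Finset.mem_singleton.1 (support_monomial_subset hm')]
    exact h

theorem degLT_mono {r : σ} {N N' : ℕ} (h : N ≤ N') : degLT k r N ≤ degLT k r N' := fun _ hf =>
  mem_degLT.2 fun m hm => (mem_degLT.1 hf m hm).trans_le h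

/-- The bounds are strict, so one of the two must be shifted by one. With `N' = 0` the second factor
is free of the variable and the bound does not change. -/
theorem mul_mem_degLT {r : σ} {N N' : ℕ} {f g : MvPolynomial σ k} (hf : f ∈ degLT k r N)
    (hg : g ∈ degLT k r (N' + 1)) : f * g ∈ degLT k r (N + N') := by
  classical
  refine mem_degLT.2 fun m hm => ?_
  obtain ⟨m1, h1, m2, h2, rfl⟩ := Finset.mem_add.1 (support_mul f g hm)
  have := mem_degLT.1 hf m1 h1
  have := mem_degLT.1 hg m2 h2
  rw [Finsupp.add_apply]
  omega

theorem C_mem_degLT (r : σ) (c : k) : C c ∈ degLT k r 1 := monomial_mem_degLT (by simp) c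

theorem X_pow_mem_degLT (r : σ) (N : ℕ) : (X r ^ N : MvPolynomial σ k) ∈ degLT k r (N + 1) := by
  rw [X_pow_eq_monomial]
  exact monomial_mem_degLT (by simp) _

theorem X_pow_mem_degLT_of_ne {q r : σ} (h : q ≠ r) (N : ℕ) :
    (X q ^ N : MvPolynomial σ k) ∈ degLT k r 1 := by
  rw [X_pow_eq_monomial]
  exact monomial_mem_degLT (by simp [h]) _

/-- The polynomial `f` has degree `N` in the variable `r`, and its leading term in this variable is
`u X_r ^ N` with a unit `u`. -/
def UnitMonic (r : σ) (N : ℕ) (f : MvPolynomial σ k) : Prop :=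
  ∃ (u : kˣ) (h : MvPolynomial σ k), h ∈ degLT k r N ∧ f = C (u : k) * X r ^ N + h

theorem UnitMonic.mem_degLT {r : σ} {N : ℕ} {f : MvPolynomial σ k} (hf : UnitMonic r N f) :
    f ∈ degLT k r (N + 1) := by
  obtain ⟨u, h, hh, rfl⟩ := hf
  refine add_mem ?_ (degLT_mono (Nat.le_succ N) hh)
  have := mul_mem_degLT (C_mem_degLT r (u : k)) (X_pow_mem_degLT (k := k) r N)
  rwa [add_comm] at this

theorem UnitMonic.mul {r : σ} {N N' : ℕ} {f f' : MvPolynomial σ k} (hf : UnitMonic r N f)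
    (hf' : UnitMonic r N' f') : UnitMonic r (N + N') (f * f') := by
  have h1 := hf'.mem_degLT
  obtain ⟨u, h, hh, rfl⟩ := hf
  obtain ⟨u', h', hh', e⟩ := hf'
  refine ⟨u * u', h * f' + C (u : k) * X r ^ N * h', add_mem (mul_mem_degLT hh h1) ?_, ?_⟩
  · have h2 : C (u : k) * X r ^ N ∈ degLT k r (N + 1) :=
      UnitMonic.mem_degLT ⟨u, 0, zero_mem _, (add_zero _).symm⟩
    rw [mul_comm, add_comm N]
    exact mul_mem_degLT hh' h2
  · rw [e, Units.val_mul, map_mul]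
    ring

theorem UnitMonic.one (r : σ) : UnitMonic r 0 (1 : MvPolynomial σ k) :=
  ⟨1, 0, zero_mem _, by simp⟩

theorem UnitMonic.degreeOf [Nontrivial k] {r : σ} {N : ℕ} {f : MvPolynomial σ k}
    (hf : UnitMonic r N f) : f.degreeOf r = N := by
  classical
  refine le_antisymm ?_ ?_
  · rw [degreeOf_eq_sup, Finset.sup_le_iff]
    exact fun m hm => Nat.lt_succ_iff.1 (CycKLR.mem_degLT.1 hf.mem_degLT m hm)
  · obtain ⟨u, h, hh, rfl⟩ := hf
    have : Finsupp.single r N ∈ (C (u : k) * X r ^ N + h).support := by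
      rw [mem_support_iff, coeff_add, coeff_C_mul, coeff_X_pow, if_pos rfl]
      rw [notMem_support_iff.1 fun hm => ?_]
      · simp
      · have := CycKLR.mem_degLT.1 hh _ hm
        simp at this
    simpa using monomial_le_degreeOf r this

theorem UnitMonic.eq_C {r : σ} {f : MvPolynomial σ k} (hf : UnitMonic r 0 f) :
    ∃ u : kˣ, f = C (u : k) := by
  obtain ⟨u, h, hh, rfl⟩ := hf
  refine ⟨u, ?_⟩
  have : h = 0 := by
    rw [← support_eq_empty, Finset.eq_empty_iff_forall_notMem]
    exact fun m hm => absurd (CycKLR.mem_degLT.1 hh m hm) (Nat.not_lt_zero _)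
  rw [this]
  simp

theorem induction_degLT {r : σ} {N : ℕ} {p : MvPolynomial σ k → Prop} (h0 : p 0)
    (hadd : ∀ f g, p f → p g → p (f + g)) (hm : ∀ m c, m r < N → p (monomial m c))
    {f : MvPolynomial σ k} (hf : f ∈ degLT k r N) : p f := by
  rw [f.as_sum]
  exact Finset.sum_induction _ p hadd h0 fun m h => hm m _ (CycKLR.mem_degLT.1 hf m h)

end Degrees

/-! ### The degrees of the polynomials `g_{ν,r}` -/

section GDegrees

open MvPolynomial

variable {k : Type*} [CommRing k] [IsDomain k] {n : ℕ}

theorem permPoly_mem_degLT (w : Equiv.Perm (Fin n)) {r : Fin n} {N : ℕ}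
    {f : MvPolynomial (Fin n) k} (hf : f ∈ degLT k r N) : permPoly w f ∈ degLT k (w r) N := by
  classical
  refine mem_degLT.2 fun m hm => ?_
  rw [permPoly, support_rename_of_injective w.injective, Finset.mem_image] at hm
  obtain ⟨m, hm, rfl⟩ := hm
  rw [Finsupp.mapDomain_apply w.injective]
  exact mem_degLT.1 hf m hm

theorem UnitMonic.permPoly (w : Equiv.Perm (Fin n)) {r : Fin n} {N : ℕ}
    {f : MvPolynomial (Fin n) k} (hf : UnitMonic r N f) :
    UnitMonic (w r) N (permPoly w f) := by
  obtain ⟨u, h, hh, rfl⟩ := hf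
  refine ⟨u, _, permPoly_mem_degLT w hh, ?_⟩
  simp [CycKLR.permPoly]

theorem subst₂_mem_degLT {b c : Fin n} (hbc : b ≠ c) {N : ℕ} {q : MvPolynomial (Fin 2) k}
    (hq : q ∈ degLT k 1 N) : subst₂ q b c ∈ degLT k c N := by
  refine induction_degLT (p := fun q => subst₂ q b c ∈ degLT k c N) ?_ ?_ ?_ hq
  · rw [subst₂, map_zero]; exact zero_mem _
  · intro f g hf hg
    rw [subst₂, map_add]
    exact add_mem hf hg
  · intro m a hm
    rw [subst₂, aeval_monomial, Finsupp.prod_fintype _ _ (fun _ => pow_zero _), Fin.prod_univ_two]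
    have h1 := mul_mem_degLT (mul_mem_degLT (X_pow_mem_degLT (k := k) c (m 1))
      (X_pow_mem_degLT_of_ne hbc (m 0))) (C_mem_degLT c a)
    refine degLT_mono (Nat.succ_le_of_lt hm) ?_
    convert h1 using 1
    simp only [algebraMap_eq, Matrix.cons_val_zero, Matrix.cons_val_one]
    ring

theorem UnitMonic.subst₂ {b c : Fin n} (hbc : b ≠ c) {N : ℕ} {q : MvPolynomial (Fin 2) k}
    (hq : UnitMonic 1 N q) : UnitMonic c N (subst₂ q b c) := by
  obtain ⟨u, h, hh, rfl⟩ := hq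
  refine ⟨u, _, subst₂_mem_degLT hbc hh, ?_⟩
  simp [CycKLR.subst₂]

theorem subst₂_mem_degLT_of_ne {b c r : Fin n} (hb : b ≠ r) (hc : c ≠ r)
    (q : MvPolynomial (Fin 2) k) : subst₂ q b c ∈ degLT k r 1 := by
  induction q using MvPolynomial.induction_on with
  | C a => rw [subst₂, aeval_C]; exact C_mem_degLT r a
  | add p q hp hq => rw [subst₂, map_add]; exact add_mem hp hq
  | mul_X p i hp =>
    rw [subst₂_mul]
    refine mul_mem_degLT (N' := 0) hp ?_
    rw [subst₂, aeval_X]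
    fin_cases i
    · simpa using X_pow_mem_degLT_of_ne (k := k) hb 1
    · simpa using X_pow_mem_degLT_of_ne (k := k) hc 1

theorem demazure_X_pow_mul {l : Fin (n - 1)} (j : ℕ) {f : MvPolynomial (Fin n) k}
    (hf : permPoly (simpleTransp l) f = f) :
    demazure l (X (lo l) ^ j * f) =
      -(∑ i ∈ Finset.range j, X (lo l) ^ i * X (hi l) ^ (j - 1 - i)) * f := by
  refine divDiff_eq_of (lo_ne_hi l).symm ?_
  have h1 := (Commute.all (X (lo l) : MvPolynomial (Fin n) k) (X (hi l))).geom_sum₂_mul j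
  have h2 : permPoly (simpleTransp l) (X (lo l) ^ j : MvPolynomial (Fin n) k) = X (hi l) ^ j := by
    simp [permPoly]
  rw [Equiv.swap_comm, ← show simpleTransp l = Equiv.swap (lo l) (hi l) from rfl, permPoly_mul, hf,
    h2]
  linear_combination f * h1

/-- Without the variable `hi l`, the part of the monomial away from `lo l` is fixed by `s_l`, and
the power of `X (lo l)` contributes a geometric sum. -/
theorem demazure_monomial {l : Fin (n - 1)} {m : Fin n →₀ ℕ} (hm : m (hi l) = 0) (c : k) :
    demazure l (monomial m c) =
      -(∑ i ∈ Finset.range (m (lo l)), X (lo l) ^ i * X (hi l) ^ (m (lo l) - 1 - i)) *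
        monomial (m.erase (lo l)) c := by
  have h1 : permPoly (simpleTransp l) (monomial (m.erase (lo l)) c) =
      monomial (m.erase (lo l)) c := by
    rw [permPoly, rename_monomial]
    refine congrArg (fun m => monomial m c) (Finsupp.ext fun r => ?_)
    rw [show r = simpleTransp l (simpleTransp l r) from (Equiv.swap_apply_self _ _ _).symm,
      Finsupp.mapDomain_apply (simpleTransp l).injective,
      show simpleTransp l (simpleTransp l r) = r from Equiv.swap_apply_self _ _ _]
    by_cases h1 : r = lo l
    · rw [h1, simpleTransp_lo, Finsupp.erase_same, Finsupp.erase_ne (lo_ne_hi l).symm, hm]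
    by_cases h2 : r = hi l
    · rw [h2, simpleTransp_hi, Finsupp.erase_same, Finsupp.erase_ne (lo_ne_hi l).symm, hm]
    rw [simpleTransp_of_ne h1 h2]
  rw [← demazure_X_pow_mul _ h1, X_pow_eq_monomial, monomial_mul, one_mul, Finsupp.single_add_erase]

theorem demazure_add (l : Fin (n - 1)) (f g : MvPolynomial (Fin n) k) :
    demazure l (f + g) = demazure l f + demazure l g := divDiff_add (lo_ne_hi l).symm _ _

theorem demazure_zero (l : Fin (n - 1)) : demazure l (0 : MvPolynomial (Fin n) k) = 0 :=
  divDiff_eq_zero (lo_ne_hi l).symm (permPoly_zero _)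

theorem induction_degLT₂ {r t : Fin n} {N M : ℕ} {p : MvPolynomial (Fin n) k → Prop} (h0 : p 0)
    (hadd : ∀ f g, p f → p g → p (f + g)) (hm : ∀ m c, m r < N → m t < M → p (monomial m c))
    {f : MvPolynomial (Fin n) k} (hf : f ∈ degLT k r N) (hf' : f ∈ degLT k t M) : p f := by
  rw [f.as_sum]
  exact Finset.sum_induction _ p hadd h0 fun m h =>
    hm m _ (CycKLR.mem_degLT.1 hf m h) (CycKLR.mem_degLT.1 hf' m h)

theorem demazure_mem_degLT_hi {l : Fin (n - 1)} {N : ℕ} {f : MvPolynomial (Fin n) k}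
    (hf : f ∈ degLT k (hi l) 1) (hN : f ∈ degLT k (lo l) (N + 1)) :
    demazure l f ∈ degLT k (hi l) N := by
  refine induction_degLT₂ (p := fun f => demazure l f ∈ degLT k (hi l) N) ?_ ?_ ?_ hf hN
  · rw [demazure_zero]; exact zero_mem _
  · intro f g hf hg
    rw [demazure_add]
    exact add_mem hf hg
  · intro m c hm hm'
    rw [demazure_monomial (by omega), neg_mul, Finset.sum_mul]
    refine neg_mem (sum_mem fun i hi' => ?_)
    rw [Finset.mem_range] at hi'
    have h1 : monomial (m.erase (lo l)) c ∈ degLT k (hi l) 1 :=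
      monomial_mem_degLT (by rw [Finsupp.erase_ne (lo_ne_hi l).symm]; exact hm) c
    refine degLT_mono ?_ (mul_mem_degLT (N' := 0) (mul_mem_degLT (N' := m (lo l) - 1 - i)
      (X_pow_mem_degLT_of_ne (lo_ne_hi l) i) (X_pow_mem_degLT _ _)) h1)
    omega

theorem demazure_mem_degLT_of_ne {l : Fin (n - 1)} {r : Fin n} (h1 : lo l ≠ r) (h2 : hi l ≠ r)
    {f : MvPolynomial (Fin n) k} (hf : f ∈ degLT k (hi l) 1) (hr : f ∈ degLT k r 1) :
    demazure l f ∈ degLT k r 1 := by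
  refine induction_degLT₂ (p := fun f => demazure l f ∈ degLT k r 1) ?_ ?_ ?_ hf hr
  · rw [demazure_zero]; exact zero_mem _
  · intro f g hf hg
    rw [demazure_add]
    exact add_mem hf hg
  · intro m c hm hm'
    rw [demazure_monomial (by omega), neg_mul, Finset.sum_mul]
    refine neg_mem (sum_mem fun i hi' => ?_)
    have h3 : monomial (m.erase (lo l)) c ∈ degLT k r 1 :=
      monomial_mem_degLT (by rw [Finsupp.erase_ne h1.symm]; exact hm') c
    exact mul_mem_degLT (N' := 0) (mul_mem_degLT (N' := 0)
      (X_pow_mem_degLT_of_ne h1 i) (X_pow_mem_degLT_of_ne h2 _)) h3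

/-- In the geometric sum coming from `X (lo l) ^ (N + 1)` only the term `X (hi l) ^ N` reaches
degree `N`; the leading unit becomes `-u`. -/
theorem UnitMonic.demazure {l : Fin (n - 1)} {N : ℕ} {f : MvPolynomial (Fin n) k}
    (hf : f ∈ degLT k (hi l) 1) (hN : UnitMonic (lo l) (N + 1) f) :
    UnitMonic (hi l) N (demazure l f) := by
  obtain ⟨u, h, hh, rfl⟩ := hN
  have h1 : C (u : k) * X (lo l) ^ (N + 1) ∈ degLT k (hi l) 1 :=
    mul_mem_degLT (N' := 0) (C_mem_degLT _ _) (X_pow_mem_degLT_of_ne (lo_ne_hi l) _)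
  have h2 : h ∈ degLT k (hi l) 1 := by simpa using sub_mem hf h1
  refine ⟨-u, CycKLR.demazure l h -
    (∑ i ∈ Finset.range N, X (lo l) ^ (i + 1) * X (hi l) ^ (N - 1 - i)) * C (u : k),
    sub_mem (demazure_mem_degLT_hi h2 hh) ?_, ?_⟩
  · rw [Finset.sum_mul]
    refine sum_mem fun i hi' => ?_
    rw [Finset.mem_range] at hi'
    refine degLT_mono ?_ (mul_mem_degLT (N' := 0) (mul_mem_degLT (N' := N - 1 - i)
      (X_pow_mem_degLT_of_ne (lo_ne_hi l) _) (X_pow_mem_degLT _ _)) (C_mem_degLT _ _))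
    omega
  · rw [demazure_add, mul_comm (C (u : k)), demazure_X_pow_mul _ (permPoly_C _ _),
      Finset.sum_range_succ']
    have : ∀ i, N + 1 - 1 - (i + 1) = N - 1 - i := fun i => by omega
    rw [Finset.sum_congr rfl fun i _ => by rw [this i]]
    simp only [pow_zero, one_mul, Nat.add_sub_cancel, Nat.sub_zero, Units.val_neg, map_neg]
    ring

variable {I : Type*} [DecidableEq I] {β : I → ℕ} {Q : I → I → MvPolynomial (Fin 2) k}
  {prec : I → I → Prop} {a : I → k[X]}

theorem gPolyAux_mem_degLT (h : IsAdapted Q prec β) {r : ℕ} {t : Fin n} (hrt : r < t.val)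
    (ν : Seqs I n β) : gPolyAux Q a prec r ν.1 ∈ degLT k t 1 := by
  induction r generalizing ν t with
  | zero =>
    rw [gPolyAux]
    split_ifs with hn
    · have hne : (⟨0, hn⟩ : Fin n) ≠ t := fun e => by
        rw [← e] at hrt
        exact absurd hrt (lt_irrefl _)
      have h1 : ∀ i : ℕ, (X ⟨0, hn⟩ ^ i : MvPolynomial (Fin n) k) ∈ degLT k t 1 :=
        X_pow_mem_degLT_of_ne hne
      rw [Polynomial.aeval_eq_sum_range]
      exact sum_mem fun i _ => Submodule.smul_mem _ _ (h1 i)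
    · exact zero_mem _
  | succ r ih =>
    by_cases hr : r < n - 1
    swap
    · rw [gPolyAux, dif_neg hr]
      exact zero_mem _
    have h1 : lo (⟨r, hr⟩ : Fin (n - 1)) ≠ t := by rintro rfl; simp [lo] at hrt
    have h2 : hi (⟨r, hr⟩ : Fin (n - 1)) ≠ t := by rintro rfl; simp [hi] at hrt
    rw [gPolyAux_succ hr h, tauAt, crossing]
    have hlt := ih (Nat.lt_of_succ_lt hrt) (Seqs.act (simpleTransp ⟨r, hr⟩) ν)
    split_ifs
    · exact demazure_mem_degLT_of_ne h1 h2 (ih (by simp [hi]) _) hlt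
    · refine mul_mem_degLT (N' := 0) ?_ (subst₂_mem_degLT_of_ne h1 h2 _)
      have := permPoly_mem_degLT (simpleTransp ⟨r, hr⟩) hlt
      rwa [simpleTransp_of_ne h1.symm h2.symm] at this

theorem unitMonic_aeval_X {σ : Type*} (t : σ) {p : k[X]} (hp : p.Monic) :
    UnitMonic t p.natDegree (Polynomial.aeval (X t : MvPolynomial σ k) p) := by
  have h1 : ∀ i ∈ Finset.range p.natDegree,
      p.coeff i • (X t ^ i : MvPolynomial σ k) ∈ degLT k t p.natDegree := fun i hi' =>
    Submodule.smul_mem _ _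
      (degLT_mono (Nat.succ_le_of_lt (Finset.mem_range.1 hi')) (X_pow_mem_degLT t i))
  refine ⟨1, _, sum_mem h1, ?_⟩
  rw [Polynomial.aeval_eq_sum_range, Finset.sum_range_succ, Polynomial.coeff_natDegree,
    hp.leadingCoeff, one_smul, Units.val_one, map_one, one_mul, add_comm]

/-- A swap carries the leading variable along, a factor `Q` has a unit leading coefficient in its
second variable, and a divided difference lowers the degree by one and keeps a unit. This breaks
down only at a divided difference in degree 0, that is, after a unit constant; the second
alternative records it, and it persists. -/
theorem unitMonic_gPolyAux (h : IsAdapted Q prec β) (ha : ∀ i, (a i).Monic)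
    (hQ : ∀ i j, i ≠ j → ∃ M, UnitMonic 1 M (Q i j)) {r : ℕ} (hr : r < n) (ν : Seqs I n β) :
    (∃ N, UnitMonic (⟨r, hr⟩ : Fin n) N (gPolyAux Q a prec r ν.1)) ∨
      ∃ q : Fin n, q.val < r ∧ UnitMonic q 0 (gPolyAux Q a prec q ν.1) := by
  induction r generalizing ν with
  | zero =>
    left
    refine ⟨(a (ν.1 ⟨0, hr⟩)).natDegree, ?_⟩
    rw [gPolyAux, dif_pos hr]
    exact unitMonic_aeval_X _ (ha _)
  | succ r ih =>
    have hr' : r < n - 1 := by omega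
    set l : Fin (n - 1) := ⟨r, hr'⟩
    have ih' := ih (by omega) (Seqs.act (simpleTransp l) ν)
    by_cases heq : ν.1 (lo l) = ν.1 (hi l)
    · rw [Seqs.act_simple_eq_self heq] at ih'
      rcases ih' with ⟨N, hN⟩ | ⟨q, hq, hq'⟩
      · cases N with
        | zero => exact Or.inr ⟨lo l, Nat.lt_succ_self r, hN⟩
        | succ N =>
          refine Or.inl ⟨N, ?_⟩
          rw [gPolyAux_succ hr' h, tauAt, heq, crossing_self, Seqs.act_simple_eq_self heq]
          exact UnitMonic.demazure (l := l) (gPolyAux_mem_degLT h (Nat.lt_succ_self r) ν) hN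
      · exact Or.inr ⟨q, by omega, hq'⟩
    · rcases ih' with ⟨N, hN⟩ | ⟨q, hq, hq'⟩
      · left
        have h1 := hN.permPoly (simpleTransp l)
        have h2 : simpleTransp l ⟨r, by omega⟩ = hi l := simpleTransp_lo l
        rw [h2] at h1
        have h3 : ∃ M, UnitMonic (hi l)
            M (CycKLR.subst₂ (factor Q prec (ν.1 (lo l)) (ν.1 (hi l))) (lo l) (hi l)) := by
          unfold factor
          split_ifs
          · obtain ⟨M, hM⟩ := hQ _ _ heq
            exact ⟨M, hM.subst₂ (lo_ne_hi l)⟩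
          · exact ⟨0, (UnitMonic.one 1).subst₂ (lo_ne_hi l)⟩
        obtain ⟨M, hM⟩ := h3
        refine ⟨N + M, ?_⟩
        rw [gPolyAux_succ hr' h, tauAt, crossing_ne _ _ _ heq]
        exact h1.mul hM
      · refine Or.inr ⟨q, by omega, ?_⟩
        have := gFam_simple (Q := Q) (a := a) (prec := prec) (l := l) hq ν
        rw [gFam, gFam] at this
        rwa [this] at hq'

end GDegrees

/-! ### Division by a triangular family of polynomials -/

section Division

open MvPolynomial

variable {k : Type*} [CommRing k] {n : ℕ}

theorem monomial_eq_X_pow_mul_erase (m : Fin n →₀ ℕ) (r : Fin n) (c : k) :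
    monomial m c = X r ^ m r * monomial (m.erase r) c := by
  rw [X_pow_eq_monomial, monomial_mul, one_mul, Finsupp.single_add_erase]

/-- Reduction by the members of index less than `j` of a triangular family. -/
theorem monomial_mem_sup {g : Fin n → MvPolynomial (Fin n) k} {N : Fin n → ℕ}
    (hg : ∀ r, UnitMonic r (N r) (g r)) (hfree : ∀ r t, r < t → g r ∈ degLT k t 1)
    (j : ℕ) (m : Fin n →₀ ℕ) (hm : ∀ q : Fin n, j ≤ q.val → m q = 0) :
    (monomial m 1 : MvPolynomial (Fin n) k) ∈
      restrictSupport k {m | ∀ q : Fin n, m q < if q.val < j then N q else 1} ⊔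
        (Ideal.span (Set.range g)).restrictScalars k := by
  induction j generalizing m with
  | zero =>
    refine Submodule.mem_sup_left ((monomial_mem_restrictSupport k).2 (Or.inl fun q => ?_))
    rw [hm q (Nat.zero_le _)]
    simp
  | succ j ih =>
    by_cases hj : j < n
    swap
    · have := ih m fun q hq => absurd q.2 (not_lt.2 ((not_lt.1 hj).trans hq))
      have h1 : ∀ q : Fin n, (q.val < j + 1) = (q.val < j) := fun q => by
        have := q.2
        exact propext ⟨fun _ => by omega, fun _ => by omega⟩
      simpa only [h1] using this
    set t : Fin n := ⟨j, hj⟩ with ht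
    generalize hd : m t = d
    induction d using Nat.strong_induction_on generalizing m with
    | _ d ihd =>
    rcases lt_or_ge d (N t) with hlt | hge
    -- The earlier variables are reduced first. The remainder is free of `X t`, so the power of `X
    -- t` can be restored without spoiling any bound.
    · obtain ⟨f, hf, l, hl, e⟩ := Submodule.mem_sup.1 (ih (m.erase t) fun q hq => by
        rcases eq_or_ne q t with rfl | hqt
        · exact Finsupp.erase_same
        · rw [Finsupp.erase_ne hqt]
          exact hm q (Nat.lt_of_le_of_ne hq fun e => hqt (Fin.ext e.symm)))
      rw [monomial_eq_X_pow_mul_erase m t, ← e, mul_add]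
      refine Submodule.add_mem_sup ?_ (Ideal.mul_mem_left _ _ hl)
      rw [f.as_sum, Finset.mul_sum]
      refine sum_mem fun m' hm' => ?_
      rw [X_pow_eq_monomial, monomial_mul, hd]
      refine (monomial_mem_restrictSupport k).2 (Or.inl fun q => ?_)
      have h1 := ((mem_restrictSupport_iff k).1 hf) hm' q
      rw [Finsupp.add_apply]
      rcases lt_trichotomy q.val j with hq | hq | hq
      · rw [if_pos hq] at h1
        rw [if_pos (hq.trans (Nat.lt_succ_self j)), Finsupp.single_eq_of_ne, zero_add]
        · exact h1
        · rintro rfl; exact lt_irrefl _ hq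
      · obtain rfl : q = t := Fin.ext hq
        rw [if_neg (lt_irrefl _)] at h1
        rw [if_pos (Nat.lt_succ_self _), Finsupp.single_eq_same]
        omega
      · rw [if_neg (by omega)] at h1
        rw [if_neg (by omega), Finsupp.single_eq_of_ne, zero_add]
        · exact h1
        · rintro rfl; exact lt_irrefl _ hq
    -- The power `X t ^ N t` is traded, modulo `g t`, for terms with a smaller exponent at `t`; by
    -- `hfree` these contain no later variable.
    · obtain ⟨u, h, hh, e⟩ := hg t
      have hsub : Finsupp.single t (N t) + (m - Finsupp.single t (N t)) = m :=
        add_tsub_cancel_of_le (Finsupp.single_le_iff.2 (hd ▸ hge))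
      set m' := m - Finsupp.single t (N t) with hm'
      have e1 : monomial m (1 : k) =
          (C ((u⁻¹ : kˣ) : k) * monomial m' 1) * g t -
            ((u⁻¹ : kˣ) : k) • (h * monomial m' 1) := by
        have e2 : monomial m (1 : k) = X t ^ N t * monomial m' 1 := by
          rw [X_pow_eq_monomial, monomial_mul, one_mul, hsub]
        have e3 : (C ((u⁻¹ : kˣ) : k) * C (u : k) : MvPolynomial (Fin n) k) = 1 := by
          rw [← C_mul, Units.inv_mul, C_1]
        rw [e, e2, smul_eq_C_mul]
        linear_combination - X t ^ N t * monomial m' (1 : k) * e3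
      rw [e1]
      refine sub_mem (Submodule.mem_sup_right
        (Ideal.mul_mem_left _ _ (Ideal.subset_span ⟨t, rfl⟩))) (Submodule.smul_mem _ _ ?_)
      rw [h.as_sum, Finset.sum_mul]
      refine sum_mem fun s hs => ?_
      have h1 : monomial s (h.coeff s) * monomial m' 1 =
          h.coeff s • monomial (s + m') (1 : k) := by
        rw [monomial_mul, smul_monomial, smul_eq_mul]
      rw [h1]
      refine Submodule.smul_mem _ _ (ihd ((s + m') t) ?_ (s + m') (fun q hq => ?_) rfl)
      · have h2 := mem_degLT.1 hh s hs
        have h3 := DFunLike.congr_fun hsub t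
        rw [Finsupp.add_apply, Finsupp.single_eq_same] at h3
        rw [Finsupp.add_apply]
        omega
      · have htq : t < q := hq
        have h2 : h ∈ degLT k q 1 := by
          have h4 : (C (u : k) * X t ^ N t : MvPolynomial (Fin n) k) ∈ degLT k q 1 :=
            mul_mem_degLT (N' := 0) (C_mem_degLT _ _) (X_pow_mem_degLT_of_ne htq.ne _)
          have := sub_mem (hfree t q htq) h4
          rwa [e, add_sub_cancel_left] at this
        have h3 := DFunLike.congr_fun hsub q
        rw [Finsupp.add_apply, hm q hq] at h3
        have := mem_degLT.1 h2 s hs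
        rw [Finsupp.add_apply]
        omega

theorem mem_sup_of_unitMonic {g : Fin n → MvPolynomial (Fin n) k} {N : Fin n → ℕ}
    (hg : ∀ r, UnitMonic r (N r) (g r)) (hfree : ∀ r t, r < t → g r ∈ degLT k t 1)
    (f : MvPolynomial (Fin n) k) :
    f ∈ restrictSupport k {m | ∀ q : Fin n, m q < N q} ⊔
        (Ideal.span (Set.range g)).restrictScalars k := by
  rw [f.as_sum]
  refine sum_mem fun m _ => ?_
  have := Submodule.smul_mem _ (f.coeff m)
    (monomial_mem_sup hg hfree n m fun q hq => absurd q.2 (not_lt.2 hq))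
  rw [smul_monomial, smul_eq_mul, mul_one] at this
  simpa using this

/-- Polynomials as polynomials in one variable `X_r` over a quotient ring. -/
def toPoly (J : Ideal (MvPolynomial (Fin n) k)) (r : Fin n) :
    MvPolynomial (Fin n) k →ₐ[k] (MvPolynomial (Fin n) k ⧸ J)[X] :=
  aeval fun q => if q = r then Polynomial.X else Polynomial.C (Ideal.Quotient.mk J (X q))

theorem toPoly_of_mem_degLT (J : Ideal (MvPolynomial (Fin n) k)) {r : Fin n}
    {f : MvPolynomial (Fin n) k} (hf : f ∈ degLT k r 1) :
    toPoly J r f = Polynomial.C (Ideal.Quotient.mk J f) := by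
  refine induction_degLT (p := fun f => toPoly J r f = Polynomial.C (Ideal.Quotient.mk J f))
    ?_ ?_ ?_ hf
  · simp
  · intro f g hf hg
    simp only [map_add, hf, hg]
  · intro m c hm
    rw [toPoly, aeval_monomial, monomial_eq, map_mul, map_mul, Finsupp.prod, Finsupp.prod, map_prod,
      map_prod]
    congr 1
    refine Finset.prod_congr rfl fun q hq => ?_
    rw [if_neg, map_pow, map_pow]
    rintro rfl
    exact (Finsupp.mem_support_iff.1 hq) (Nat.lt_one_iff.1 hm)

theorem degree_toPoly_lt (J : Ideal (MvPolynomial (Fin n) k)) {r : Fin n} {N : ℕ}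
    {f : MvPolynomial (Fin n) k} (hf : f ∈ degLT k r N) : (toPoly J r f).degree < N := by
  refine induction_degLT (p := fun f => (toPoly J r f).degree < N) ?_ ?_ ?_ hf
  · rw [map_zero, Polynomial.degree_zero]
    exact WithBot.bot_lt_coe _
  · intro f g hf hg
    rw [map_add]
    exact (Polynomial.degree_add_le _ _).trans_lt (max_lt hf hg)
  · intro m c hm
    rw [monomial_eq_X_pow_mul_erase m r, mul_comm, map_mul, map_pow, toPoly_of_mem_degLT J
      (monomial_mem_degLT (by simp) c), toPoly, aeval_X, if_pos rfl]
    exact (Polynomial.degree_C_mul_X_pow_le _ _).trans_lt (by exact_mod_cast hm)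

theorem eval_toPoly (J : Ideal (MvPolynomial (Fin n) k)) (r : Fin n) (f : MvPolynomial (Fin n) k) :
    (toPoly J r f).eval (Ideal.Quotient.mk J (X r)) = Ideal.Quotient.mk J f := by
  induction f using MvPolynomial.induction_on with
  | C a =>
    rw [toPoly_of_mem_degLT J (C_mem_degLT r a), Polynomial.eval_C]
  | add p q hp hq => rw [map_add, Polynomial.eval_add, hp, hq, map_add]
  | mul_X p i hp =>
    rw [map_mul, Polynomial.eval_mul, hp, map_mul]
    congr 1
    rw [toPoly, aeval_X]
    split_ifs with h
    · rw [h, Polynomial.eval_X]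
    · rw [Polynomial.eval_C]

/-- Modulo the earlier members, `f` is a polynomial in the last variable `X t`, divisible by a monic
one of degree `N t` yet of smaller degree. So it vanishes there, `f` lies in the ideal of the
earlier members, and the argument descends. -/
theorem eq_zero_of_mem_span {g : Fin n → MvPolynomial (Fin n) k} {N : Fin n → ℕ}
    (hg : ∀ r, UnitMonic r (N r) (g r)) (hfree : ∀ r t, r < t → g r ∈ degLT k t 1)
    (j : ℕ) (hj : j ≤ n) {f : MvPolynomial (Fin n) k}
    (hf : f ∈ Ideal.span (g '' {r | r.val < j})) (hN : ∀ r : Fin n, r.val < j → f ∈ degLT k r (N r)) :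
    f = 0 := by
  induction j generalizing f with
  | zero => simpa using hf
  | succ j ih =>
    refine ih (Nat.le_of_succ_le hj) ?_ fun r hr => hN r (hr.trans (Nat.lt_succ_self j))
    set t : Fin n := ⟨j, hj⟩ with ht
    set J := Ideal.span (g '' {r | r.val < j}) with hJ
    have hset : {r : Fin n | r.val < j + 1} = insert t {r | r.val < j} := by
      ext r
      simp only [Set.mem_ofPred_eq, Set.mem_insert_iff, Fin.ext_iff, ht]
      omega
    rw [hset, Set.image_insert_eq, Ideal.mem_span_insert] at hf
    obtain ⟨q, l, hl, e⟩ := hf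
    -- Comparing degrees needs a nontrivial coefficient ring; if the quotient is trivial, `J` is
    -- everything and contains `f`.
    rcases subsingleton_or_nontrivial (MvPolynomial (Fin n) k ⧸ J) with hs | hs
    · exact Ideal.Quotient.eq_zero_iff_mem.1 (Subsingleton.elim _ _)
    have hker : ∀ l ∈ J, toPoly J t l = 0 := by
      intro l hl
      have : J ≤ RingHom.ker (toPoly J t) := by
        rw [hJ, Ideal.span_le]
        rintro _ ⟨r, hr, rfl⟩
        rw [SetLike.mem_coe, RingHom.mem_ker, toPoly_of_mem_degLT J (hfree r t hr),
          Ideal.Quotient.eq_zero_iff_mem.2 (Ideal.subset_span (Set.mem_image_of_mem g hr)), map_zero]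
      exact this hl
    obtain ⟨u, h, hh, eg⟩ := hg t
    have e1 : toPoly J t (C ((u⁻¹ : kˣ) : k) * g t) =
        Polynomial.X ^ N t + toPoly J t (C ((u⁻¹ : kˣ) : k) * h) := by
      rw [eg, mul_add, ← mul_assoc, ← C_mul, Units.inv_mul, C_1, one_mul, map_add, map_pow]
      congr 2
      rw [toPoly, aeval_X, if_pos rfl]
    have h0 : (C ((u⁻¹ : kˣ) : k) * h : MvPolynomial (Fin n) k) ∈ degLT k t (N t) := by
      rw [← smul_eq_C_mul]
      exact Submodule.smul_mem _ _ hh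
    have hdeg := degree_toPoly_lt J h0
    have hmonic : (toPoly J t (C ((u⁻¹ : kˣ) : k) * g t)).Monic := by
      rw [e1]
      exact Polynomial.monic_X_pow_add hdeg
    have hfe : toPoly J t f = toPoly J t (C ((u⁻¹ : kˣ) : k) * g t) * toPoly J t (C (u : k) * q) := by
      rw [e, map_add, hker l hl, add_zero, ← map_mul]
      congr 1
      have e3 : (C ((u⁻¹ : kˣ) : k) * C (u : k) : MvPolynomial (Fin n) k) = 1 := by
        rw [← C_mul, Units.inv_mul, C_1]
      linear_combination - q * g t * e3
    have hz : toPoly J t f = 0 := by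
      by_contra hne
      refine hmonic.not_dvd_of_degree_lt hne ?_ (Dvd.intro _ hfe.symm)
      rw [e1, Polynomial.degree_add_eq_left_of_degree_lt (by rwa [Polynomial.degree_X_pow]),
        Polynomial.degree_X_pow]
      exact degree_toPoly_lt J (hN t (Nat.lt_succ_self j))
    rw [← Ideal.Quotient.eq_zero_iff_mem, ← eval_toPoly J t, hz, Polynomial.eval_zero]

end Division

/-! ### The action of `τ_w` on polynomials -/

section Transition

open MvPolynomial

variable {k : Type*} [CommRing k] [IsDomain k] {I : Type*} [Fintype I] [DecidableEq I]
  {n : ℕ} {β : I → ℕ} {Q : I → I → MvPolynomial (Fin 2) k} {prec : I → I → Prop}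
  {word : Equiv.Perm (Fin n) → List (Fin (n - 1))}

/-- The component in `ν` of the family obtained by the right action of `τ_w` from the family with
the single component `f` in `μ`. -/
def transition (h : IsAdapted Q prec β) (word : Equiv.Perm (Fin n) → List (Fin (n - 1)))
    (μ ν : Seqs I n β) (w : Equiv.Perm (Fin n)) (f : MvPolynomial (Fin n) k) :
    MvPolynomial (Fin n) k :=
  ract h (Pi.single μ f) (klrτWord Q β (word w) * klrE Q ν) ν

theorem transition_one (h : IsAdapted Q prec β) (hword : ∀ w, IsReducedExpr w (word w))
    (μ : Seqs I n β) (f : MvPolynomial (Fin n) k) : transition h word μ μ 1 f = f := by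
  rw [transition, isReducedExpr_one_iff.1 (hword 1), klrτWord_nil, one_mul, ract_klrE, if_pos rfl,
    Pi.single_eq_same]

theorem transition_of_descent (h : IsAdapted Q prec β) (hword : ∀ w, IsReducedExpr w (word w))
    {μ ν : Seqs I n β} (hμ : IsSorted prec μ.1) {w : Equiv.Perm (Fin n)} (hw : Seqs.act w ν = μ)
    {l : Fin (n - 1)} (hl : w (hi l) < w (lo l)) (f : MvPolynomial (Fin n) k) :
    transition h word μ ν w f = tauAt Q prec l ν
      (transition h word μ (Seqs.act (simpleTransp l) ν) (w * simpleTransp l) f) := by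
  have h1 := (hword (w * simpleTransp l)).concat (l := l) (by simpa using hl)
  rw [mul_simple_mul_simple] at h1
  rw [transition, klrτWord_eq h hμ hw (hword w) h1, klrτWord_concat_mul_klrE, ract_mul, ract_klrτ,
    tauOp_apply]
  rfl

theorem ract_single_klrτ (h : IsAdapted Q prec β) {μ : Seqs I n β} {l : Fin (n - 1)}
    (hl : μ.1 (lo l) = μ.1 (hi l)) (f : MvPolynomial (Fin n) k) :
    ract h (Pi.single μ f) (klrτ Q β l) = Pi.single μ (demazure l f) := by
  funext ρ
  rw [ract_klrτ, tauOp_apply]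
  by_cases hρ : ρ = μ
  · rw [hρ, Seqs.act_simple_eq_self hl, Pi.single_eq_same, Pi.single_eq_same, tauAt, hl,
      crossing_self]
    rfl
  · rw [Pi.single_eq_of_ne hρ, Pi.single_eq_of_ne, tauAt_zero]
    intro e
    apply hρ
    rw [← Seqs.act_simple_act_simple l ρ, e, Seqs.act_simple_eq_self hl]

/-- A divided difference inside a block of `μ` is a left multiplication by `τ_l`. It either
lengthens `w` on the left or meets another `τ_l`, and `τ_l²` vanishes on equal colours. -/
theorem transition_demazure (h : IsAdapted Q prec β) (hword : ∀ w, IsReducedExpr w (word w))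
    {μ ν : Seqs I n β} (hμ : IsSorted prec μ.1) {w : Equiv.Perm (Fin n)} (hw : Seqs.act w ν = μ)
    {l : Fin (n - 1)} (hl : μ.1 (lo l) = μ.1 (hi l)) (f : MvPolynomial (Fin n) k) :
    transition h word μ ν w (demazure l f) = if w⁻¹ (lo l) < w⁻¹ (hi l) then
      transition h word μ ν (simpleTransp l * w) f else 0 := by
  have hw' : Seqs.act (simpleTransp l * w) ν = μ := by
    rw [Seqs.act_mul, hw, Seqs.act_simple_eq_self hl]
  rw [transition, ← ract_single_klrτ h hl, ← ract_mul, ← mul_assoc]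
  split_ifs with hd
  · rw [← klrτWord_cons, transition, klrτWord_eq h hμ hw' (hword _) ((hword w).cons hd)]
  · have hd' : (simpleTransp l * w)⁻¹ (lo l) < (simpleTransp l * w)⁻¹ (hi l) := by
      simpa [simpleTransp_inv] using (lt_or_gt_simple w⁻¹ l).resolve_left hd
    have h1 := (hword (simpleTransp l * w)).cons hd'
    rw [simple_mul_simple_mul] at h1
    rw [mul_assoc, klrτWord_eq h hμ hw (hword w) h1, klrτWord_cons, mul_assoc, klrτWord_mul_klrE,
      (hword (simpleTransp l * w)).1, hw', ← mul_assoc, ← mul_assoc,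
      klrτ_mul_klrτ_of_eq h.diag hl, zero_mul, ract_zero]
    rfl

/-! ### Monomials with explicit images -/

/-- The number of non-inversions of `w` with second element `r` and equal colours. -/
def sameColourCount (ν : Fin n → I) (w : Equiv.Perm (Fin n)) (r : Fin n) : ℕ :=
  (Finset.univ.filter fun q => q < r ∧ ν q = ν r ∧ w q < w r).card

/-- There are no positions `q < r < s` of the same colour with `w s < w q < w r`. -/
def AvoidsPattern (ν : Fin n → I) (w : Equiv.Perm (Fin n)) : Prop :=
  ∀ q r s, q < r → r < s → ν q = ν r → ν r = ν s → w q < w r → w q < w s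

theorem simpleTransp_simpleTransp (l : Fin (n - 1)) (r : Fin n) :
    simpleTransp l (simpleTransp l r) = r := Equiv.swap_apply_self _ _ _

theorem simpleTransp_lt_iff {l : Fin (n - 1)} {q r : Fin n}
    (h : ¬ (q = lo l ∧ r = hi l)) (h' : ¬ (q = hi l ∧ r = lo l)) :
    simpleTransp l q < simpleTransp l r ↔ q < r := by
  refine ⟨fun hlt => ?_, fun hlt => simpleTransp_lt hlt h⟩
  have := simpleTransp_lt hlt (l := l) ?_
  · rwa [simpleTransp_simpleTransp, simpleTransp_simpleTransp] at this
  · rintro ⟨e1, e2⟩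
    refine h' ⟨?_, ?_⟩
    · rw [← simpleTransp_simpleTransp l q, e1, simpleTransp_lo]
    · rw [← simpleTransp_simpleTransp l r, e2, simpleTransp_hi]

theorem sameColourCount_of_ne {ν : Seqs I n β} {w : Equiv.Perm (Fin n)} {l : Fin (n - 1)}
    {r : Fin n} (h : ∀ q, ν.1 q = ν.1 r → ¬ (q = lo l ∧ r = hi l) ∧ ¬ (q = hi l ∧ r = lo l)) :
    sameColourCount (Seqs.act (simpleTransp l) ν).1 (w * simpleTransp l) (simpleTransp l r) =
      sameColourCount ν.1 w r := by
  refine (Finset.card_equiv (simpleTransp l) fun q => ?_).symm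
  simp only [Finset.mem_filter, Finset.mem_univ, true_and, Seqs.act_simple_apply,
    simpleTransp_simpleTransp, Equiv.Perm.mul_apply]
  constructor
  · rintro ⟨h1, h2, h3⟩
    exact ⟨(simpleTransp_lt_iff (h q h2).1 (h q h2).2).2 h1, h2, h3⟩
  · rintro ⟨h1, h2, h3⟩
    exact ⟨(simpleTransp_lt_iff (h q h2).1 (h q h2).2).1 h1, h2, h3⟩

theorem lt_hi_iff {l : Fin (n - 1)} {q : Fin n} : q < hi l ↔ q < lo l ∨ q = lo l := by
  rw [Fin.lt_def, Fin.lt_def, Fin.ext_iff]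
  simp only [lo, hi]
  omega

theorem sameColourCount_lo_eq_hi {ν : Fin n → I} {w : Equiv.Perm (Fin n)} {l : Fin (n - 1)}
    (hν : ν (lo l) = ν (hi l)) (hl : w (hi l) < w (lo l)) (hav : AvoidsPattern ν w) :
    sameColourCount ν w (lo l) = sameColourCount ν w (hi l) := by
  refine congrArg Finset.card (Finset.filter_congr fun q _ => ?_)
  rw [lt_hi_iff, ← hν]
  constructor
  · rintro ⟨h1, h2, h3⟩
    exact ⟨Or.inl h1, h2, hav _ _ _ h1 (lo_lt_hi l) h2 hν h3⟩
  · rintro ⟨h1 | rfl, h2, h3⟩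
    · exact ⟨h1, h2, h3.trans hl⟩
    · exact absurd h3 hl.not_gt

theorem sameColourCount_mul_simple {ν : Seqs I n β} {w : Equiv.Perm (Fin n)} {l : Fin (n - 1)}
    (hν : ν.1 (lo l) = ν.1 (hi l)) (hl : w (hi l) < w (lo l)) (hav : AvoidsPattern ν.1 w)
    (r : Fin n) : sameColourCount ν.1 (w * simpleTransp l) r =
      sameColourCount ν.1 w r + if r = hi l then 1 else 0 := by
  by_cases h1 : r = lo l
  · rw [if_neg (h1 ▸ lo_ne_hi l), add_zero, h1, sameColourCount_lo_eq_hi hν hl hav]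
    refine congrArg Finset.card (Finset.filter_congr fun q _ => ?_)
    rw [lt_hi_iff, Equiv.Perm.mul_apply, Equiv.Perm.mul_apply, simpleTransp_lo, hν]
    constructor
    · rintro ⟨h1, h2, h3⟩
      rw [simpleTransp_of_ne h1.ne (h1.trans (lo_lt_hi l)).ne] at h3
      exact ⟨Or.inl h1, h2, h3⟩
    · rintro ⟨h1 | rfl, h2, h3⟩
      · rw [simpleTransp_of_ne h1.ne (h1.trans (lo_lt_hi l)).ne]
        exact ⟨h1, h2, h3⟩
      · exact absurd h3 hl.not_gt
  by_cases h2 : r = hi l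
  · rw [if_pos h2, h2, ← sameColourCount_lo_eq_hi hν hl hav]
    have : (Finset.univ.filter fun q => q < lo l ∧ ν.1 q = ν.1 (lo l) ∧ w q < w (lo l)).card + 1 =
        (insert (lo l) (Finset.univ.filter fun q =>
          q < lo l ∧ ν.1 q = ν.1 (lo l) ∧ w q < w (lo l))).card :=
      (Finset.card_insert_of_notMem (by simp)).symm
    rw [sameColourCount, sameColourCount, this]
    congr 1
    ext q
    simp only [Finset.mem_filter, Finset.mem_univ, true_and, Finset.mem_insert,
      Equiv.Perm.mul_apply, simpleTransp_hi, lt_hi_iff, ← hν]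
    constructor
    · rintro ⟨h1 | h1, h2, h3⟩
      · rw [simpleTransp_of_ne h1.ne (h1.trans (lo_lt_hi l)).ne] at h3
        exact Or.inr ⟨h1, h2, h3⟩
      · exact Or.inl h1
    · rintro (rfl | ⟨h1, h2, h3⟩)
      · rw [simpleTransp_lo]
        exact ⟨Or.inr rfl, rfl, hl⟩
      · rw [simpleTransp_of_ne h1.ne (h1.trans (lo_lt_hi l)).ne]
        exact ⟨Or.inl h1, h2, h3⟩
  · rw [if_neg h2, add_zero]
    have := sameColourCount_of_ne (ν := ν) (w := w) (l := l) (r := r)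
      fun q _ => ⟨fun e => h2 e.2, fun e => h1 e.2⟩
    rwa [Seqs.act_simple_eq_self hν, simpleTransp_of_ne h1 h2] at this

/-- Only triples containing both crossed positions could form a new pattern; monotonicity to the
right of the descent excludes the dangerous ones. -/
theorem AvoidsPattern.mul_simple {ν : Seqs I n β} {w : Equiv.Perm (Fin n)} {l : Fin (n - 1)}
    (hl : w (hi l) < w (lo l)) (hmono : ∀ q r, lo l < q → q < r → w q < w r)
    (hav : AvoidsPattern ν.1 w) :
    AvoidsPattern (Seqs.act (simpleTransp l) ν).1 (w * simpleTransp l) := by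
  intro q r s hqr hrs e1 e2 hw
  rw [Seqs.act_simple_apply, Seqs.act_simple_apply] at e1 e2
  rw [Equiv.Perm.mul_apply, Equiv.Perm.mul_apply] at hw ⊢
  by_cases h1 : q = lo l ∧ r = hi l
  · obtain ⟨rfl, rfl⟩ := h1
    rw [simpleTransp_lo, simpleTransp_of_ne ((lo_lt_hi l).trans hrs).ne' hrs.ne']
    exact hmono _ _ (lo_lt_hi l) hrs
  by_cases h2 : r = lo l ∧ s = hi l
  · obtain ⟨rfl, rfl⟩ := h2
    rw [simpleTransp_hi]
    rw [simpleTransp_lo] at hw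
    exact hw.trans hl
  exact hav _ _ _ (simpleTransp_lt hqr h1) (simpleTransp_lt hrs h2) e1 e2 hw

theorem permPoly_prod_X_pow (w : Equiv.Perm (Fin n)) (b : Fin n → ℕ) :
    permPoly w (∏ r, X r ^ b (w r) : MvPolynomial (Fin n) k) = ∏ r, X r ^ b r := by
  rw [permPoly, map_prod, ← Equiv.prod_comp w fun r => (X r ^ b r : MvPolynomial (Fin n) k)]
  simp

theorem exists_rightmost_descent {w : Equiv.Perm (Fin n)} (hw : w ≠ 1) :
    ∃ l, w (hi l) < w (lo l) ∧ ∀ q r, lo l < q → q < r → w q < w r := by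
  obtain ⟨l0, hl0⟩ := exists_descent hw
  obtain ⟨l, hl, hmax⟩ := Finset.exists_max_image
    (Finset.univ.filter fun l : Fin (n - 1) => w (hi l) < w (lo l)) Fin.val ⟨l0, by simpa using hl0⟩
  rw [Finset.mem_filter] at hl
  refine ⟨l, hl.2, fun q r hq hqr => ?_⟩
  refine strictMono_of_forall_lo_lt_hi (m := l.val + 1) (fun l' hl' => ?_) hq hqr
  refine (lt_or_gt_simple w l').resolve_right fun hd => ?_
  have := hmax l' (by simpa using hd)
  omega

/-- The exponents are designed for an induction removing the rightmost descent `l`. With equal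
colours, avoidance makes the exponents at `lo l` and `hi l` coincide, and passing to `w s_l` raises
only the one at `hi l` by one: the divided difference of `X (hi l)` times a symmetric monomial is
that monomial. With distinct colours, sortedness of `μ` makes the factor 1, so the operator only
permutes the variables. Avoidance, unlike terminality, survives the induction. -/
theorem exists_transition_eq (h : IsAdapted Q prec β) (hword : ∀ w, IsReducedExpr w (word w))
    {μ ν : Seqs I n β} (hμ : IsSorted prec μ.1) {w : Equiv.Perm (Fin n)} (hw : Seqs.act w ν = μ)
    (hav : AvoidsPattern ν.1 w) :
    ∃ f, transition h word μ ν w f = ∏ r, X r ^ sameColourCount ν.1 w r := by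
  induction hN : invCount w using Nat.strong_induction_on generalizing w ν with
  | _ N ih =>
  by_cases hw1 : w = 1
  · subst hw1
    rw [Seqs.act_one] at hw
    subst hw
    exact ⟨_, transition_one h hword ν _⟩
  obtain ⟨l, hl, hmono⟩ := exists_rightmost_descent hw1
  obtain ⟨f, hf⟩ := ih (invCount (w * simpleTransp l))
    (by have := invCount_mul_simple_add_one hl; omega) (Seqs.act_mul_simple hw l)
    (hav.mul_simple hl hmono) rfl
  refine ⟨f, ?_⟩
  rw [transition_of_descent h hword hμ hw hl, hf]
  by_cases hν : ν.1 (lo l) = ν.1 (hi l)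
  · rw [Seqs.act_simple_eq_self hν, tauAt, hν, crossing_self]
    have e1 : (∏ r, X r ^ sameColourCount ν.1 (w * simpleTransp l) r : MvPolynomial (Fin n) k) =
        X (hi l) * ∏ r, X r ^ sameColourCount ν.1 w r := by
      simp only [sameColourCount_mul_simple hν hl hav, pow_add, Finset.prod_mul_distrib]
      rw [mul_comm]
      congr 1
      simp [Finset.prod_ite_eq']
    have e2 : permPoly (simpleTransp l) (∏ r, X r ^ sameColourCount ν.1 w r :
        MvPolynomial (Fin n) k) = ∏ r, X r ^ sameColourCount ν.1 w r := by
      conv_rhs => rw [← permPoly_prod_X_pow (simpleTransp l)]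
      congr 1
      refine Finset.prod_congr rfl fun r _ => ?_
      congr 1
      by_cases h1 : r = lo l
      · rw [h1, simpleTransp_lo, sameColourCount_lo_eq_hi hν hl hav]
      by_cases h2 : r = hi l
      · rw [h2, simpleTransp_hi, sameColourCount_lo_eq_hi hν hl hav]
      rw [simpleTransp_of_ne h1 h2]
    rw [e1]
    refine divDiff_eq_of (lo_ne_hi l).symm ?_
    rw [Equiv.swap_comm, ← show simpleTransp l = Equiv.swap (lo l) (hi l) from rfl, permPoly_mul,
      e2, permPoly_X, simpleTransp_hi]
    ring
  · have hprec : prec (ν.1 (hi l)) (ν.1 (lo l)) := by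
      rcases hμ _ _ hl.le with h1 | h1
      · rw [← Seqs.apply_of_act_eq hw, ← Seqs.apply_of_act_eq hw] at h1
        exact absurd h1.symm hν
      · rwa [← Seqs.apply_of_act_eq hw, ← Seqs.apply_of_act_eq hw] at h1
    rw [tauAt, crossing_ne _ _ _ hν, factor, if_neg (h.asymm _ _ hprec), subst₂, map_one, mul_one]
    change permPoly (simpleTransp l) _ = _
    conv_rhs => rw [← permPoly_prod_X_pow (simpleTransp l)]
    congr 1
    refine Finset.prod_congr rfl fun r _ => ?_
    congr 1
    rw [← sameColourCount_of_ne (ν := ν) (w := w) (l := l), simpleTransp_simpleTransp]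
    intro q hq
    constructor
    · rintro ⟨e1, e2⟩
      rw [e1, e2] at hq
      exact hν hq
    · rintro ⟨e1, e2⟩
      rw [e1, e2] at hq
      exact hν hq.symm

/-! ### Linear independence over the polynomials -/

/-- A permutation `w` with `w.ν = μ` is terminal if `w⁻¹` is decreasing on all adjacent positions
of the same colour in `μ`. -/
def IsTerminal (μ : Fin n → I) (w : Equiv.Perm (Fin n)) : Prop :=
  ∀ l : Fin (n - 1), μ (lo l) = μ (hi l) → w⁻¹ (hi l) < w⁻¹ (lo l)

theorem IsTerminal.inv_lt (h : IsAdapted Q prec β) {μ : Fin n → I} (hμ : IsSorted prec μ)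
    {w : Equiv.Perm (Fin n)} (hw : IsTerminal μ w) {r t : Fin n} (hrt : r < t) (e : μ r = μ t) :
    w⁻¹ t < w⁻¹ r := by
  obtain ⟨t, ht⟩ := t
  induction t with
  | zero => exact absurd hrt (Nat.not_lt_zero _)
  | succ t ih =>
    obtain ⟨l, h1, h2⟩ : ∃ l : Fin (n - 1), (⟨t + 1, ht⟩ : Fin n) = hi l ∧
        (⟨t, Nat.lt_of_succ_lt ht⟩ : Fin n) = lo l := ⟨⟨t, by omega⟩, rfl, rfl⟩
    rw [h1] at hrt e ⊢
    have ih := ih (Nat.lt_of_succ_lt ht)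
    rw [h2] at ih
    rcases lt_hi_iff.1 hrt with h3 | rfl
    · have h4 := hμ.eq_of_between h h3.le (lo_lt_hi l).le e
      exact (hw l h4.symm).trans (ih h3 (e.trans h4))
    · exact hw l e

/-- For each colour, `w⁻¹` maps the block of `μ` order-reversingly onto the positions of that colour
in `ν`; a strictly monotone map of a finite order is determined by its range. -/
theorem IsTerminal.eq (h : IsAdapted Q prec β) {μ ν : Seqs I n β} (hμ : IsSorted prec μ.1)
    {w w' : Equiv.Perm (Fin n)} (hw : IsTerminal μ.1 w) (hw' : IsTerminal μ.1 w')
    (e : Seqs.act w ν = μ) (e' : Seqs.act w' ν = μ) : w = w' := by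
  rw [← inv_inj]
  refine Equiv.ext fun r => ?_
  have key : ∀ {w : Equiv.Perm (Fin n)}, IsTerminal μ.1 w → Seqs.act w ν = μ →
      StrictMono (fun t : {t // μ.1 t = μ.1 r} => OrderDual.toDual (w⁻¹ t.1)) ∧
        Set.range (fun t : {t // μ.1 t = μ.1 r} => OrderDual.toDual (w⁻¹ t.1)) =
          {t | ν.1 (OrderDual.ofDual t) = μ.1 r} := by
    intro w hw e
    refine ⟨fun t t' htt' => hw.inv_lt h hμ htt' (t.2.trans t'.2.symm), ?_⟩
    ext t
    constructor
    · rintro ⟨t, rfl⟩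
      change ν.1 (w⁻¹ t.1) = μ.1 r
      rw [Seqs.apply_of_act_eq e, ← Equiv.Perm.mul_apply, mul_inv_cancel, Equiv.Perm.one_apply, t.2]
    · intro ht
      refine ⟨⟨w (OrderDual.ofDual t), ?_⟩, ?_⟩
      · rw [← Seqs.apply_of_act_eq e]
        exact ht
      · simp
  have := ((key hw e).1.range_inj (key hw' e').1).1 ((key hw e).2.trans (key hw' e').2.symm)
  exact congrFun this ⟨r, rfl⟩

theorem invCount_le (w : Equiv.Perm (Fin n)) : invCount w ≤ Fintype.card (Fin n × Fin n) :=
  Finset.card_le_univ _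

theorem Seqs.act_simple_mul {μ ν : Seqs I n β} {w : Equiv.Perm (Fin n)} {l : Fin (n - 1)}
    (hl : μ.1 (lo l) = μ.1 (hi l)) : Seqs.act (simpleTransp l * w) ν = μ ↔ Seqs.act w ν = μ := by
  rw [Seqs.act_mul]
  refine ⟨fun e => ?_, fun e => by rw [e, Seqs.act_simple_eq_self hl]⟩
  rw [← Seqs.act_simple_act_simple l (Seqs.act w ν), e, Seqs.act_simple_eq_self hl]

theorem exists_of_not_isTerminal {μ : Fin n → I} {w : Equiv.Perm (Fin n)}
    (hw : ¬ IsTerminal μ w) :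
    ∃ l : Fin (n - 1), μ (lo l) = μ (hi l) ∧ w⁻¹ (lo l) < w⁻¹ (hi l) := by
  rw [IsTerminal] at hw
  push Not at hw
  obtain ⟨l, hl, hd⟩ := hw
  exact ⟨l, hl, (lt_or_gt_simple w⁻¹ l).resolve_right hd.not_gt⟩

/-- A nonterminal permutation becomes longer under left multiplication by some transposition inside
a block. Lengths are bounded, so the climb ends, and it can end only at the unique terminal
permutation. -/
theorem IsTerminal.invCount_lt (h : IsAdapted Q prec β) {μ ν : Seqs I n β}
    (hμ : IsSorted prec μ.1) {w w' : Equiv.Perm (Fin n)} (hw : IsTerminal μ.1 w)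
    (e : Seqs.act w ν = μ) (e' : Seqs.act w' ν = μ) (hne : w' ≠ w) :
    invCount w' < invCount w := by
  induction hN : Fintype.card (Fin n × Fin n) - invCount w' using Nat.strong_induction_on
    generalizing w' with
  | _ N ih =>
  have hw' : ¬ IsTerminal μ.1 w' := fun hw' => hne (hw'.eq h hμ hw e' e)
  obtain ⟨l, hl, hd⟩ := exists_of_not_isTerminal hw'
  have h1 := invCount_simple_mul hd
  by_cases h2 : simpleTransp l * w' = w
  · rw [h2] at h1
    omega
  · have h3 := invCount_le (simpleTransp l * w')
    have := ih _ (by omega) ((Seqs.act_simple_mul hl).2 e') h2 rfl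
    omega

/-- A terminal permutation inverts all pairs of equal colour: avoidance is vacuous and every
exponent in `exists_transition_eq` is zero. -/
theorem IsTerminal.exists_transition_eq_one (h : IsAdapted Q prec β)
    (hword : ∀ w, IsReducedExpr w (word w)) {μ ν : Seqs I n β} (hμ : IsSorted prec μ.1)
    {w : Equiv.Perm (Fin n)} (hw : IsTerminal μ.1 w) (e : Seqs.act w ν = μ) :
    ∃ f, transition h word μ ν w f = 1 := by
  have hanti : ∀ q r, q < r → ν.1 q = ν.1 r → w r < w q := by
    intro q r hqr hν
    rw [Seqs.apply_of_act_eq e, Seqs.apply_of_act_eq e] at hν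
    refine lt_of_not_ge fun hle => ?_
    have := hw.inv_lt h hμ (hle.lt_of_ne fun e => hqr.ne (w.injective e)) hν
    simp only [← Equiv.Perm.mul_apply, inv_mul_cancel, Equiv.Perm.one_apply] at this
    exact hqr.not_gt this
  obtain ⟨f, hf⟩ := exists_transition_eq h hword hμ e
    fun q r s hqr _ hν _ hlt => absurd hlt (hanti q r hqr hν).not_gt
  refine ⟨f, hf.trans (Finset.prod_eq_one fun r _ => ?_)⟩
  rw [sameColourCount, Finset.filter_false_of_mem, Finset.card_empty, pow_zero]
  rintro q _ ⟨h1, h2, h3⟩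
  exact hanti q r h1 h2 |>.not_gt h3

/-- If all right actions of the element `∑ τ_w p_w e(ν)` have their components in the ideal `J`,
then all the polynomials `p_w` are in `J`. -/
theorem mem_of_sum_transition_mem (h : IsAdapted Q prec β)
    (hword : ∀ w, IsReducedExpr w (word w)) {μ ν : Seqs I n β} (hμ : IsSorted prec μ.1)
    (J : Ideal (MvPolynomial (Fin n) k)) (p : Equiv.Perm (Fin n) → MvPolynomial (Fin n) k)
    (hp : ∀ f, ∑ w ∈ Finset.univ.filter (fun w => Seqs.act w ν = μ),
      transition h word μ ν w f * p w ∈ J)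
    {w : Equiv.Perm (Fin n)} (hw : Seqs.act w ν = μ) : p w ∈ J := by
  -- Upward induction on the length of `w`, for all coefficient families at once, given that shorter
  -- permutations have coefficients in `J`. At a terminal `w` all other permutations are shorter,
  -- and an `f` with image 1 isolates `p w`.
  have key : ∀ N, ∀ w : Equiv.Perm (Fin n), Seqs.act w ν = μ →
      Fintype.card (Fin n × Fin n) - invCount w = N →
      ∀ p : Equiv.Perm (Fin n) → MvPolynomial (Fin n) k,
      (∀ f, ∑ w ∈ Finset.univ.filter (fun w => Seqs.act w ν = μ),
        transition h word μ ν w f * p w ∈ J) →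
      (∀ w', Seqs.act w' ν = μ → invCount w' < invCount w → p w' ∈ J) → p w ∈ J := by
    intro N
    induction N using Nat.strong_induction_on with
    | _ N ih =>
    intro w hw hN p hp hlt
    by_cases ht : IsTerminal μ.1 w
    · obtain ⟨f, hf⟩ := ht.exists_transition_eq_one h hword hμ hw
      have h1 := hp f
      rw [← Finset.add_sum_erase _ _ (Finset.mem_filter.2 ⟨Finset.mem_univ w, hw⟩), hf,
        one_mul] at h1
      refine (Ideal.add_mem_iff_left J (sum_mem fun w' hw' => ?_)).1 h1
      rw [Finset.mem_erase, Finset.mem_filter] at hw'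
      exact J.mul_mem_left _ (hlt w' hw'.2.2 (ht.invCount_lt h hμ hw hw'.2.2 hw'.1))
    · obtain ⟨l, hl, hd⟩ := exists_of_not_isTerminal ht
      have h1 := invCount_simple_mul hd
      have h2 := invCount_le (simpleTransp l * w)
      have hiff : ∀ w : Equiv.Perm (Fin n), (simpleTransp l * w)⁻¹ (hi l) <
          (simpleTransp l * w)⁻¹ (lo l) ↔ w⁻¹ (lo l) < w⁻¹ (hi l) := fun w => by
        simp [simpleTransp_inv]
      -- Testing the relation on `demazure l f` moves the coefficient of `w` to `s_l w` and drops
      -- the terms killed by `τ_l² = 0`. Surviving permutations grow by one as well, so the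
      -- assumption on shorter ones is preserved.
      have h3 := ih _ (by omega) (simpleTransp l * w) ((Seqs.act_simple_mul hl).2 hw) rfl
        (fun w' => if w'⁻¹ (hi l) < w'⁻¹ (lo l) then p (simpleTransp l * w') else 0)
        (fun f => ?_) (fun w' hw' hinv => ?_)
      · rwa [if_pos ((hiff w).2 hd), simple_mul_simple_mul] at h3
      · convert hp (demazure l f) using 1
        refine (Finset.sum_equiv (Equiv.mulLeft (simpleTransp l)) (fun w => ?_) fun w hw => ?_).symm
        · simp [Seqs.act_simple_mul hl]
        · rw [Finset.mem_filter] at hw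
          rw [transition_demazure h hword hμ hw.2 hl]
          simp only [Equiv.coe_mulLeft, hiff, simple_mul_simple_mul]
          split_ifs <;> simp
      · split_ifs with hd'
        · have hd'' := (hiff (simpleTransp l * w')).1 (by rwa [simple_mul_simple_mul])
          have h4 := invCount_simple_mul hd''
          rw [simple_mul_simple_mul] at h4
          exact hlt _ ((Seqs.act_simple_mul hl).2 hw') (by omega)
        · exact zero_mem _
  induction hN : invCount w using Nat.strong_induction_on generalizing w with
  | _ N ih =>
  exact key _ w hw rfl p hp fun w' hw' hlt => ih _ (hN ▸ hlt) hw' rfl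

end Transition

/-! ### The parameters -/

section Parameters

open MvPolynomial

variable {k : Type*} [CommRing k] {I P : Type*} [DecidableEq I] [AddCommGroup P]
  [Module.Free ℤ P] [Module.Finite ℤ P] {𝒜 : ℕ → AddSubgroup k} [GradedRing 𝒜]
  {D : CartanDatum I P} {Q : I → I → MvPolynomial (Fin 2) k}

theorem coeff₂_swap (f : MvPolynomial (Fin 2) k) (p q : ℕ) :
    coeff₂ (rename (Equiv.swap (0 : Fin 2) 1) f) p q = coeff₂ f q p := by
  rw [coeff₂, coeff₂, ← coeff_rename_mapDomain _ (Equiv.swap (0 : Fin 2) 1).injective f]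
  simp [Finsupp.mapDomain_add, Finsupp.mapDomain_single, add_comm]

theorem IsQMatrix.isUnit_coeff (hQ : IsQMatrix D 𝒜 Q) {i j : I} (hij : i ≠ j) :
    IsUnit (coeff₂ (Q i j) 0 (-D.A j i).toNat) := by
  rw [hQ.symm i j, coeff₂_swap]
  obtain ⟨c, hc⟩ := hQ.unit j i hij.symm
  rw [← hc]
  refine IsUnit.of_mul_eq_one ((c⁻¹ : (𝒜 0)ˣ) : 𝒜 0) ?_
  rw [← SetLike.GradeZero.coe_mul, Units.mul_inv, SetLike.GradeZero.coe_one]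

/-- A nonzero coefficient of `u ^ p * v ^ q` has nonnegative degree, which by the symmetrization
reads `d_i p + d_j (q + a_{ji}) ≤ 0`. Hence `q ≥ -a_{ji}` forces `p = 0` and `q = -a_{ji}`, and that
coefficient is a unit by the symmetry of `Q`. -/
theorem IsQMatrix.unitMonic (hQ : IsQMatrix D 𝒜 Q) {i j : I} (hij : i ≠ j) :
    UnitMonic 1 (-D.A j i).toNat (Q i j) := by
  obtain ⟨u, hu⟩ := hQ.isUnit_coeff hij
  set M := (-D.A j i).toNat with hM
  have hM' : (M : ℤ) = -D.A j i :=
    Int.toNat_of_nonneg (by have := D.offDiag j i hij.symm; omega)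
  refine ⟨u, Q i j - C (u : k) * X 1 ^ M, mem_degLT.2 fun m hm => ?_, by ring⟩
  rw [mem_support_iff, coeff_sub, coeff_C_mul, coeff_X_pow] at hm
  have hm' : m = Finsupp.single 0 (m 0) + Finsupp.single 1 (m 1) := by
    ext r
    fin_cases r <;> simp
  by_contra! hle
  apply hm
  have key : coeff m (Q i j) ≠ 0 → m 0 = 0 ∧ m 1 = M := by
    intro hne
    have := hQ.homog i j hij (m 0) (m 1)
    rw [coeff₂, ← hm'] at this
    obtain ⟨r, hr, -⟩ := this.resolve_left hne
    simp only [CartanDatum.form, D.diag] at hr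
    have h1 := D.symm i j
    have h2 : (0 : ℤ) < D.d i := by exact_mod_cast D.d_pos i
    have h3 : (0 : ℤ) < D.d j := by exact_mod_cast D.d_pos j
    have h4 : (M : ℤ) ≤ m 1 := by exact_mod_cast hle
    have h5 : (0 : ℤ) ≤ r := Int.natCast_nonneg r
    have h6 : (0 : ℤ) ≤ m 0 := Int.natCast_nonneg _
    have h7 : (D.d i : ℤ) * m 0 + D.d j * (m 1 - M) ≤ 0 := by
      rw [hM']
      linarith
    have h8 : 0 ≤ (D.d i : ℤ) * m 0 := mul_nonneg h2.le h6
    have h9 : 0 ≤ (D.d j : ℤ) * (m 1 - M) := mul_nonneg h3.le (by linarith)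
    have h10 : (D.d i : ℤ) * m 0 = 0 := by linarith
    have h11 : (D.d j : ℤ) * (m 1 - M) = 0 := by linarith
    have h12 := (mul_eq_zero.1 h10).resolve_left h2.ne'
    have h13 := (mul_eq_zero.1 h11).resolve_left h3.ne'
    omega
  by_cases h0 : Finsupp.single 1 M = m
  · rw [if_pos h0, mul_one, hu, coeff₂, Finsupp.single_zero, zero_add, h0, sub_self]
  · rw [if_neg h0, mul_zero, sub_zero]
    by_contra hne
    obtain ⟨h1, h2⟩ := key hne
    exact h0 (by rw [hm', h1, h2, Finsupp.single_zero, zero_add])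

variable {p n : ℕ} {c : Fin p → I} {m : Fin p → ℕ}

theorem IsBlockSeq.exists_eq {μ : Fin n → I} (h : IsBlockSeq c m μ) (r : Fin n) :
    ∃ s, c s = μ r := by
  have h1 : μ r ∈ List.ofFn μ := List.mem_ofFn.2 ⟨r, rfl⟩
  rw [h, List.mem_flatten] at h1
  obtain ⟨L, hL, hr⟩ := h1
  obtain ⟨s, rfl⟩ := List.mem_ofFn.1 hL
  exact ⟨s, (List.eq_of_mem_replicate hr).symm⟩

theorem IsBlockSeq.isSorted {μ : Fin n → I} (h : IsBlockSeq c m μ) :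
    IsSorted (colourLT c) μ := by
  have h1 : (List.ofFn μ).Pairwise fun i j => i = j ∨ colourLT c i j := by
    rw [h, List.pairwise_flatten]
    refine ⟨fun L hL => ?_, List.pairwise_ofFn.2 fun s t hst i hi j hj => Or.inr ?_⟩
    · obtain ⟨s, rfl⟩ := List.mem_ofFn.1 hL
      exact List.pairwise_replicate.2 (Or.inr (Or.inl rfl))
    · exact ⟨s, t, hst, (List.eq_of_mem_replicate hi).symm, (List.eq_of_mem_replicate hj).symm⟩
  intro r t hrt
  rcases hrt.eq_or_lt with rfl | hrt
  · exact Or.inl rfl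
  · exact List.pairwise_ofFn.1 h1 hrt

theorem IsQMatrix.isAdapted (hQ : IsQMatrix D 𝒜 Q) (hc : Function.Injective c) {β : I → ℕ}
    {μ : Seqs I n β} (h : IsBlockSeq c m μ.1) : IsAdapted Q (colourLT c) β where
  symm := hQ.symm
  diag := hQ.diag
  irrefl := by
    rintro i ⟨s, t, hst, rfl, e⟩
    exact hst.ne (hc e.symm)
  asymm := by
    rintro i j ⟨s, t, hst, rfl, rfl⟩ ⟨s', t', hst', e, e'⟩
    rw [hc e, hc e'] at hst'
    exact hst.not_gt hst'
  trans := by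
    rintro i j l ⟨s, t, hst, rfl, rfl⟩ ⟨s', t', hst', e, rfl⟩
    exact ⟨s, t', hst.trans (hc e ▸ hst'), rfl, rfl⟩
  total := by
    intro i j hi hj hij
    obtain ⟨r, rfl⟩ := μ.exists_apply_eq hi
    obtain ⟨t, rfl⟩ := μ.exists_apply_eq hj
    obtain ⟨s, hs⟩ := h.exists_eq r
    obtain ⟨s', hs'⟩ := h.exists_eq t
    rcases lt_trichotomy s s' with h1 | rfl | h1
    · exact Or.inl ⟨s, s', h1, hs, hs'⟩
    · exact absurd (hs.symm.trans hs') hij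
    · exact Or.inr ⟨s', s, h1, hs', hs⟩

end Parameters

/-! ### The quotient map -/

section Quotient

open MvPolynomial

variable {k : Type*} [CommRing k] {I : Type*} [Fintype I] [DecidableEq I]
  {Q : I → I → MvPolynomial (Fin 2) k} {n : ℕ} {β : I → ℕ} {a : I → k[X]}

variable (Q β a) in
/-- The canonical surjection as a linear map. -/
def toCycLin : KLR Q n β →ₗ[k] CycKLRAlg Q β n a where
  toFun := toCyc Q β a
  map_add' _ _ := map_add _ _ _
  map_smul' _ _ := rfl

theorem toCycLin_apply (y : KLR Q n β) : toCycLin Q β a y = toCyc Q β a y := rfl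

theorem toCyc_mul (y z : KLR Q n β) : toCyc Q β a (y * z) = toCyc Q β a y * toCyc Q β a z :=
  map_mul _ _ _

theorem toCyc_eq_zero_iff {y : KLR Q n β} : toCyc Q β a y = 0 ↔ y ∈ cycIdeal Q β n a := by
  rw [TwoSidedIdeal.mem_iff, ← RingCon.eq]
  rfl

theorem toCyc_surjective : Function.Surjective (toCyc Q β (n := n) a) :=
  RingCon.mk'_surjective _

theorem mem_biweightSpace_iff {μ ν : Seqs I n β} {z : CycKLRAlg Q β n a} :
    z ∈ biweightSpace Q a μ ν ↔ ∃ y, toCyc Q β a (klrE Q μ * y * klrE Q ν) = z := by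
  constructor
  · rintro ⟨x, rfl⟩
    obtain ⟨y, rfl⟩ := toCyc_surjective x
    refine ⟨y, ?_⟩
    rw [toCyc_mul, toCyc_mul]
    rfl
  · rintro ⟨y, rfl⟩
    refine ⟨toCyc Q β a y, ?_⟩
    rw [toCyc_mul, toCyc_mul]
    rfl

theorem monomial_eq_prod_X_pow (m : Fin n →₀ ℕ) :
    (monomial m 1 : MvPolynomial (Fin n) k) = ∏ r, X r ^ m r := by
  rw [monomial_eq, C_1, one_mul, Finsupp.prod_fintype _ _ fun _ => pow_zero _]

theorem polyHom_monomial [IsDomain k] (m : Fin n →₀ ℕ) :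
    polyHom Q β (monomial m 1) = monom (klrX Q β) m := by
  rw [monom_eq_evalHom (k := k) (klrX Q β) (klrX_comm Q β), monomial_eq_prod_X_pow]
  rfl

end Quotient

/-! ### The basis of the bi-weight spaces -/

section Basis

open MvPolynomial

variable {k : Type*} [CommRing k] [IsDomain k] {I : Type*} [Fintype I] [DecidableEq I]
  {Q : I → I → MvPolynomial (Fin 2) k} {n : ℕ} {β : I → ℕ} {prec : I → I → Prop} {a : I → k[X]}
  {word : Equiv.Perm (Fin n) → List (Fin (n - 1))} {μ ν : Seqs I n β}

theorem ract_polyHom (h : IsAdapted Q prec β) (F : Pol k n β) (f : MvPolynomial (Fin n) k)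
    (ν : Seqs I n β) : ract h F (polyHom Q β f) ν = F ν * f := by
  have : (polRep h).comp (polyHom Q β) = mulOp k n β := by
    refine MvPolynomial.algHom_ext fun r => ?_
    rw [AlgHom.comp_apply, polyHom_X, polRep_klrX]
  rw [ract, ← AlgHom.comp_apply, this, mulOp_apply]

theorem ract_klrτWord_mul (h : IsAdapted Q prec β) (w : Equiv.Perm (Fin n))
    (f g : MvPolynomial (Fin n) k) :
    ract h (Pi.single μ f) (klrτWord Q β (word w) * polyHom Q β g * klrE Q ν) ν =
      transition h word μ ν w f * g := by
  rw [mul_assoc, polyHom_mul_klrE, ← mul_assoc, ract_mul, ract_polyHom, transition]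

theorem klrτWord_mul_polyHom_mul_klrE (L : List (Fin (n - 1))) (f : MvPolynomial (Fin n) k)
    {w : Equiv.Perm (Fin n)} (hL : IsReducedExpr w L) (hw : Seqs.act w ν = μ) :
    klrτWord Q β L * polyHom Q β f * klrE Q ν =
      klrE Q μ * klrτWord Q β L * (polyHom Q β f * klrE Q ν) := by
  rw [mul_assoc, polyHom_mul_klrE, ← mul_assoc, ← hw, ← hL.1, ← klrτWord_mul_klrE, mul_assoc,
    ← polyHom_mul_klrE, ← mul_assoc, ← mul_assoc, mul_assoc _ (klrE Q ν) (polyHom Q β f),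
    ← polyHom_mul_klrE, ← mul_assoc, mul_assoc _ (klrE Q ν) (klrE Q ν), klrE_mul_self]

theorem biweightSpace_le (h : IsAdapted Q prec β) (hword : ∀ w, IsReducedExpr w (word w))
    (hμ : IsSorted prec μ.1) {S : Submodule k (CycKLRAlg Q β n a)}
    (hS : ∀ w, Seqs.act w ν = μ → ∀ f,
      toCyc Q β a (klrτWord Q β (word w) * polyHom Q β f * klrE Q ν) ∈ S) :
    biweightSpace Q a μ ν ≤ S := by
  intro z hz
  obtain ⟨y, rfl⟩ := mem_biweightSpace_iff.1 hz
  have h1 : tauSpan Q μ ν ≤ S.comap (toCycLin Q β a) := by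
    refine Submodule.span_le.2 ?_
    rintro _ ⟨w, L, f, hw, hL, rfl⟩
    have h2 := hS w hw f
    rw [mul_assoc, polyHom_mul_klrE, ← mul_assoc, klrτWord_eq h hμ hw (hword w) hL, mul_assoc,
      ← polyHom_mul_klrE, ← mul_assoc] at h2
    exact h2
  exact h1 (mem_tauSpan_of_isSorted h hμ y ν)

theorem annihilates_of_mem_span (h : IsAdapted Q prec β) (hμ : IsSorted prec μ.1)
    {f : MvPolynomial (Fin n) k} (hf : f ∈ Ideal.span (Set.range (gPoly Q a prec ν.1))) :
    Annihilates Q a μ ν f := by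
  induction hf using Submodule.span_induction with
  | mem f hf =>
    obtain ⟨r, rfl⟩ := hf
    exact annihilates_gPolyAux h hμ r.val ν
  | zero => exact annihilates_zero _ _
  | add f g _ _ hf hg => exact hf.add hg
  | smul f g _ hg => exact hg.mul_left f

theorem gIdeal_le (ν : Seqs I n β) :
    gIdeal Q a prec n ν ≤ Ideal.span (gPoly Q a prec ν.1 '' {r | r.val < n}) := by
  refine Ideal.span_le.2 ?_
  rintro _ ⟨r, hr, rfl⟩
  exact Ideal.subset_span ⟨⟨r, hr⟩, hr, rfl⟩

theorem toCyc_mem_span (h : IsAdapted Q prec β) (hword : ∀ w, IsReducedExpr w (word w))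
    (hμ : IsSorted prec μ.1)
    (hg : ∀ r, UnitMonic r ((gPoly Q a prec ν.1 r).degreeOf r) (gPoly Q a prec ν.1 r))
    {w : Equiv.Perm (Fin n)} (hw : Seqs.act w ν = μ) (f : MvPolynomial (Fin n) k) :
    toCyc Q β a (klrτWord Q β (word w) * polyHom Q β f * klrE Q ν) ∈
      Submodule.span k (Set.range fun t : BasisIndex Q a prec μ.1 ν.1 =>
        toCyc Q β a (klrτWord Q β (word t.1.1) * monom (klrX Q β) t.2.1 * klrE Q ν)) := by
  obtain ⟨f, hf, l, hl, rfl⟩ := Submodule.mem_sup.1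
    (mem_sup_of_unitMonic hg (fun r t hrt => gPolyAux_mem_degLT h hrt ν) f)
  have h1 : toCyc Q β a (klrτWord Q β (word w) * polyHom Q β l * klrE Q ν) = 0 := by
    rw [toCyc_eq_zero_iff, klrτWord_mul_polyHom_mul_klrE _ _ (hword w) hw]
    exact annihilates_of_mem_span h hμ hl _
  rw [map_add, mul_add, add_mul, ← toCycLin_apply, map_add, toCycLin_apply, toCycLin_apply, h1,
    add_zero, ← toCycLin_apply, f.as_sum, map_sum, Finset.mul_sum, Finset.sum_mul, map_sum]
  refine sum_mem fun m hm => ?_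
  have h2 : monomial m (f.coeff m) = f.coeff m • monomial m (1 : k) := by
    rw [smul_monomial, smul_eq_mul, mul_one]
  rw [h2, map_smul, mul_smul_comm, smul_mul_assoc, map_smul, polyHom_monomial]
  exact Submodule.smul_mem _ _ (Submodule.subset_span
    ⟨⟨⟨w, congrArg Subtype.val hw⟩, ⟨m, (mem_restrictSupport_iff k).1 hf hm⟩⟩, rfl⟩)

theorem linearIndependent_toCyc (h : IsAdapted Q prec β) (hword : ∀ w, IsReducedExpr w (word w))
    (hμ : IsSorted prec μ.1)
    (hg : ∀ r, UnitMonic r ((gPoly Q a prec ν.1 r).degreeOf r) (gPoly Q a prec ν.1 r)) :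
    LinearIndependent k fun t : BasisIndex Q a prec μ.1 ν.1 =>
      toCyc Q β a (klrτWord Q β (word t.1.1) * monom (klrX Q β) t.2.1 * klrE Q ν) := by
  classical
  rw [linearIndependent_iff']
  intro s c hs t ht
  let ex : BasisIndex Q a prec μ.1 ν.1 → Fin n →₀ ℕ := fun t => Finsupp.equivFunOnFinite.symm t.2.1
  -- Grouping a linear relation by permutations turns it into `∑ τ_w p_w e(ν)` with `p_w` of degree
  -- below `N_r` in each variable.
  let p : Equiv.Perm (Fin n) → MvPolynomial (Fin n) k := fun w =>
    ∑ t ∈ s.filter fun t => t.1.1 = w, monomial (ex t) (c t)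
  have hmem : ∑ t ∈ s, klrτWord Q β (word t.1.1) * polyHom Q β (monomial (ex t) (c t)) * klrE Q ν ∈
      cycIdeal Q β n a := by
    rw [← toCyc_eq_zero_iff, ← hs, ← toCycLin_apply, map_sum]
    refine Finset.sum_congr rfl fun t _ => ?_
    have h2 : monomial (ex t) (c t) = c t • monomial (ex t) (1 : k) := by
      rw [smul_monomial, smul_eq_mul, mul_one]
    rw [h2, map_smul, mul_smul_comm, smul_mul_assoc, map_smul, polyHom_monomial]
    rfl
  have hp : ∀ w, Seqs.act w ν = μ → p w ∈ gIdeal Q a prec n ν := by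
    intro w hw
    refine mem_of_sum_transition_mem h hword hμ _ p (fun f => ?_) hw
    convert ract_mem_of_mem_cycIdeal h hmem (Pi.single μ f) ν using 1
    rw [ract_sum, Finset.sum_apply]
    simp only [ract_klrτWord_mul]
    rw [← Finset.sum_fiberwise_of_maps_to (s := s)
      (t := Finset.univ.filter fun w : Equiv.Perm (Fin n) => Seqs.act w ν = μ)
      (g := fun t => t.1.1)
      fun t _ => Finset.mem_filter.2 ⟨Finset.mem_univ _, Subtype.ext t.1.2⟩]
    refine Finset.sum_congr rfl fun w _ => ?_
    rw [Finset.mul_sum]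
    refine Finset.sum_congr rfl fun t ht => ?_
    rw [(Finset.mem_filter.1 ht).2]
  have hz : p t.1.1 = 0 := by
    refine eq_zero_of_mem_span hg (fun r t hrt => gPolyAux_mem_degLT h hrt ν) n le_rfl
      (gIdeal_le ν (hp _ (Subtype.ext t.1.2))) fun r _ => sum_mem fun t' _ => ?_
    exact monomial_mem_degLT (t'.2.2 r) _
  have hcoeff := congrArg (coeff (ex t)) hz
  rw [coeff_sum, coeff_zero, Finset.sum_eq_single_of_mem t (by simp [ht]), coeff_monomial,
    if_pos rfl] at hcoeff
  · exact hcoeff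
  · intro t' ht' hne
    rw [coeff_monomial, if_neg]
    intro e
    refine hne (Prod.ext (Subtype.ext (Finset.mem_filter.1 ht').2) (Subtype.ext ?_))
    exact Finsupp.equivFunOnFinite.symm.injective e

/-- A unit constant among the polynomials `g` makes 1 annihilate the space. -/
theorem biweightSpace_eq_bot (h : IsAdapted Q prec β) (hμ : IsSorted prec μ.1) {q : Fin n}
    (hq : UnitMonic q 0 (gPoly Q a prec ν.1 q)) : biweightSpace Q a μ ν = ⊥ := by
  obtain ⟨u, hu⟩ := hq.eq_C
  have h1 : Annihilates Q a μ ν (C ((u⁻¹ : kˣ) : k) * gPoly Q a prec ν.1 q) :=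
    (annihilates_gPolyAux h hμ q.val ν).mul_left _
  rw [hu, ← C_mul, Units.inv_mul, C_1] at h1
  refine (Submodule.eq_bot_iff _).2 fun z hz => ?_
  obtain ⟨y, rfl⟩ := mem_biweightSpace_iff.1 hz
  have h2 := h1 y
  rw [map_one, one_mul] at h2
  exact toCyc_eq_zero_iff.2 h2

end Basis

end CycKLR

end

/-! ### The main theorem. -/

open CycKLR in
theorem mainTheorem7 {I P k : Type*} [Fintype I] [DecidableEq I]
    [AddCommGroup P] [Module.Free ℤ P] [Module.Finite ℤ P]
    [CommRing k] [IsDomain k] (𝒜 : ℕ → AddSubgroup k) [GradedRing 𝒜]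
    (D : CartanDatum I P)
    (Q : I → I → MvPolynomial (Fin 2) k) (hQ : IsQMatrix D 𝒜 Q)
    (Λ : P) (hΛ : D.IsDominant Λ)
    (a : I → Polynomial k) (ha : IsCyclotomicFamily D 𝒜 Λ a)
    (n : ℕ) (β : I → ℕ) (hβ : ∑ i, β i = n)
    {p : ℕ} (c : Fin p → I) (hc : Function.Injective c) (m : Fin p → ℕ)
    (νt : Seqs I n β) (hνt : IsBlockSeq c m νt.1)
    (ν : Seqs I n β)
    (word : Equiv.Perm (Fin n) → List (Fin (n - 1))) (hword : ∀ w, IsReducedExpr w (word w)) :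
    let v : BasisIndex Q a (colourLT c) νt.1 ν.1 → CycKLRAlg Q β n a :=
      fun t => toCyc Q β a
        (klrτWord Q β (word t.1.1) * monom (klrX Q β) t.2.1 * klrE Q ν)
    LinearIndependent k v ∧ Submodule.span k (Set.range v) = biweightSpace Q a νt ν := by
  intro v
  have h := hQ.isAdapted hc hνt
  have hμ := hνt.isSorted
  -- If some `g` is a unit constant, then `N_q = 0` leaves no admissible exponents and the space is
  -- zero. Otherwise every `g` has a unit leading coefficient, so in particular none is zero.
  by_cases hex : ∃ q, UnitMonic q 0 (gPoly Q a (colourLT c) ν.1 q)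
  · obtain ⟨q, hq⟩ := hex
    have : IsEmpty (BasisIndex Q a (colourLT c) νt.1 ν.1) :=
      ⟨fun t => absurd (t.2.2 q) (by rw [hq.degreeOf]; exact Nat.not_lt_zero _)⟩
    refine ⟨linearIndependent_empty_type, ?_⟩
    rw [biweightSpace_eq_bot h hμ hq, Set.range_eq_empty, Submodule.span_empty]
  · have hg : ∀ r, UnitMonic r ((gPoly Q a (colourLT c) ν.1 r).degreeOf r)
        (gPoly Q a (colourLT c) ν.1 r) := by
      intro r
      rcases unitMonic_gPolyAux (a := a) h ha.monic (fun i j hij => ⟨_, hQ.unitMonic hij⟩) r.2 ν with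
        ⟨N, hN⟩ | ⟨q, -, hq⟩
      · have hN : UnitMonic r N (gPoly Q a (colourLT c) ν.1 r) := hN
        rwa [hN.degreeOf]
      · exact absurd ⟨q, hq⟩ hex
    refine ⟨linearIndependent_toCyc h hword hμ hg, le_antisymm (Submodule.span_le.2 ?_)
      (biweightSpace_le h hword hμ fun w hw f => toCyc_mem_span h hword hμ hg hw f)⟩
    rintro _ ⟨t, rfl⟩
    have h1 := klrτWord_mul_polyHom_mul_klrE (Q := Q) (μ := νt) (word t.1.1)
      (MvPolynomial.monomial (Finsupp.equivFunOnFinite.symm t.2.1) 1) (hword t.1.1)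
      (Subtype.ext t.1.2)
    rw [polyHom_monomial] at h1
    refine mem_biweightSpace_iff.2
      ⟨klrτWord Q β (word t.1.1) * monom (klrX Q β) t.2.1, congrArg (toCyc Q β a) ?_⟩
    rw [← mul_assoc (klrE Q νt), mul_assoc (klrE Q νt * _)]
    exact h1.symm
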